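/- All spaces are composed of qubits and $\|X\|_{\mathrm{tr}}=\operatorname{tr}\sqrt{X^*X}$. For a linear map $\Phi:\mathrm L(\mathcal H)\to\mathrm L(\mathcal K)$ let $\|\Phi\|_\diamond=\sup_{0\ne X\in \mathrm L(\mathcal H\otimes\mathcal H)}\|(\Phi\otimes \mathrm{id}_{\mathcal H})(X)\|_{\mathrm{tr}}/\|X\|_{\mathrm{tr}}$. Circuits are mixed-state quantum circuits: sequences of unitary gates from a fixed universal set (Hadamard, $T$, controlled-not, Toffoli), gates that introduce an ancilla qubit in state $|0\rangle$, and gates that trace out a qubit. An instance is a circuit $E$ which takes $m$ classical key bits and a quantum state on $\mathcal H$ to a state on $\mathcal K$, where $\dim\mathcal K\ge\dim\mathcal H$ and $\mathcal K$ has at least one qubit; for $k\in\{0,1\}^m$ it implements the channel $E_k$. Regard $\mathcal H$ as the subspace $\mathcal H\otimes|0\cdots0\rangle$ of $\mathcal K$. For $0<\delta\le 1$ and a polynomial $p$, the promise problem $\mathrm{DI}_{\varepsilon,\delta}$ (Detecting Insecure Encryption) is to decide between: * Yes: there is a subspace $S\subseteq\mathcal H$ with $\dim S\ge(\dim\mathcal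 H)^{1-\delta}$ such that for every finite-dimensional reference space $\mathcal R$, every density operator $\rho$ on $S\otimes\mathcal R$ and every key $k$, $\|(E_k\otimes\mathrm{id}_{\mathcal R})(\rho)-\rho\|_{\mathrm{tr}}\le\varepsilon$. * No: $\|\Omega-2^{-m}\sum_kE_k\|_\diamond\le\varepsilon$, where $\Omega(X)=\operatorname{tr}(X)\,\mathbb 1_{\mathcal K}/\dim\mathcal K$, and there is a circuit $D$, of size at most $p$ of the size of $E$, such that $\|D_k\circ E_k-\mathrm{id}_{\mathcal H}\|_\diamond\le\varepsilon$ for all $k$. Protocol. On input $E$ and a proof state on $(\mathcal H\otimes\mathcal R)^{\otimes2}$ with $\dim\mathcal R=\dim\mathcal H$, the verifier picks independent uniformly random keys $k_1,k_2\in\{0,1\}^m$, applies $(E_{k_1}\otimes\mathrm{id}_{\mathcal R})\otimes(E_{k_2}\otimes\mathrm{id}_{\mathcal R})$ to the proof state, performs the swap test (the projective measurement $\{(\mathbb 1+W)/2,(\mathbb 1-W)/2\}$, $W$ the swap of the two copies of $\mathcal K\otimes\mathcal R$), and accepts if the outcome is symmetric. Proposition. For $0<\varepsilon<1/8$, $0<\delta\le1$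 and every polynomial $p$, this protocol is a QMA protocol for $\mathrm{DI}_{\varepsilon,\delta}$, with completeness $1-\varepsilon$ and soundness $\tfrac34+\varepsilon<1-\varepsilon$. That is, there are circuits $V_E$, whose descriptions are computed from the description of $E$ by a deterministic Turing machine in polynomial time (and which do not depend on $\varepsilon,\delta,p$), such that measuring the single output qubit of $V_E$ gives $1$ with exactly the acceptance probability of the protocol on every proof state, and: * if $E$ is a yes instance, some proof state of the form $|\psi\rangle\otimes|\psi\rangle$ with a unit vector $|\psi\rangle\in\mathcal H\otimes\mathcal R$ is accepted with probability at least $1-\varepsilon$; * if $E$ is a no instance, every proof state is accepted with probability at most $\tfrac12+\tfrac1{2\dim\mathcal K}+\varepsilon\ (\le\tfrac34+\varepsilon)$. -/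

import Mathlib

open scoped ENNReal ComplexOrder

noncomputable section

/-! ### States, trace norm, diamond norm -/

/-- Labels of the computational basis of an `n`-qubit space. -/
abbrev Qubits (n : ℕ) : Type := Fin n → Bool

/-- Linear operators on the Hilbert space `ℂ^A`. -/
abbrev Op (A : Type) : Type := Matrix A A ℂ

/-- Density operators. -/
def IsDensity {A : Type} [Fintype A] (ρ : Op A) : Prop :=
  ρ.PosSemidef ∧ ρ.trace = 1

/-- The trace norm `tr √(X* X)`, i.e. the sum of the singular values of `X`. -/
def traceNorm {A : Type} [Fintype A] [DecidableEq A] (X : Op A) : ℝ :=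
  ∑ i, Real.sqrt ((Matrix.isHermitian_conjTranspose_mul_self X).eigenvalues i)

/-- `Φ ⊗ id_R`, acting blockwise. -/
def tensorId {A B : Type} (Φ : Op A →ₗ[ℂ] Op B) (R : Type) : Op (A × R) →ₗ[ℂ] Op (B × R) where
  toFun X := Matrix.of fun x y => Φ (fun a a' => X (a, x.2) (a', y.2)) x.1 y.1
  map_add' X Y := by
    ext x y
    exact congrFun (congrFun (Φ.map_add (fun a a' => X (a, x.2) (a', y.2))
      (fun a a' => Y (a, x.2) (a', y.2))) x.1) y.1
  map_smul' c X := by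
    ext x y
    exact congrFun (congrFun (Φ.map_smul c (fun a a' => X (a, x.2) (a', y.2))) x.1) y.1

/-- `id_R ⊗ Φ`, acting blockwise. -/
def idTensor {A B : Type} (R : Type) (Φ : Op A →ₗ[ℂ] Op B) : Op (R × A) →ₗ[ℂ] Op (R × B) where
  toFun X := Matrix.of fun x y => Φ (fun a a' => X (x.1, a) (y.1, a')) x.2 y.2
  map_add' X Y := by
    ext x y
    exact congrFun (congrFun (Φ.map_add (fun a a' => X (x.1, a) (y.1, a'))
      (fun a a' => Y (x.1, a) (y.1, a'))) x.2) y.2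
  map_smul' c X := by
    ext x y
    exact congrFun (congrFun (Φ.map_smul c (fun a a' => X (x.1, a) (y.1, a'))) x.2) y.2

/-- `Φ ⊗ Ψ`. -/
def mapTensor {A A' B B' : Type} (Φ : Op A →ₗ[ℂ] Op B) (Ψ : Op A' →ₗ[ℂ] Op B') :
    Op (A × A') →ₗ[ℂ] Op (B × B') :=
  tensorId Φ B' ∘ₗ idTensor A Ψ

/-- The diamond norm `sup_X ‖(Φ ⊗ id_H)(X)‖_tr / ‖X‖_tr` over nonzero `X ∈ L(H ⊗ H)`,
for `Φ : L(H) → L(K)`. -/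
def diamondNorm {A B : Type} [Fintype A] [DecidableEq A] [Fintype B] [DecidableEq B]
    (Φ : Op A →ₗ[ℂ] Op B) : ℝ≥0∞ :=
  ⨆ (X : Op (A × A)) (_ : X ≠ 0),
    ENNReal.ofReal (traceNorm (tensorId Φ A X)) / ENNReal.ofReal (traceNorm X)

/-- The completely depolarizing channel, `X ↦ tr(X) 𝟙 / dim K`. -/
def depolarizing (A B : Type) [Fintype A] [Fintype B] [DecidableEq B] :
    Op A →ₗ[ℂ] Op B :=
  LinearMap.smulRight (Matrix.traceLinearMap A ℂ ℂ) ((Fintype.card B : ℂ)⁻¹ • (1 : Op B))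

/-! ### Mixed-state quantum circuits -/

/-- Gates with `n` input wires and `m` output wires: Hadamard, the `π/8` gate `T`,
controlled-not, Toffoli (targets come last), the introduction of an ancilla in state `|0⟩` (it
becomes wire `0`, the old wire `i` becomes wire `i + 1`), and tracing out a wire. -/
inductive QGate : ℕ → ℕ → Type
  | hadamard {n : ℕ} (i : Fin n) : QGate n n
  | tGate {n : ℕ} (i : Fin n) : QGate n n
  | cnot {n : ℕ} (i j : Fin n) (hij : i ≠ j) : QGate n n
  | toffoli {n : ℕ} (i j k : Fin n) (hij : i ≠ j) (hik : i ≠ k) (hjk : j ≠ k) : QGate n n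
  | ancilla {n : ℕ} : QGate n (n + 1)
  | discard {n : ℕ} (i : Fin (n + 1)) : QGate (n + 1) n

/-- Circuits with `n` input qubits and `m` output qubits: sequences of gates, the first gate of the
sequence being applied first. -/
inductive QCircuit : ℕ → ℕ → Type
  | nil {n : ℕ} : QCircuit n n
  | cons {n k m : ℕ} (g : QGate n k) (c : QCircuit k m) : QCircuit n m

/-- Hadamard gate on wire `i`. -/
def hadamardOp {n : ℕ} (i : Fin n) : Op (Qubits n) := fun x y =>
  if ∀ j, j ≠ i → x j = y j then
    ((Real.sqrt 2 : ℝ) : ℂ)⁻¹ * (if x i = true ∧ y i = true then -1 else 1)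
  else 0

/-- The gate `diag(1, exp(iπ/4))` on wire `i`. -/
def tOp {n : ℕ} (i : Fin n) : Op (Qubits n) :=
  Matrix.diagonal fun x => if x i = true then Complex.exp (Complex.I * (Real.pi / 4 : ℝ)) else 1

/-- Controlled-not with control `i` and target `j`. -/
def cnotOp {n : ℕ} (i j : Fin n) : Op (Qubits n) := fun x y =>
  if x = Function.update y j (xor (y j) (y i)) then 1 else 0

/-- Toffoli gate with controls `i`, `j` and target `k`. -/
def toffoliOp {n : ℕ} (i j k : Fin n) : Op (Qubits n) := fun x y =>
  if x = Function.update y k (xor (y k) (y i && y j)) then 1 else 0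

/-- `ρ ↦ U ρ U*`. -/
def conjMap {A : Type} [Fintype A] (U : Op A) : Op A →ₗ[ℂ] Op A :=
  LinearMap.mulLeft ℂ U ∘ₗ LinearMap.mulRight ℂ U.conjTranspose

/-- `ρ ↦ |0⟩⟨0| ⊗ ρ`, the new qubit being wire `0`. -/
def ancillaMap (n : ℕ) : Op (Qubits n) →ₗ[ℂ] Op (Qubits (n + 1)) where
  toFun ρ := Matrix.of fun x y => if x 0 = false ∧ y 0 = false then ρ (Fin.tail x) (Fin.tail y) else 0
  map_add' ρ σ := by
    ext x y
    by_cases h : x 0 = false ∧ y 0 = false <;> simp [h]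
  map_smul' c ρ := by
    ext x y
    by_cases h : x 0 = false ∧ y 0 = false <;> simp [h]

/-- The partial trace over wire `i`. -/
def discardMap {n : ℕ} (i : Fin (n + 1)) : Op (Qubits (n + 1)) →ₗ[ℂ] Op (Qubits n) where
  toFun ρ := Matrix.of fun x y =>
    ∑ b : Bool, ρ (Fin.insertNth (α := fun _ => Bool) i b x)
      (Fin.insertNth (α := fun _ => Bool) i b y)
  map_add' ρ σ := by
    ext x y
    simp [Finset.sum_add_distrib]
  map_smul' c ρ := by
    ext x y
    simp [mul_add]

/-- The channel of a gate. -/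
def QGate.channel {n m : ℕ} : QGate n m → (Op (Qubits n) →ₗ[ℂ] Op (Qubits m))
  | .hadamard i => conjMap (hadamardOp i)
  | .tGate i => conjMap (tOp i)
  | .cnot i j _ => conjMap (cnotOp i j)
  | .toffoli i j k _ _ _ => conjMap (toffoliOp i j k)
  | .ancilla => ancillaMap _
  | .discard i => discardMap i

/-- The channel implemented by a circuit. -/
def QCircuit.channel {n m : ℕ} : QCircuit n m → (Op (Qubits n) →ₗ[ℂ] Op (Qubits m))
  | .nil => LinearMap.id
  | .cons g c => c.channel ∘ₗ g.channel

/-- The number of gates. -/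
def QCircuit.gateCount {n m : ℕ} : QCircuit n m → ℕ
  | .nil => 0
  | .cons _ c => c.gateCount + 1

/-- The size of a circuit: its number of input qubits plus its number of gates. -/
def QCircuit.size {n m : ℕ} (c : QCircuit n m) : ℕ := n + c.gateCount

/-- `ρ ↦ |k⟩⟨k| ⊗ ρ`, the `m` qubits of `|k⟩` being the first ones. -/
def attachKey {m : ℕ} (n : ℕ) (k : Qubits m) : Op (Qubits n) →ₗ[ℂ] Op (Qubits (m + n)) where
  toFun ρ := Matrix.of fun x y =>
    if (fun i => x (Fin.castAdd n i)) = k ∧ (fun i => y (Fin.castAdd n i)) = k then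
      ρ (fun i => x (Fin.natAdd m i)) (fun i => y (Fin.natAdd m i)) else 0
  map_add' ρ σ := by
    ext x y
    by_cases h : (fun i => x (Fin.castAdd n i)) = k ∧ (fun i => y (Fin.castAdd n i)) = k <;>
      simp [h]
  map_smul' c ρ := by
    ext x y
    by_cases h : (fun i => x (Fin.castAdd n i)) = k ∧ (fun i => y (Fin.castAdd n i)) = k <;>
      simp [h]

/-- The channel implemented by a circuit whose first `m` input qubits are set to the classical
string `k`. -/
def QCircuit.keyed {m n l : ℕ} (c : QCircuit (m + n) l) (k : Qubits m) :
    Op (Qubits n) →ₗ[ℂ] Op (Qubits l) :=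
  c.channel ∘ₗ attachKey n k

/-! ### Descriptions of circuits as strings over a finite alphabet -/

/-- The alphabet used to write down circuits. -/
inductive CircuitSym
  | one | sep | hadamard | tGate | cnot | toffoli | ancilla | discard
  deriving DecidableEq

instance : Fintype CircuitSym where
  elems := {.one, .sep, .hadamard, .tGate, .cnot, .toffoli, .ancilla, .discard}
  complete x := by cases x <;> decide

/-- A natural number in unary, with an end marker. -/
def unary (i : ℕ) : List CircuitSym := List.replicate i CircuitSym.one ++ [CircuitSym.sep]

/-- The description of a gate: its name, followed by the wires it acts on. -/
def QGate.symbols {n m : ℕ} : QGate n m → List CircuitSym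
  | .hadamard i => CircuitSym.hadamard :: unary i
  | .tGate i => CircuitSym.tGate :: unary i
  | .cnot i j _ => CircuitSym.cnot :: (unary i ++ unary j)
  | .toffoli i j k _ _ _ => CircuitSym.toffoli :: (unary i ++ unary j ++ unary k)
  | .ancilla => [CircuitSym.ancilla]
  | .discard i => CircuitSym.discard :: unary i

/-- The description of a gate sequence. -/
def QCircuit.symbols {n m : ℕ} : QCircuit n m → List CircuitSym
  | .nil => []
  | .cons g c => g.symbols ++ c.symbols

theorem unary_append_inj {i j : ℕ} {l l' : List CircuitSym} (h : unary i ++ l = unary j ++ l') :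
    i = j ∧ l = l' := by
  induction i generalizing j with
  | zero => cases j with
    | zero => simpa [unary] using h
    | succ j => simp [unary, List.replicate_succ] at h
  | succ i ih => cases j with
    | zero => simp [unary, List.replicate_succ] at h
    | succ j =>
      have := @ih j (by simpa [unary, List.replicate_succ] using h)
      exact ⟨by omega, this.2⟩

theorem QGate.symbols_append_inj {n k k' : ℕ} (g : QGate n k) (g' : QGate n k')
    {l l' : List CircuitSym} (h : g.symbols ++ l = g'.symbols ++ l') :
    k = k' ∧ HEq g g' ∧ l = l' := by
  cases g <;> cases g' <;> simp only [QGate.symbols, List.cons_append, List.append_assoc,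
    List.cons.injEq, reduceCtorEq, false_and, true_and, List.nil_append] at h
  · obtain ⟨h1, h2⟩ := unary_append_inj h
    simp [Fin.ext h1, h2]
  · obtain ⟨h1, h2⟩ := unary_append_inj h
    simp [Fin.ext h1, h2]
  · obtain ⟨h1, h2⟩ := unary_append_inj h
    obtain ⟨h3, h4⟩ := unary_append_inj h2
    simp [Fin.ext h1, Fin.ext h3, h4]
  · obtain ⟨h1, h2⟩ := unary_append_inj h
    obtain ⟨h3, h4⟩ := unary_append_inj h2
    obtain ⟨h5, h6⟩ := unary_append_inj h4
    simp [Fin.ext h1, Fin.ext h3, Fin.ext h5, h6]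
  · simp [h]
  · obtain ⟨h1, h2⟩ := unary_append_inj h
    simp [Fin.ext h1, h2]

theorem QCircuit.symbols_inj {n m m' : ℕ} (c : QCircuit n m) (c' : QCircuit n m')
    (h : c.symbols = c'.symbols) : m = m' ∧ HEq c c' := by
  induction c with
  | nil => cases c' with
    | nil => simp
    | cons g c => cases g <;> simp [QCircuit.symbols, QGate.symbols] at h
  | cons g c ih => cases c' with
    | nil => cases g <;> simp [QCircuit.symbols, QGate.symbols] at h
    | cons g' c' =>
      obtain ⟨rfl, h2, h3⟩ := QGate.symbols_append_inj g g' h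
      obtain ⟨rfl, h4⟩ := ih c' h3
      cases h2
      cases h4
      simp

/-! ### QMA protocols -/

/-- A circuit with a single output qubit, bundled with the number of its input qubits. -/
abbrev VerifierCircuit : Type := Σ w : ℕ, QCircuit w 1

/-- The description of a verifier circuit. -/
def VerifierCircuit.encode (V : VerifierCircuit) : List CircuitSym := unary V.1 ++ V.2.symbols

theorem VerifierCircuit.encode_injective : Function.Injective VerifierCircuit.encode := by
  rintro ⟨w, c⟩ ⟨w', c'⟩ h
  obtain ⟨h1, h2⟩ := unary_append_inj h
  dsimp only at h1 h2
  subst h1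
  obtain ⟨-, h3⟩ := QCircuit.symbols_inj c c' h2
  rw [eq_of_heq h3]

/-- The probability that measuring the output qubit of a one-output circuit in the computational
basis gives `|1⟩`. -/
def QCircuit.acceptProb {w : ℕ} (c : QCircuit w 1) (ρ : Op (Qubits w)) : ℝ :=
  (c.channel ρ (fun _ => true) (fun _ => true)).re

/-- A promise problem. -/
structure PromiseProblem (α : Type) where
  yes : Set α
  no : Set α

/-- `V` is a QMA protocol for the promise problem `L` with completeness `c` and soundness `s`: from
an instance `x`, written with the encoding `enc`, a deterministic Turing machine finds in polynomial
time the description of the circuit that the verifier applies to the witness; there is a gap between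
the constants `s` and `c`; on a yes instance some witness state is accepted with probability at
least `c`, and on a no instance every state is accepted with probability at most `s`. -/
structure IsQMAProtocol {α : Type} (enc : α → List CircuitSym) (L : PromiseProblem α) (c s : ℝ)
    (V : α → VerifierCircuit) : Prop where
  polyTime : Nonempty (Turing.TM2ComputableInPolyTime enc VerifierCircuit.encode V)
  gap : 0 ≤ s ∧ s < c ∧ c ≤ 1
  complete : ∀ x ∈ L.yes, ∃ ρ, IsDensity ρ ∧ c ≤ (V x).2.acceptProb ρ
  sound : ∀ x ∈ L.no, ∀ ρ, IsDensity ρ → (V x).2.acceptProb ρ ≤ s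

/-! ### Detecting insecure encryption -/

/-- A circuit that takes `m` classical key bits and `n` qubits to `l ≥ n` qubits (at least one). -/
structure EncryptionCircuit where
  m : ℕ
  n : ℕ
  l : ℕ
  le : n ≤ l
  pos : 0 < l
  circuit : QCircuit (m + n) l

namespace EncryptionCircuit

/-- The description of an instance. -/
def encode (E : EncryptionCircuit) : List CircuitSym :=
  unary E.m ++ unary E.n ++ unary E.l ++ E.circuit.symbols

theorem encode_injective : Function.Injective encode := by
  rintro ⟨m, n, l, h, hp, c⟩ ⟨m', n', l', h', hp', c'⟩ e
  simp only [encode, List.append_assoc] at e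
  obtain ⟨rfl, e⟩ := unary_append_inj e
  obtain ⟨rfl, e⟩ := unary_append_inj e
  obtain ⟨rfl, e⟩ := unary_append_inj e
  obtain ⟨-, h3⟩ := QCircuit.symbols_inj c c' e
  rw [eq_of_heq h3]

/-- The channel `E_k`. -/
def chan (E : EncryptionCircuit) (k : Qubits E.m) : Op (Qubits E.n) →ₗ[ℂ] Op (Qubits E.l) :=
  E.circuit.keyed k

/-- The average `2^{-m} ∑_k E_k`. -/
def average (E : EncryptionCircuit) : Op (Qubits E.n) →ₗ[ℂ] Op (Qubits E.l) :=
  ((2 : ℂ) ^ E.m)⁻¹ • ∑ k : Qubits E.m, E.chan k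

end EncryptionCircuit

/-- The inclusion of the `n`-qubit space into the `l`-qubit space, `|x⟩ ↦ |x⟩|0…0⟩`. It is the
identity if `n = l`. -/
def padding {n l : ℕ} (h : n ≤ l) : Matrix (Qubits l) (Qubits n) ℂ := fun y x =>
  if (∀ i : Fin n, y (Fin.castLE h i) = x i) ∧ (∀ j : Fin l, n ≤ j → y j = false) then 1 else 0

/-- `X ↦ J X J*` on operators, with `J` the inclusion `padding h`. -/
def paddingMap {n l : ℕ} (h : n ≤ l) : Op (Qubits n) →ₗ[ℂ] Op (Qubits l) where
  toFun X := padding h * X * (padding h).conjTranspose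
  map_add' X Y := by rw [Matrix.mul_add, Matrix.add_mul]
  map_smul' c X := by simp

/-- `ρ` is a density operator on `S ⊗ ℂ^R`: a density operator whose range is contained in
`S ⊗ ℂ^R`, the space of the vectors all of whose `R`-slices lie in `S`. -/
def IsDensityOn {A R : Type} [Fintype A] [Fintype R] (S : Submodule ℂ (A → ℂ))
    (ρ : Op (A × R)) : Prop :=
  IsDensity ρ ∧ ∀ v : A × R → ℂ, ∀ r : R, (fun a => (ρ.mulVec v) (a, r)) ∈ S

/-- The problem of detecting insecure encryption. The decryption circuit of a no instance has size
at most `p` of the size of the encryption circuit. -/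
def detectInsecure (ε δ : ℝ) (p : Polynomial ℕ) : PromiseProblem EncryptionCircuit where
  yes := {E | ∃ S : Submodule ℂ (Qubits E.n → ℂ),
    ((2 : ℝ) ^ E.n) ^ (1 - δ) ≤ (Module.finrank ℂ S : ℝ) ∧
    ∀ (R : Type) [Fintype R] [DecidableEq R] (ρ : Op (Qubits E.n × R)), IsDensityOn S ρ →
      ∀ k : Qubits E.m,
        traceNorm (tensorId (E.chan k) R ρ - tensorId (paddingMap E.le) R ρ) ≤ ε}
  no := {E | diamondNorm (depolarizing (Qubits E.n) (Qubits E.l) - E.average) ≤ ENNReal.ofReal ε ∧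
    ∃ D : QCircuit (E.m + E.l) E.n, D.size ≤ p.eval E.circuit.size ∧
      ∀ k : Qubits E.m,
        diamondNorm (D.keyed k ∘ₗ E.chan k - LinearMap.id) ≤ ENNReal.ofReal ε}

/-! ### The protocol -/

/-- The swap operator `W (ψ ⊗ φ) = φ ⊗ ψ`. -/
def swapOp (A : Type) [DecidableEq A] : Op (A × A) := fun x y => if x = y.swap then 1 else 0

/-- The projection `(𝟙 + W) / 2` onto the symmetric subspace. -/
def symProj (A : Type) [DecidableEq A] : Op (A × A) := (2 : ℂ)⁻¹ • (1 + swapOp A)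

/-- The acceptance probability of the protocol on a proof state `ρ` on `(H ⊗ R) ⊗ (H ⊗ R)` with
`R = H`: for independent uniformly random keys `k₁, k₂`, the probability of the symmetric outcome of
the swap test on `((E_{k₁} ⊗ id_R) ⊗ (E_{k₂} ⊗ id_R))(ρ)`. -/
def EncryptionCircuit.protocolAcceptProb (E : EncryptionCircuit)
    (ρ : Op ((Qubits E.n × Qubits E.n) × (Qubits E.n × Qubits E.n))) : ℝ :=
  ((2 : ℝ) ^ E.m * 2 ^ E.m)⁻¹ * ∑ k₁ : Qubits E.m, ∑ k₂ : Qubits E.m,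
    (symProj (Qubits E.l × Qubits E.n) *
      mapTensor (tensorId (E.chan k₁) (Qubits E.n)) (tensorId (E.chan k₂) (Qubits E.n)) ρ).trace.re

/-- Concatenation of the four registers `H, R, H, R` of a proof state. -/
def joinRegisters {n : ℕ} (x : (Qubits n × Qubits n) × (Qubits n × Qubits n)) :
    Qubits ((n + n) + (n + n)) :=
  Fin.append (Fin.append x.1.1 x.1.2) (Fin.append x.2.1 x.2.2)

end

/-! The swap test on a state σ accepts with probability (tr σ + tr Wσ)/2. Independent keys turn the
tested state into (Ē ⊗ id)^{⊗2}(ρ), where Ē is the average of the channels E_k (`swapTestInput_eq`).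
The test therefore probes whether Ē keeps some input nearly pure or is nearly completely
depolarizing.

Completeness. On ψ ⊗ ψ the acceptance probability is (1 + tr σ²)/2 with σ = (Ē ⊗ id)(|ψ⟩⟨ψ|)
(`protocolAcceptProb_ketbra`). If ψ is a unit vector of S ⊗ R, every E_k, and hence Ē, maps it to
within ε in trace norm of the pure state P of the padded vector. Since tr σ² = 1 + tr P(σ - P) + tr
σ(σ - P) and both P and σ are contractions, tr σ² ≥ 1 - 2ε (`one_sub_le_trace_mul_self`).

Soundness. Replacing Ē by Ω in the two copies, one copy at a time, changes tr Wσ by at most 2ε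
(`norm_trace_mapTensor_sub_le`). After both replacements the ciphertext registers are maximally
mixed and contribute 1/dim K, while the reference registers contribute the trace of ρ against a
partial swap, of real part at most 1 (`re_trace_swapOp_mul_depolarizing_le`). The replaced channel
acts beside a reference larger than H, whereas the diamond norm provides only a copy of H. A Schmidt
decomposition closes this gap (`exists_contraction_mul`, `norm_trace_tensorId_le`). Of trace-norm
duality only the inequality |tr MX| ≤ ‖X‖_tr for contractions M is needed (`norm_trace_mul_le`).

The circuit. A random key bit is a Hadamard-rotated ancilla that has been copied to a discarded
qubit. The swap test uses a control qubit in state (|0⟩ - |1⟩)/√2, so that after the last Hadamard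
gate the outcome 1 is the symmetric one. Operators are treated as functions of the bits on
infinitely many wires, so that most gates become substitutions and widths leave the types
(`Realizes`); `exists_verifier` assembles the parts.

The machine. The description of the circuit is a concatenation of loops over words whose wire
numbers are sums of m, n, l and a loop index. A small language of stack programs, with a
compositional running-time predicate (`StackProg.Runs`), writes it in quadratic time. As stacks grow
at the front, everything is written from back to front. -/

noncomputable section

/-! ### Structured programs for multi-stack machines -/

/-- Structured programs acting on stacks indexed by `K`, all of them over the alphabet
`CircuitSym`. `emit k w` pushes the word `w` on `k`; `transfer k ts` pops the symbols of `k` until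
it is empty, pushing each of them on all stacks in `ts`; `readUnary k t` pops ones from `k` and
pushes them on `t`, up to and including the first symbol of `k` that is not a one; `loop k p` runs
`p` once for each symbol popped from `k`, until `k` is empty. -/
inductive StackProg (K : Type)
  | emit (k : K) (w : List CircuitSym)
  | transfer (k : K) (ts : List K)
  | readUnary (k t : K)
  | seq (p q : StackProg K)
  | loop (k : K) (p : StackProg K)

namespace StackProg

open Turing

variable {K : Type}

/-- The control points of a program. -/
def Label : StackProg K → Type
  | emit _ _ => Unit
  | transfer _ _ => Unit
  | readUnary _ _ => Unit
  | seq p q => p.Label ⊕ q.Label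
  | loop _ p => Option p.Label

/-- A program has finitely many control points. -/
instance labelFintype : (p : StackProg K) → Fintype p.Label
  | emit _ _ => inferInstanceAs (Fintype Unit)
  | transfer _ _ => inferInstanceAs (Fintype Unit)
  | readUnary _ _ => inferInstanceAs (Fintype Unit)
  | seq p q =>
    letI := labelFintype p
    letI := labelFintype q
    inferInstanceAs (Fintype (p.Label ⊕ q.Label))
  | loop _ p =>
    letI := labelFintype p
    inferInstanceAs (Fintype (Option p.Label))

/-- The control point at which a program starts. -/
def entry : (p : StackProg K) → p.Label
  | emit _ _ => ()
  | transfer _ _ => ()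
  | readUnary _ _ => ()
  | seq p _ => Sum.inl p.entry
  | loop _ _ => none

/-- Statements of a machine whose only register holds the symbol popped last. -/
abbrev Instr (K Λ : Type) : Type := TM2.Stmt (fun _ : K => CircuitSym) Λ (Option CircuitSym)

/-- Stack contents. -/
abbrev Stacks (K : Type) : Type := K → List CircuitSym

/-- Push a word. -/
def pushWord {Λ : Type} (k : K) : List CircuitSym → Instr K Λ → Instr K Λ
  | [], q => q
  | a :: w, q => pushWord k w (.push k (fun _ => a) q)

/-- Push the register on several stacks. -/
def pushAll {Λ : Type} : List K → Instr K Λ → Instr K Λ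
  | [], q => q
  | k :: ks, q => .push k (fun v => v.getD .one) (pushAll ks q)

/-- The statements of a program, its control points being embedded into `Λ` by `emb`; the control
is passed to `exit` in the end. -/
def code {Λ : Type} : (p : StackProg K) → (p.Label → Λ) → Λ → p.Label → Instr K Λ
  | emit k w, _, exit, _ => pushWord k w (.goto fun _ => exit)
  | transfer k ts, emb, exit, _ =>
    .pop k (fun _ a => a) (.branch (fun v => v.isSome) (pushAll ts (.goto fun _ => emb ()))
      (.goto fun _ => exit))
  | readUnary k t, emb, exit, _ =>
    .pop k (fun _ a => a) (.branch (fun v => v = some .one)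
      (.push t (fun _ => .one) (.goto fun _ => emb ())) (.goto fun _ => exit))
  | seq p q, emb, exit, l =>
    Sum.rec (fun a => p.code (fun a => emb (Sum.inl a)) (emb (Sum.inr q.entry)) a)
      (fun b => q.code (fun b => emb (Sum.inr b)) exit b) l
  | loop k p, emb, exit, l =>
    Option.rec (.pop k (fun _ a => a) (.branch (fun v => v.isSome)
        (.goto fun _ => emb (some p.entry)) (.goto fun _ => exit)))
      (fun a => p.code (fun a => emb (some a)) (emb none) a) l

/-! ### Execution of stack programs, with step counts -/

variable [DecidableEq K]

theorem stepAux_pushWord {Λ : Type} (k : K) (w : List CircuitSym) (q : Instr K Λ)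
    (v : Option CircuitSym) (S : Stacks K) :
    TM2.stepAux (pushWord k w q) v S = TM2.stepAux q v (Function.update S k (w ++ S k)) := by
  induction w generalizing q with
  | nil => simp [pushWord]
  | cons a w ih => simp [pushWord, ih]

/-- The effect of pushing one symbol on several stacks. -/
def pushSym (ts : List K) (a : CircuitSym) (S : Stacks K) : Stacks K :=
  ts.foldl (fun S k => Function.update S k (a :: S k)) S

theorem stepAux_pushAll {Λ : Type} (ts : List K) (q : Instr K Λ) (a : CircuitSym)
    (S : Stacks K) :
    TM2.stepAux (pushAll ts q) (some a) S = TM2.stepAux q (some a) (pushSym ts a S) := by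
  induction ts generalizing S with
  | nil => simp [pushAll, pushSym]
  | cons k ts ih => simp [pushAll, pushSym, ih]

/-- Started with the stacks `S`, the program `p` terminates within `t` steps, with the stacks
`S'`. -/
def Runs (p : StackProg K) (S S' : Stacks K) (t : ℕ) : Prop :=
  ∀ (Λ : Type) (emb : p.Label → Λ) (exit : Λ) (M : Λ → Instr K Λ),
    (∀ a, M (emb a) = p.code emb exit a) → ∀ v, ∃ v' s, s ≤ t ∧
      (flip bind (TM2.step M))^[s] (some ⟨some (emb p.entry), v, S⟩) = some ⟨some exit, v', S'⟩

theorem Runs.mono {p : StackProg K} {S S' : Stacks K} {t t' : ℕ} (h : p.Runs S S' t)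
    (ht : t ≤ t') : p.Runs S S' t' := fun Λ emb exit M hM v =>
  let ⟨v', s, hs, e⟩ := h Λ emb exit M hM v
  ⟨v', s, hs.trans ht, e⟩

theorem runs_emit (k : K) (w : List CircuitSym) (S : Stacks K) :
    (emit k w).Runs S (Function.update S k (w ++ S k)) 1 := by
  intro Λ emb exit M hM v
  refine ⟨v, 1, le_rfl, ?_⟩
  simp [flip, hM, code, stepAux_pushWord]

/-- Since `Runs` quantifies over all machines that contain the code, `p` can be run inside the code
of the composite, with the entry of `q` as its exit. The quantification over the register makes the
leftover symbol of `p` harmless. -/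
theorem Runs.seq {p q : StackProg K} {S S' S'' : Stacks K} {t t' : ℕ} (hp : p.Runs S S' t)
    (hq : q.Runs S' S'' t') : (p.seq q).Runs S S'' (t + t') := by
  intro Λ emb exit M hM v
  obtain ⟨v', s, hs, e⟩ := hp Λ (fun a => emb (Sum.inl a)) (emb (Sum.inr q.entry)) M
    (fun a => hM (Sum.inl a)) v
  obtain ⟨v'', s', hs', e'⟩ := hq Λ (fun a => emb (Sum.inr a)) exit M
    (fun a => hM (Sum.inr a)) v'
  refine ⟨v'', s' + s, by omega, ?_⟩
  rw [Function.iterate_add_apply]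
  exact (congrArg _ e).trans e'

theorem runs_transfer_nil {k : K} (ts : List K) {S : Stacks K} (h : S k = []) :
    (transfer k ts).Runs S S 1 := by
  intro Λ emb exit M hM v
  refine ⟨none, 1, le_rfl, ?_⟩
  have : Function.update S k [] = S := by rw [← h]; simp
  simp [flip, hM, code, h, this]

/-- One pass through the code pops a symbol, distributes it and returns to the same control point,
so the remaining run is again a run of the whole program. -/
theorem runs_transfer_cons {k : K} {ts : List K} {S S' : Stacks K} {a : CircuitSym}
    {r : List CircuitSym} {t : ℕ} (h : S k = a :: r)
    (hr : (transfer k ts).Runs (pushSym ts a (Function.update S k r)) S' t) :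
    (transfer k ts).Runs S S' (t + 1) := by
  intro Λ emb exit M hM v
  obtain ⟨v', s, hs, e⟩ := hr Λ emb exit M hM (some a)
  refine ⟨v', s + 1, by omega, ?_⟩
  rw [Function.iterate_succ_apply, ← e]
  congr 1
  have hM0 := hM (entry _)
  simp only [code] at hM0
  simp [flip, hM0, h, stepAux_pushAll]
  rfl

theorem runs_readUnary {k t : K} (hkt : k ≠ t) (i : ℕ) {S : Stacks K} {r : List CircuitSym}
    (h : S k = unary i ++ r) :
    (readUnary k t).Runs S
      (Function.update (Function.update S k r) t (List.replicate i .one ++ S t)) (i + 1) := by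
  induction i generalizing S with
  | zero =>
    intro Λ emb exit M hM v
    -- The separator is popped but not pushed; it survives only in the register.
    refine ⟨some .sep, 1, le_rfl, ?_⟩
    have : Function.update (Function.update S k r) t (S t) = Function.update S k r := by
      rw [Function.update_eq_self_iff, Function.update_of_ne hkt.symm]
    simp [flip, hM, code, h, unary, this]
  | succ i ih =>
    intro Λ emb exit M hM v
    have h' : S k = .one :: (unary i ++ r) := by simpa [unary, List.replicate_succ] using h
    obtain ⟨v', s, hs, e⟩ := ih (S := Function.update (Function.update S k (unary i ++ r)) t
      (.one :: S t)) (by simp [hkt]) Λ emb exit M hM (some .one)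
    refine ⟨v', s + 1, by omega, ?_⟩
    rw [Function.iterate_succ_apply]
    have e1 : List.replicate i CircuitSym.one ++ .one :: S t =
        List.replicate (i + 1) .one ++ S t := by
      rw [List.replicate_succ', List.append_assoc]; rfl
    have e2 : Function.update (Function.update (Function.update (Function.update S k
        (unary i ++ r)) t (.one :: S t)) k r) t (List.replicate i .one ++ .one :: S t) =
        Function.update (Function.update S k r) t (List.replicate (i + 1) .one ++ S t) := by
      rw [e1]
      funext x
      by_cases hx : x = t
      · subst hx; simp
      · by_cases hx' : x = k
        · subst hx'; simp [hx]
        · simp [hx, hx']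
    simp only [Function.update_self, e2] at e
    rw [← e]
    congr 1
    have hM0 := hM (entry _)
    simp only [code] at hM0
    simp [flip, hM0, h', hkt.symm]
    rfl

theorem runs_loop_nil {k : K} (p : StackProg K) {S : Stacks K} (h : S k = []) :
    (loop k p).Runs S S 1 := by
  intro Λ emb exit M hM v
  refine ⟨none, 1, le_rfl, ?_⟩
  have : Function.update S k [] = S := by rw [← h]; simp
  have hM0 : M (emb (entry _)) = .pop k (fun _ a => a) (.branch (fun v => v.isSome)
    (.goto fun _ => emb (some p.entry)) (.goto fun _ => exit)) := hM none
  simp [flip, hM0, h, this]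

theorem runs_loop_cons {k : K} {p : StackProg K} {S S' S'' : Stacks K} {a : CircuitSym}
    {r : List CircuitSym} {t t' : ℕ} (h : S k = a :: r)
    (hp : p.Runs (Function.update S k r) S' t) (hr : (loop k p).Runs S' S'' t') :
    (loop k p).Runs S S'' (1 + t + t') := by
  intro Λ emb exit M hM v
  obtain ⟨v', s, hs, e⟩ := hp Λ (fun a => emb (some a)) (emb none) M
    (fun a => hM (some a)) (some a)
  obtain ⟨v'', s', hs', e'⟩ := hr Λ emb exit M hM v'
  refine ⟨v'', s' + (s + 1), by omega, ?_⟩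
  rw [Function.iterate_add_apply, Function.iterate_succ_apply]
  refine Eq.trans (congrArg _ (Eq.trans (congrArg _ ?_) e)) e'
  have hM0 : M (emb (entry _)) = .pop k (fun _ a => a) (.branch (fun v => v.isSome)
    (.goto fun _ => emb (some p.entry)) (.goto fun _ => exit)) := hM none
  simp [flip, hM0, h]

/-! ### From programs to polynomial-time computability -/

/-- The machine that runs a program and halts. -/
def machine [Fintype K] (p : StackProg K) (inp out : K) : FinTM2 where
  K := K
  k₀ := inp
  k₁ := out
  Γ _ := CircuitSym
  Λ := Option p.Label
  main := some p.entry
  ΛFin := letI := p.labelFintype; inferInstance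
  σ := Option CircuitSym
  initialState := none
  Γk₀Fin := inferInstanceAs (Fintype CircuitSym)
  m l := match l with
    -- The prescribed halting configuration has the register in its initial state, so it is reset
    -- first.
    | none => .load (fun _ => none) .halt
    | some a => p.code some none a

theorem initList_machine [Fintype K] (p : StackProg K) (inp out : K) (w : List CircuitSym) :
    initList (p.machine inp out) w =
      (⟨some (some p.entry), none, Function.update (fun _ => []) inp w⟩ :
        TM2.Cfg (fun _ : K => CircuitSym) (Option p.Label) (Option CircuitSym)) := by
  have : (initList (p.machine inp out) w).stk =
      @Function.update K (fun _ => List CircuitSym) _ (fun _ => []) inp w := by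
    refine funext fun (k : K) => ?_
    by_cases hk : k = inp
    · subst hk
      exact (dif_pos rfl).trans (Function.update_self (β := fun _ : K => List CircuitSym) ..).symm
    · exact (dif_neg hk).trans
        (Function.update_of_ne (f := fun _ : K => ([] : List CircuitSym)) hk _).symm
  rw [← this]
  rfl

theorem haltList_machine [Fintype K] (p : StackProg K) (inp out : K) (w : List CircuitSym) :
    haltList (p.machine inp out) w =
      (⟨none, none, Function.update (fun _ => []) out w⟩ :
        TM2.Cfg (fun _ : K => CircuitSym) (Option p.Label) (Option CircuitSym)) := by
  have : (haltList (p.machine inp out) w).stk =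
      @Function.update K (fun _ => List CircuitSym) _ (fun _ => []) out w := by
    refine funext fun (k : K) => ?_
    by_cases hk : k = out
    · subst hk
      exact (dif_pos rfl).trans (Function.update_self (β := fun _ : K => List CircuitSym) ..).symm
    · exact (dif_neg hk).trans
        (Function.update_of_ne (f := fun _ : K => ([] : List CircuitSym)) hk _).symm
  rw [← this]
  rfl

/-- A function is computable in polynomial time if some program computes it in polynomial time,
the stacks other than the output stack being empty in the end. -/
theorem computableInPolyTime [Fintype K] {α β : Type} {ea : α → List CircuitSym}
    {eb : β → List CircuitSym} {f : α → β} (p : StackProg K) (inp out : K) (time : Polynomial ℕ)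
    (h : ∀ a, p.Runs (Function.update (fun _ => []) inp (ea a))
      (Function.update (fun _ => []) out (eb (f a))) (time.eval (ea a).length)) :
    Nonempty (TM2ComputableInPolyTime ea eb f) := by
  refine ⟨{ tm := p.machine inp out
            inputAlphabet := Equiv.refl _
            outputAlphabet := Equiv.refl _
            -- The extra step is the final reset and halt.
            time := time + 1
            outputsFun := fun a => ?_ }⟩
  have H := h a (Option p.Label) some none (p.machine inp out).m (fun _ => rfl) none
  choose v' s hs e using H
  refine ⟨⟨s + 1, ?_⟩, by simpa using hs⟩
  have hid : ∀ w : List CircuitSym, List.map (Equiv.refl CircuitSym).invFun w = w := List.map_id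
  have e0 : initList (p.machine inp out) (List.map (Equiv.refl CircuitSym).invFun (ea a)) =
      (⟨some (some p.entry), none, Function.update (fun _ => []) inp (ea a)⟩ :
        TM2.Cfg (fun _ : K => CircuitSym) (Option p.Label) (Option CircuitSym)) := by
    exact (congrArg (initList (p.machine inp out)) (hid (ea a))).trans
      (initList_machine p inp out (ea a))
  have e1 : haltList (p.machine inp out) (List.map (Equiv.refl CircuitSym).invFun (eb (f a))) =
      (⟨none, none, Function.update (fun _ => []) out (eb (f a))⟩ :
        TM2.Cfg (fun _ : K => CircuitSym) (Option p.Label) (Option CircuitSym)) := by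
    exact (congrArg (haltList (p.machine inp out)) (hid (eb (f a)))).trans
      (haltList_machine p inp out (eb (f a)))
  rw [Nat.add_comm, Function.iterate_add_apply]
  refine Eq.trans (congrArg _ (Eq.trans (congrArg _ (congrArg some e0)) e)) ?_
  exact congrArg some e1.symm

end StackProg
end

noncomputable section

/-! ### The description of the verifier -/

/-- The concatenation of the words `w 0, …, w (c - 1)`. -/
def wordLoop (c : ℕ) (w : ℕ → List CircuitSym) : List CircuitSym := (List.range c).flatMap w

theorem wordLoop_succ (c : ℕ) (w : ℕ → List CircuitSym) :
    wordLoop (c + 1) w = wordLoop c w ++ w c := by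
  simp [wordLoop, List.range_succ]

/-- Gates that introduce a uniformly random classical bit as wire `0`. -/
def keyWord : List CircuitSym :=
  .ancilla :: .hadamard :: unary 0 ++ .ancilla :: .cnot :: unary 1 ++ unary 0 ++
    .discard :: unary 0

/-- Gates that move wire `j - 1` to the front. -/
def moveWord (j : ℕ) : List CircuitSym :=
  .ancilla :: .cnot :: unary j ++ unary 0 ++ .cnot :: unary 0 ++ unary j ++ .discard :: unary j

/-- Gates that swap wires `a` and `b`, controlled by wire `0`. -/
def cswapWord (a b : ℕ) : List CircuitSym :=
  .cnot :: unary b ++ unary a ++ .toffoli :: unary 0 ++ unary a ++ unary b ++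
    .cnot :: unary b ++ unary a

/-- Gates that introduce a qubit in state `(|0⟩ - |1⟩) / √2` as wire `0`. -/
def minusWord : List CircuitSym :=
  .ancilla :: .hadamard :: unary 0 ++ .tGate :: unary 0 ++ .tGate :: unary 0 ++
    .tGate :: unary 0 ++ .tGate :: unary 0

/-- The gates of the verifier for an encryption circuit with `m` key bits, `n` input qubits, `l`
output qubits and the gates `s`. -/
def verifierWord (m n l : ℕ) (s : List CircuitSym) : List CircuitSym :=
  wordLoop m (fun _ => keyWord) ++ (s ++ (wordLoop n (fun _ => moveWord (l + (n + n))) ++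
    (wordLoop m (fun _ => keyWord) ++ (s ++ (minusWord ++
      (wordLoop l (fun i => cswapWord (i + 1) (l + i + 1)) ++
        (wordLoop n (fun i => cswapWord (l + (l + i) + 1) (l + (l + (n + i)) + 1)) ++
          (wordLoop l (fun _ => .discard :: unary 1) ++ (wordLoop l (fun _ => .discard :: unary 1) ++
            (wordLoop n (fun _ => .discard :: unary 1) ++
              (wordLoop n (fun _ => .discard :: unary 1) ++ .hadamard :: unary 0)))))))))))

/-! ### A polynomial-time program that writes this description -/

/-- The stacks: input, output, the numbers of key bits, input qubits and output qubits in unary, a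
loop counter, and scratch space. -/
inductive VStack
  | inp | out | keys | ins | outs | counter | scratch
  deriving DecidableEq

instance : Fintype VStack where
  elems := {.inp, .out, .keys, .ins, .outs, .counter, .scratch}
  complete x := by cases x <;> decide

namespace StackProg

open VStack

theorem pushSym_apply {K : Type} [DecidableEq K] {ts : List K} (hts : ts.Nodup) (a : CircuitSym)
    (S : Stacks K) (x : K) : pushSym ts a S x = if x ∈ ts then a :: S x else S x := by
  induction ts generalizing S with
  | nil => simp [pushSym]
  | cons k ts ih =>
    rw [List.nodup_cons] at hts
    have : pushSym (k :: ts) a S = pushSym ts a (Function.update S k (a :: S k)) := rfl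
    rw [this, ih hts.2]
    by_cases hx : x = k
    · subst hx; simp [hts.1]
    · simp [hx]

theorem runs_transfer {K : Type} [DecidableEq K] {k : K} {ts : List K} (hts : ts.Nodup)
    (hk : k ∉ ts) (S : Stacks K) :
    (transfer k ts).Runs S
      (fun x => if x = k then [] else if x ∈ ts then (S k).reverse ++ S x else S x)
      ((S k).length + 1) := by
  generalize hw : S k = w
  induction w generalizing S with
  | nil =>
    convert (runs_transfer_nil ts hw) using 1
    · funext x
      by_cases hx : x = k
      · subst hx; simp [hw]
      · simp [hx]
    · rfl
  | cons a w ih =>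
    have := ih (pushSym ts a (Function.update S k w)) (by simp [pushSym_apply hts, hk])
    convert runs_transfer_cons hw this using 1
    · funext x
      by_cases hx : x = k
      · simp [hx]
      · by_cases hx' : x ∈ ts <;> simp [hx, hx', pushSym_apply hts]
    · rfl

/-- Add a copy of one stack to another one. -/
def copyTo (k d : VStack) : StackProg VStack :=
  (transfer k [scratch]).seq (transfer scratch [k, d])

/-- Each transfer reverses the word; the two reversals cancel, and the second one feeds both the
source and the destination. -/
theorem runs_copyTo {k d : VStack} (hk : k ≠ scratch) (hd : d ≠ scratch) (hkd : k ≠ d)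
    {S : Stacks VStack} (hS : S scratch = []) {x : ℕ} (hx : (S k).length ≤ x) :
    (copyTo k d).Runs S (Function.update S d (S k ++ S d)) (2 * x + 2) := by
  refine Runs.mono (Runs.seq (runs_transfer (by simp) (by simpa using hk) S)
    ?_) (t := ((S k).length + 1) + ((S k).length + 1)) (by omega)
  have := runs_transfer (k := scratch) (ts := [k, d]) (by simpa using hkd)
    (by simp [hk.symm, hd.symm])
    (fun x => if x = k then [] else if x ∈ [scratch] then (S k).reverse ++ S x else S x)
  convert this using 1
  · funext x
    by_cases hx : x = d
    · subst hx; simp [hd, hk.symm, hkd.symm, hS]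
    · by_cases hx' : x = k
      · subst hx'; simp [hk, hk.symm, hS, hkd]
      · by_cases hx'' : x = scratch
        · subst hx''; simp [hd.symm, hS]
        · simp [hx, hx', hx'']
  · simp [hk.symm, hS]

/-- Within `t` steps the program `p`, started with the stacks `S` (apart from the output), adds the
word `w` in front of the output and changes nothing else. -/
def Emits (p : StackProg VStack) (S : Stacks VStack) (w : List CircuitSym) (t : ℕ) : Prop :=
  ∀ o, p.Runs (Function.update S out o) (Function.update S out (w ++ o)) t

/-- What is emitted later stands in front, hence the reversed order of the words here and in all
programs below. -/
theorem Emits.seq {p q : StackProg VStack} {S : Stacks VStack} {w w' : List CircuitSym} {t t' : ℕ}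
    (hp : p.Emits S w t) (hq : q.Emits S w' t') : (p.seq q).Emits S (w' ++ w) (t + t') :=
  fun o => by simpa using (hp o).seq (hq (w ++ o))

theorem Emits.congr {p : StackProg VStack} {S : Stacks VStack} {w w' : List CircuitSym} {t t' : ℕ}
    (hp : p.Emits S w t) (hw : w = w') (ht : t ≤ t') : p.Emits S w' t' :=
  hw ▸ fun o => (hp o).mono ht

theorem emits_emit (S : Stacks VStack) (w : List CircuitSym) : (emit out w).Emits S w 1 :=
  fun o => by simpa using runs_emit out w (Function.update S out o)

theorem emits_copyTo {k : VStack} (hk : k ≠ scratch) (hk' : k ≠ out) {S : Stacks VStack}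
    (hS : S scratch = []) {x : ℕ} (hx : (S k).length ≤ x) :
    (copyTo k out).Emits S (S k) (2 * x + 2) := fun o => by
  simpa [hk'] using runs_copyTo (S := Function.update S out o) hk (by simp) hk' (by simpa using hS)
    (x := x) (by simpa [hk'] using hx)

/-- Write the sum of `e` and the lengths of the stacks in `ks` in unary. -/
def emitNumber (e : ℕ) : List VStack → StackProg VStack
  | [] => emit out (unary e)
  | k :: ks => (emitNumber e ks).seq (copyTo k out)

theorem replicate_append_unary (i j : ℕ) :
    List.replicate i CircuitSym.one ++ unary j = unary (i + j) := by
  simp only [unary, List.replicate_add, List.append_assoc]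

theorem emits_emitNumber (e : ℕ) {S : Stacks VStack} (hS : S scratch = []) {x : ℕ}
    (c : VStack → ℕ) {ks : List VStack} (h : ∀ k ∈ ks, k ≠ scratch ∧ k ≠ out ∧
      S k = List.replicate (c k) .one ∧ c k ≤ x) :
    (emitNumber e ks).Emits S (unary (ks.foldr (fun k s => c k + s) e))
      (1 + ks.length * (2 * x + 2)) := by
  induction ks with
  | nil => exact (emits_emit S _).congr rfl (by simp)
  | cons k ks ih =>
    obtain ⟨h1, h2, h3, h4⟩ := h k (by simp)
    have := (ih fun k hk => h k (by simp [hk])).seq (emits_copyTo h1 h2 hS (x := x)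
      (by simpa [h3] using h4))
    rw [h3, replicate_append_unary] at this
    refine this.congr rfl (le_of_eq ?_)
    simp only [List.length_cons]
    ring

/-- Run a program once for each symbol of a stack. -/
def forEach (k : VStack) (p : StackProg VStack) : StackProg VStack :=
  (copyTo k counter).seq (loop counter p)

/-- The ones left on the counter after each pop spell the loop index. It runs downwards from `c -
1`, which is the right order for an output written from the back. -/
theorem emits_loop {p : StackProg VStack} {S : Stacks VStack} {c T : ℕ} {w : ℕ → List CircuitSym}
    (h : ∀ i < c, p.Emits (Function.update S counter (List.replicate i .one)) (w i) T)
    (o : List CircuitSym) :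
    (loop counter p).Runs
      (Function.update (Function.update S counter (List.replicate c .one)) out o)
      (Function.update (Function.update S counter []) out (wordLoop c w ++ o))
      (c * (T + 1) + 1) := by
  induction c generalizing o with
  | zero => exact (runs_loop_nil p (by simp)).mono (by simp)
  | succ c ih =>
    have h1 := h c (by omega) o
    have h2 := ih (fun i hi => h i (by omega)) (w c ++ o)
    rw [wordLoop_succ, List.append_assoc]
    refine (runs_loop_cons (r := List.replicate c .one) (a := .one) ?_ ?_ h2).mono
      (t := 1 + T + (c * (T + 1) + 1)) (le_of_eq (by ring))
    · simp [List.replicate_succ]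
    · convert h1 using 1
      rw [Function.update_comm (by simp), Function.update_idem]

theorem emits_forEach {k : VStack} (hk : k ≠ scratch ∧ k ≠ out ∧ k ≠ counter)
    {p : StackProg VStack} {S : Stacks VStack} (hS : S scratch = []) (hS' : S counter = [])
    {c x T : ℕ} (hc : S k = List.replicate c .one) (hx : c ≤ x) {w : ℕ → List CircuitSym}
    (h : ∀ i < c, p.Emits (Function.update S counter (List.replicate i .one)) (w i) T) :
    (forEach k p).Emits S (wordLoop c w) (2 * x + 2 + (x * (T + 1) + 1)) := fun o => by
  have h1 := runs_copyTo (S := Function.update S out o) (d := counter) hk.1 (by simp) hk.2.2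
    (by simpa using hS) (x := x) (by simpa [hk.2.1, hc] using hx)
  have h2 := emits_loop h o
  refine (h1.seq ?_).mono (t := 2 * x + 2 + (c * (T + 1) + 1)) (by gcongr)
  convert h2 using 1
  · rw [Function.update_comm (by simp)]
    simp [hk.2.1, hc, hS']
  · rw [← hS', Function.update_eq_self]

/-- Write the gates of a controlled swap; the wires are one plus the lengths of the given
stacks. -/
def emitCswap (as bs : List VStack) : StackProg VStack :=
  (emitNumber 1 as).seq <| (emitNumber 1 bs).seq <| (emit out [.cnot]).seq <|
    (emitNumber 1 bs).seq <| (emitNumber 1 as).seq <| (emit out (.toffoli :: unary 0)).seq <|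
    (emitNumber 1 as).seq <| (emitNumber 1 bs).seq <| emit out [.cnot]

theorem emits_emitCswap {S : Stacks VStack} (hS : S scratch = []) {x : ℕ} (c : VStack → ℕ)
    {as bs : List VStack}
    (ha : ∀ k ∈ as, k ≠ scratch ∧ k ≠ out ∧ S k = List.replicate (c k) .one ∧ c k ≤ x)
    (hb : ∀ k ∈ bs, k ≠ scratch ∧ k ≠ out ∧ S k = List.replicate (c k) .one ∧ c k ≤ x) {a b : ℕ}
    (haw : as.foldr (fun k s => c k + s) 1 = a) (hbw : bs.foldr (fun k s => c k + s) 1 = b) :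
    (emitCswap as bs).Emits S (cswapWord a b)
      (3 * (as.length + bs.length) * (2 * x + 2) + 9) := by
  have h1 := emits_emitNumber 1 hS c ha
  have h2 := emits_emitNumber 1 hS c hb
  rw [haw] at h1
  rw [hbw] at h2
  have := h1.seq <| h2.seq <| (emits_emit S [.cnot]).seq <| h2.seq <| h1.seq <|
    (emits_emit S (.toffoli :: unary 0)).seq <| h1.seq <| h2.seq <| emits_emit S [.cnot]
  refine this.congr ?_ (le_of_eq ?_)
  · simp [cswapWord]
  · ring

/-- Write the gates that move a wire to the front. -/
def emitMove : StackProg VStack :=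
  (emitNumber 0 [outs, ins, ins]).seq <| (emit out [.discard]).seq <|
    (emitNumber 0 [outs, ins, ins]).seq <| (emit out (unary 0 ++ .cnot :: unary 0)).seq <|
    (emitNumber 0 [outs, ins, ins]).seq <| emit out [.ancilla, .cnot]

/-- Write the gates of the verifier. -/
def emitVerifier : StackProg VStack :=
  (emit out (.hadamard :: unary 0)).seq <|
  (forEach ins (emit out (.discard :: unary 1))).seq <|
  (forEach ins (emit out (.discard :: unary 1))).seq <|
  (forEach outs (emit out (.discard :: unary 1))).seq <|
  (forEach outs (emit out (.discard :: unary 1))).seq <|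
  (forEach ins (emitCswap [outs, outs, counter] [outs, outs, ins, counter])).seq <|
  (forEach outs (emitCswap [counter] [outs, counter])).seq <|
  (emit out minusWord).seq <| (copyTo inp out).seq <| (forEach keys (emit out keyWord)).seq <|
  (forEach ins emitMove).seq <| (copyTo inp out).seq <| forEach keys (emit out keyWord)

/-- Read a description of an encryption circuit and write the description of the verifier. -/
def writeVerifier : StackProg VStack :=
  (readUnary inp keys).seq <| (readUnary inp ins).seq <| (readUnary inp outs).seq <|
  (emitVerifier.seq (emitNumber 0 [ins, ins, ins, ins])).seq <|
  (transfer inp []).seq <| (transfer keys []).seq <| (transfer ins []).seq <| transfer outs []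

/-- The stacks with the given input, key, input and output registers, the others being empty. -/
def registers (i a b c : List CircuitSym) : Stacks VStack
  | inp => i
  | keys => a
  | ins => b
  | outs => c
  | _ => []

theorem emits_emitVerifier {m n l x : ℕ} {s : List CircuitSym} (hm : m ≤ x) (hn : n ≤ x)
    (hl : l ≤ x) (hs : s.length ≤ x) :
    emitVerifier.Emits (registers s (List.replicate m .one) (List.replicate n .one)
      (List.replicate l .one))
      (verifierWord m n l s) (200 * x ^ 2 + 200 * x + 200) := by
  set S := registers s (List.replicate m .one) (List.replicate n .one)
    (List.replicate l .one) with hSdef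
  have hS : S scratch = [] := rfl
  have hS' : S counter = [] := rfl
  have hw (k c w) (hk : k ≠ scratch ∧ k ≠ out ∧ k ≠ counter) (hc : S k = List.replicate c .one)
      (hx : c ≤ x) := emits_forEach hk hS hS' hc hx (fun i _ => emits_emit _ w)
  have hdo := hw outs l (.discard :: unary 1) (by simp) rfl hl
  have hdi := hw ins n (.discard :: unary 1) (by simp) rfl hn
  have hkey := hw keys m keyWord (by simp) rfl hm
  have hinp : (copyTo inp out).Emits S s _ := emits_copyTo (by simp) (by simp) hS (x := x) hs
  have hswapR := emits_forEach (k := ins) (p := emitCswap [outs, outs, counter]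
      [outs, outs, ins, counter]) (by simp) hS hS' (c := n) (x := x) rfl hn
      (w := fun i => cswapWord (l + (l + i) + 1) (l + (l + (n + i)) + 1))
      -- Each of the two wire numbers of a controlled swap is written three times; they are sums
      -- over three and four stacks.
      (T := 3 * (3 + 4) * (2 * x + 2) + 9) (fun i hi => by
    refine emits_emitCswap (by simpa using hS) (x := x)
      -- The default value `i` is the length of the loop counter.
      (fun k => match k with | ins => n | outs => l | _ => i) ?_ ?_ ?_ ?_
    · simp [hSdef, registers]; omega
    · simp [hSdef, registers]; omega
    · simp; omega
    · simp; omega)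
  have hswapK := emits_forEach (k := outs) (p := emitCswap [counter] [outs, counter]) (by simp)
      hS hS' (c := l) (x := x) rfl hl (w := fun i => cswapWord (i + 1) (l + i + 1))
      (T := 3 * (1 + 2) * (2 * x + 2) + 9) (fun i hi => by
    refine emits_emitCswap (by simpa using hS) (x := x)
      (fun k => match k with | outs => l | _ => i) ?_ ?_ ?_ ?_
    · simp; omega
    · simp [hSdef, registers]; omega
    · simp
    · simp; omega)
  have hmove := emits_forEach (k := ins) (p := emitMove) (by simp) hS hS' (c := n) (x := x) rfl hn
      (w := fun _ => moveWord (l + (n + n))) (T := 3 * (1 + 3 * (2 * x + 2)) + 3) (fun i hi => by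
    set S' := Function.update S counter (List.replicate i .one)
    have h1 := emits_emitNumber 0 (S := S') (by simpa [S'] using hS) (x := x)
      (fun k => match k with | ins => n | _ => l) (ks := [outs, ins, ins])
      (by simp [S', hSdef, registers]; omega)
    have h2 : [outs, ins, ins].foldr (fun k s => (match k with | ins => n | _ => l) + s) 0 =
      l + (n + n) := by simp
    rw [h2] at h1
    have := h1.seq <| (emits_emit S' [.discard]).seq <| h1.seq <|
      (emits_emit S' (unary 0 ++ .cnot :: unary 0)).seq <| h1.seq <|
      emits_emit S' [.ancilla, .cnot]
    refine this.congr ?_ (le_of_eq ?_)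
    · simp [moveWord]
    · simp only [List.length_cons, List.length_nil]
      ring)
  have := (emits_emit S (.hadamard :: unary 0)).seq <| hdi.seq <| hdi.seq <| hdo.seq <| hdo.seq <|
    hswapR.seq <| hswapK.seq <| (emits_emit S minusWord).seq <| hinp.seq <| hkey.seq <|
    hmove.seq <| hinp.seq hkey
  refine this.congr ?_ ?_
  · simp only [verifierWord, List.append_assoc]
  -- The leading term is only 78x², from the two swap loops (42 and 18) and the move loop (18).
  · ring_nf
    nlinarith

theorem runs_writeVerifier (m n l : ℕ) (s : List CircuitSym) {x : ℕ}
    (hx : x = (unary m ++ unary n ++ unary l ++ s).length) :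
    writeVerifier.Runs (Function.update (fun _ => []) inp (unary m ++ unary n ++ unary l ++ s))
      (Function.update (fun _ => []) out
        (unary ((n + n) + (n + n)) ++ verifierWord m n l s))
      (200 * x ^ 2 + 220 * x + 300) := by
  have hlen : x = m + n + l + s.length + 3 := by
    rw [hx]
    simp only [unary, List.length_append, List.length_replicate, List.length_singleton]
    omega
  have h1 : (readUnary inp keys).Runs (registers (unary m ++ (unary n ++ (unary l ++ s))) [] [] [])
      (registers (unary n ++ (unary l ++ s)) (List.replicate m .one) [] []) (m + 1) := by
    convert runs_readUnary (k := inp) (t := keys) (by simp) m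
      (S := registers (unary m ++ (unary n ++ (unary l ++ s))) [] [] [])
      (r := unary n ++ (unary l ++ s)) rfl using 1
    funext k; cases k <;> simp [registers]
  have h2 : (readUnary inp ins).Runs
      (registers (unary n ++ (unary l ++ s)) (List.replicate m .one) [] [])
      (registers (unary l ++ s) (List.replicate m .one) (List.replicate n .one) []) (n + 1) := by
    convert runs_readUnary (k := inp) (t := ins) (by simp) n
      (S := registers (unary n ++ (unary l ++ s)) (List.replicate m .one) [] [])
      (r := unary l ++ s) rfl using 1
    funext k; cases k <;> simp [registers]
  have h3 : (readUnary inp outs).Runs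
      (registers (unary l ++ s) (List.replicate m .one) (List.replicate n .one) [])
      (registers s (List.replicate m .one) (List.replicate n .one) (List.replicate l .one))
      (l + 1) := by
    convert runs_readUnary (k := inp) (t := outs) (by simp) l
      (S := registers (unary l ++ s) (List.replicate m .one) (List.replicate n .one) [])
      (r := s) rfl using 1
    funext k; cases k <;> simp [registers]
  -- The number 4n of witness qubits opens the description, so it is emitted after the gates.
  have h4 := (emits_emitVerifier (m := m) (n := n) (l := l) (x := x) (s := s) (by omega) (by omega)
    (by omega) (by omega)).seq (emits_emitNumber 0 (ks := [ins, ins, ins, ins]) rfl (x := x)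
      (fun _ => n) (by simp [registers]; omega))
  have h5 {k : VStack} (hk : k ≠ out) (S : Stacks VStack) (o : List CircuitSym)
      (hl : (S k).length ≤ x) : (transfer k []).Runs (Function.update S out o)
        (Function.update (Function.update S k []) out o) (x + 1) := by
    convert (runs_transfer (k := k) (ts := []) (by simp) (by simp)
      (Function.update S out o)).mono (t' := x + 1) (by simpa [hk] using hl) using 1
    funext k'
    by_cases h : k' = out
    · subst h; simp [hk.symm]
    · by_cases h' : k' = k <;> simp [h, h', hk]
  set S := registers s (List.replicate m .one) (List.replicate n .one)
    (List.replicate l .one) with hSdef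
  set o := unary ((n + n) + (n + n)) ++ verifierWord m n l s with ho
  -- The halting configuration allows only the output stack to be nonempty. The counter and the
  -- scratch stack are empty already.
  have h6 := (h5 (k := inp) (by simp) S o (by simp [hSdef, registers]; omega)).seq <|
    (h5 (k := keys) (by simp) _ o (by simp [hSdef, registers]; omega)).seq <|
    (h5 (k := ins) (by simp) _ o (by simp [hSdef, registers]; omega)).seq <|
    h5 (k := outs) (by simp) _ o (by simp [hSdef, registers]; omega)
  have e1 : (Function.update (fun _ => []) inp (unary m ++ unary n ++ unary l ++ s)) =
      registers (unary m ++ (unary n ++ (unary l ++ s))) [] [] [] := by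
    funext k; cases k <;> simp [registers]
  have e2 : S = Function.update S out [] := by
    funext k; cases k <;> simp [hSdef, registers]
  have e3 : Function.update (Function.update (Function.update (Function.update (Function.update S
      inp []) keys []) ins []) outs []) out o = Function.update (fun _ => []) out o := by
    funext k; cases k <;> simp [hSdef, registers]
  have e4 : unary (List.foldr (fun _ s => n + s) 0 [ins, ins, ins, ins]) ++
      verifierWord m n l s ++ [] = o := by
    simp [ho, add_assoc]
  have h8 := h4 []
  rw [e4, ← e2] at h8
  rw [e3] at h6
  rw [e1]
  refine (h1.seq <| h2.seq <| h3.seq <| h8.seq h6).mono ?_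
  simp only [List.length_cons, List.length_nil]
  omega

end StackProg

open Turing in
/-- The description of the verifier is computable in polynomial time. -/
theorem polyTime_of_symbols
    (V : (E : EncryptionCircuit) → QCircuit ((E.n + E.n) + (E.n + E.n)) 1)
    (hV : ∀ E, (V E).symbols = verifierWord E.m E.n E.l E.circuit.symbols) :
    Nonempty (TM2ComputableInPolyTime EncryptionCircuit.encode VerifierCircuit.encode
      fun E => ⟨_, V E⟩) := by
  refine StackProg.writeVerifier.computableInPolyTime .inp .out
    (200 * Polynomial.X ^ 2 + 220 * Polynomial.X + 300) fun E => ?_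
  have h := StackProg.runs_writeVerifier E.m E.n E.l E.circuit.symbols rfl
  simp only [VerifierCircuit.encode, hV E]
  exact h.mono (le_of_eq (by simp [EncryptionCircuit.encode]))

end

noncomputable section

/-! ### Matrix entries of the channels of gates -/

/-- Conjugation by a permutation matrix substitutes the inverse permutation in both indices, and an
involution is its own inverse. -/
theorem conjMap_apply_of_perm {A : Type} [Fintype A] [DecidableEq A] {f : A → A}
    (hf : Function.Involutive f) {U : Op A} (hU : ∀ x y, U x y = if x = f y then 1 else 0)
    (ρ : Op A) (x y : A) : conjMap U ρ x y = ρ (f x) (f y) := by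
  have h : ∀ a b : A, (if a = f b then (1 : ℂ) else 0) = if b = f a then 1 else 0 := fun a b => by
    have : a = f b ↔ b = f a := by rw [eq_comm, hf.eq_iff, eq_comm]
    simp [this]
  simp only [conjMap, LinearMap.comp_apply, LinearMap.mulLeft_apply, LinearMap.mulRight_apply,
    Matrix.mul_apply, Matrix.conjTranspose_apply, hU]
  simp only [h x, h y, apply_ite star, star_one, star_zero, mul_ite, mul_one, mul_zero,
    Finset.sum_ite_eq', Finset.mem_univ, if_true, ite_mul, one_mul, zero_mul]

/-- The sign by which the Hadamard transform differs from a constant. -/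
def hadamardSign (a b : Bool) : ℂ := if a = true ∧ b = true then -1 else 1

theorem involutive_cnot {N : ℕ} {i j : Fin N} (hij : i ≠ j) :
    Function.Involutive fun y : Qubits N => Function.update y j (xor (y j) (y i)) := by
  intro y
  simp [hij]

theorem involutive_toffoli {N : ℕ} {i j k : Fin N} (hik : i ≠ k) (hjk : j ≠ k) :
    Function.Involutive fun y : Qubits N => Function.update y k (xor (y k) (y i && y j)) := by
  intro y
  simp [hik, hjk]

theorem cnot_channel_apply {N : ℕ} {i j : Fin N} (hij : i ≠ j) (ρ : Op (Qubits N))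
    (x y : Qubits N) : (QGate.cnot i j hij).channel ρ x y =
      ρ (Function.update x j (xor (x j) (x i))) (Function.update y j (xor (y j) (y i))) :=
  conjMap_apply_of_perm (involutive_cnot hij) (fun _ _ => rfl) ρ x y

theorem toffoli_channel_apply {N : ℕ} {i j k : Fin N} (hij : i ≠ j) (hik : i ≠ k) (hjk : j ≠ k)
    (ρ : Op (Qubits N)) (x y : Qubits N) : (QGate.toffoli i j k hij hik hjk).channel ρ x y =
      ρ (Function.update x k (xor (x k) (x i && x j)))
        (Function.update y k (xor (y k) (y i && y j))) :=
  conjMap_apply_of_perm (involutive_toffoli hik hjk) (fun _ _ => rfl) ρ x y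

theorem tGate_channel_apply {N : ℕ} (i : Fin N) (ρ : Op (Qubits N)) (x y : Qubits N) :
    (QGate.tGate i).channel ρ x y =
      (if x i = true then Complex.exp (Complex.I * (Real.pi / 4 : ℝ)) else 1) * ρ x y *
        star (if y i = true then Complex.exp (Complex.I * (Real.pi / 4 : ℝ)) else 1) := by
  simp only [QGate.channel, conjMap, LinearMap.comp_apply, LinearMap.mulLeft_apply,
    LinearMap.mulRight_apply, tOp, Matrix.diagonal_conjTranspose, Matrix.diagonal_mul,
    Matrix.mul_diagonal, mul_assoc]
  rfl

/-- The strings that agree with `x` off wire `i` are its two updates there. This reduces a row of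
the Hadamard matrix to a sum over one bit. -/
theorem sum_ite_agree {N : ℕ} (i : Fin N) (x : Qubits N) (f : Qubits N → ℂ) :
    (∑ y, if ∀ j, j ≠ i → x j = y j then f y else 0) = ∑ a, f (Function.update x i a) := by
  rw [← Finset.sum_filter]
  refine (Finset.sum_bij (fun a _ => Function.update x i a) ?_ ?_ ?_ ?_).symm
  · intro a _
    simp only [Finset.mem_filter, Finset.mem_univ, true_and]
    intro j hj
    simp [hj]
  · intro a _ b _ h
    simpa using congrFun h i
  · intro y hy
    simp only [Finset.mem_filter, Finset.mem_univ, true_and] at hy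
    refine ⟨y i, Finset.mem_univ _, ?_⟩
    funext j
    by_cases hj : j = i
    · subst hj; simp
    · simp [hj, hy j hj]
  · simp

theorem hadamard_channel_apply {N : ℕ} (i : Fin N) (ρ : Op (Qubits N)) (x y : Qubits N) :
    (QGate.hadamard i).channel ρ x y = 2⁻¹ * ∑ a, ∑ b, hadamardSign (x i) a *
      hadamardSign (y i) b * ρ (Function.update x i a) (Function.update y i b) := by
  have h1 (f : Qubits N → ℂ) (x : Qubits N) : ∑ z, hadamardOp i x z * f z =
      ((Real.sqrt 2 : ℝ) : ℂ)⁻¹ * ∑ a, hadamardSign (x i) a * f (Function.update x i a) := by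
    have := sum_ite_agree i x fun z => ((Real.sqrt 2 : ℝ) : ℂ)⁻¹ * hadamardSign (x i) (z i) * f z
    simp only [hadamardOp, ite_mul, zero_mul]
    refine this.trans ?_
    rw [Finset.mul_sum]
    simp [mul_assoc]
  have h2 (x y : Qubits N) : star (hadamardOp i x y) = hadamardOp i x y := by
    simp only [hadamardOp]
    split_ifs <;> simp [Complex.conj_ofReal]
  have h3 : (((Real.sqrt 2 : ℝ) : ℂ)⁻¹) * ((Real.sqrt 2 : ℝ) : ℂ)⁻¹ = 2⁻¹ := by
    rw [← mul_inv, ← Complex.ofReal_mul, Real.mul_self_sqrt (by norm_num)]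
    simp
  simp only [QGate.channel, conjMap, LinearMap.comp_apply, LinearMap.mulLeft_apply,
    LinearMap.mulRight_apply, Matrix.mul_apply, Matrix.conjTranspose_apply, h2]
  simp only [mul_comm (ρ _ _), h1]
  rw [← h3, mul_assoc]
  congr 1
  rw [Finset.mul_sum]
  refine Finset.sum_congr rfl fun a _ => ?_
  rw [Finset.mul_sum, Finset.mul_sum, Finset.mul_sum]
  refine Finset.sum_congr rfl fun b _ => ?_
  ring

/-! ### Circuits in wire coordinates -/

/-- The values on the first `N` wires. -/
def wires (N : ℕ) (x : ℕ → Bool) : Qubits N := fun i => x i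

/-- The matrix entries of an operator, as a function of the values on all wires. -/
abbrev Kernel : Type := (ℕ → Bool) → (ℕ → Bool) → ℂ

/-- The matrix entries of an operator, as a function of the values on all wires. -/
def kernel {N : ℕ} (ρ : Op (Qubits N)) : Kernel := fun x y => ρ (wires N x) (wires N y)

/-- Concatenation of a register and the values on the remaining wires. -/
def cat {n : ℕ} (u : Qubits n) (x : ℕ → Bool) : ℕ → Bool := fun i =>
  if h : i < n then u ⟨i, h⟩ else x (i - n)

/-- The values on the wires from wire `n` on. -/
def dropWires (n : ℕ) (x : ℕ → Bool) : ℕ → Bool := fun i => x (i + n)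

/-- Insert a wire. -/
def insertWire (i : ℕ) (b : Bool) (x : ℕ → Bool) : ℕ → Bool := fun j =>
  if j < i then x j else if j = i then b else x (j - 1)

theorem wires_cat {n : ℕ} (u : Qubits n) (x : ℕ → Bool) : wires n (cat u x) = u := by
  funext i
  simp [wires, cat]

theorem dropWires_cat {n : ℕ} (u : Qubits n) (x : ℕ → Bool) : dropWires n (cat u x) = x := by
  funext i
  simp [dropWires, cat]

theorem cat_wires_dropWires (n : ℕ) (x : ℕ → Bool) : cat (wires n x) (dropWires n x) = x := by
  funext i
  by_cases h : i < n
  · simp [cat, wires, h]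
  · simp [cat, dropWires, h, Nat.sub_add_cancel (not_lt.1 h)]

theorem wires_update {N i : ℕ} (hi : i < N) (x : ℕ → Bool) (b : Bool) :
    wires N (Function.update x i b) = Function.update (wires N x) ⟨i, hi⟩ b := by
  funext j
  by_cases h : j = ⟨i, hi⟩
  · subst h; simp [wires]
  · have : (j : ℕ) ≠ i := fun e => h (Fin.ext e)
    simp [wires, h, this]

theorem wires_insertWire {N : ℕ} (i : Fin (N + 1)) (x : ℕ → Bool) (b : Bool) :
    wires (N + 1) (insertWire i b x) =
      Fin.insertNth (α := fun _ => Bool) i b (wires N x) := by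
  funext j
  refine Fin.succAboveCases i ?_ (fun k => ?_) j
  · simp [wires, insertWire]
  · simp only [Fin.insertNth_apply_succAbove, wires, insertWire]
    rcases lt_or_ge k.castSucc i with h | h
    · have h' : (k : ℕ) < i := h
      simp [Fin.succAbove_of_castSucc_lt _ _ h, h']
    · have h' : (i : ℕ) ≤ k := h
      rw [Fin.succAbove_of_le_castSucc _ _ h]
      simp [show ¬ ((k : ℕ) + 1 < i) by omega, show (k : ℕ) + 1 ≠ i by omega]

/-- Some circuit with `N` input and `N'` output wires has the description `w` and acts on matrix
entries by `G`. -/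
def Realizes (N N' : ℕ) (w : List CircuitSym) (G : Kernel → Kernel) : Prop :=
  ∃ c : QCircuit N N', c.symbols = w ∧ ∀ ρ x y, kernel (c.channel ρ) x y = G (kernel ρ) x y

/-- Sequential composition. -/
def QCircuit.append {n k m : ℕ} : QCircuit n k → QCircuit k m → QCircuit n m
  | .nil, d => d
  | .cons g c, d => .cons g (c.append d)

theorem QCircuit.symbols_append {n k m : ℕ} (c : QCircuit n k) (d : QCircuit k m) :
    (c.append d).symbols = c.symbols ++ d.symbols := by
  induction c with
  | nil => rfl
  | cons g c ih => simp [append, symbols, ih]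

theorem QCircuit.channel_append {n k m : ℕ} (c : QCircuit n k) (d : QCircuit k m)
    (ρ : Op (Qubits n)) : (c.append d).channel ρ = d.channel (c.channel ρ) := by
  induction c with
  | nil => rfl
  | cons g c ih => simp [append, channel, ih]

theorem Realizes.nil (N : ℕ) : Realizes N N [] id := ⟨.nil, rfl, fun _ _ _ => rfl⟩

/-- Kernels do not know the number of wires, so this is plain composition of functions.
Substitutions compose contravariantly: that of the last gate is applied to the arguments first. -/
theorem Realizes.trans {N N' N'' : ℕ} {w w' : List CircuitSym} {G G' : Kernel → Kernel}
    (h : Realizes N N' w G) (h' : Realizes N' N'' w' G') :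
    Realizes N N'' (w ++ w') fun k => G' (G k) := by
  obtain ⟨c, hc, hG⟩ := h
  obtain ⟨d, hd, hG'⟩ := h'
  refine ⟨c.append d, by rw [QCircuit.symbols_append, hc, hd], fun ρ x y => ?_⟩
  rw [QCircuit.channel_append, hG']
  exact congrArg (fun k => G' k x y) (funext fun x => funext fun y => hG ρ x y)

theorem Realizes.congr {N N' : ℕ} {w w' : List CircuitSym} {G G' : Kernel → Kernel}
    (h : Realizes N N' w G) (hw : w = w') (hG : ∀ k x y, G k x y = G' k x y) :
    Realizes N N' w' G' := by
  obtain ⟨c, hc, h⟩ := h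
  exact ⟨c, hc.trans hw, fun ρ x y => (h ρ x y).trans (hG _ x y)⟩

theorem Realizes.gate {N N' : ℕ} (g : QGate N N') {w : List CircuitSym} {G : Kernel → Kernel}
    (hw : g.symbols = w) (h : ∀ ρ x y, kernel (g.channel ρ) x y = G (kernel ρ) x y) :
    Realizes N N' w G :=
  ⟨.cons g .nil, by simp [QCircuit.symbols, hw], h⟩

/-- The action of a Hadamard gate. -/
def kHadamard (i : ℕ) (k : Kernel) : Kernel := fun x y => 2⁻¹ * ∑ a, ∑ b,
  hadamardSign (x i) a * hadamardSign (y i) b * k (Function.update x i a) (Function.update y i b)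

/-- The action of a `T` gate. -/
def kT (i : ℕ) (k : Kernel) : Kernel := fun x y =>
  (if x i = true then Complex.exp (Complex.I * (Real.pi / 4 : ℝ)) else 1) * k x y *
    star (if y i = true then Complex.exp (Complex.I * (Real.pi / 4 : ℝ)) else 1)

/-- The action of a change of variables. -/
def kMap (f : (ℕ → Bool) → ℕ → Bool) (k : Kernel) : Kernel := fun x y => k (f x) (f y)

/-- The change of variables of a controlled-not gate. -/
def cnotBits (i j : ℕ) (x : ℕ → Bool) : ℕ → Bool := Function.update x j (xor (x j) (x i))

/-- The change of variables of a Toffoli gate. -/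
def toffoliBits (i j k : ℕ) (x : ℕ → Bool) : ℕ → Bool :=
  Function.update x k (xor (x k) (x i && x j))

/-- The action of the introduction of an ancilla. -/
def kAncilla (k : Kernel) : Kernel := fun x y =>
  if x 0 = false ∧ y 0 = false then k (dropWires 1 x) (dropWires 1 y) else 0

/-- The action of tracing out a wire. -/
def kDiscard (i : ℕ) (k : Kernel) : Kernel := fun x y =>
  ∑ b, k (insertWire i b x) (insertWire i b y)

theorem realizes_hadamard {N i : ℕ} (hi : i < N) :
    Realizes N N (.hadamard :: unary i) (kHadamard i) :=
  Realizes.gate (QGate.hadamard ⟨i, hi⟩) (by simp [QGate.symbols]) fun ρ x y => by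
    simp only [kernel, hadamard_channel_apply, kHadamard, wires_update hi]
    rfl

theorem realizes_tGate {N i : ℕ} (hi : i < N) : Realizes N N (.tGate :: unary i) (kT i) :=
  Realizes.gate (QGate.tGate ⟨i, hi⟩) (by simp [QGate.symbols]) fun ρ x y => by
    simp only [kernel, tGate_channel_apply, kT]
    rfl

theorem realizes_cnot {N i j : ℕ} (hi : i < N) (hj : j < N) (hij : i ≠ j) :
    Realizes N N (.cnot :: unary i ++ unary j) (kMap (cnotBits i j)) :=
  Realizes.gate (QGate.cnot ⟨i, hi⟩ ⟨j, hj⟩ (by simpa using hij)) (by simp [QGate.symbols])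
      fun ρ x y => by
    simp only [kernel, cnot_channel_apply, kMap, cnotBits, wires_update hj]
    rfl

theorem realizes_toffoli {N i j k : ℕ} (hi : i < N) (hj : j < N) (hk : k < N) (hij : i ≠ j)
    (hik : i ≠ k) (hjk : j ≠ k) :
    Realizes N N (.toffoli :: unary i ++ unary j ++ unary k) (kMap (toffoliBits i j k)) :=
  Realizes.gate (QGate.toffoli ⟨i, hi⟩ ⟨j, hj⟩ ⟨k, hk⟩ (by simpa using hij) (by simpa using hik)
    (by simpa using hjk)) (by simp [QGate.symbols]) fun ρ x y => by
    simp only [kernel, toffoli_channel_apply, kMap, toffoliBits, wires_update hk]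
    rfl

theorem realizes_ancilla (N : ℕ) : Realizes N (N + 1) [.ancilla] kAncilla :=
  Realizes.gate QGate.ancilla rfl fun ρ x y => by
    simp only [kernel, QGate.channel, kAncilla, ancillaMap]
    rfl

theorem realizes_discard {N i : ℕ} (hi : i < N + 1) :
    Realizes (N + 1) N (.discard :: unary i) (kDiscard i) :=
  Realizes.gate (QGate.discard ⟨i, hi⟩) (by simp [QGate.symbols]) fun ρ x y => by
    have h := fun b x => wires_insertWire (N := N) ⟨i, hi⟩ x b
    simp only at h
    simp only [kernel, kDiscard, h]
    rfl

end

noncomputable section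

/-! ### The parts of the verifier -/

theorem dropWires_update_zero (x : ℕ → Bool) (b : Bool) :
    dropWires 1 (Function.update x 0 b) = dropWires 1 x := by
  funext i
  simp [dropWires]

theorem dropWires_insertWire_zero (x : ℕ → Bool) (b : Bool) :
    dropWires 1 (insertWire 0 b x) = x := by
  funext i
  simp [dropWires, insertWire]

theorem kHadamard_kAncilla (k : Kernel) (x y : ℕ → Bool) :
    kHadamard 0 (kAncilla k) x y = 2⁻¹ * k (dropWires 1 x) (dropWires 1 y) := by
  simp [kHadamard, kAncilla, dropWires_update_zero, hadamardSign]

/-- The first ancilla is brought to (|0⟩ + |1⟩)/√2 and copied to a second one. Discarding the copy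
removes the off-diagonal entries and leaves a uniformly random bit. -/
theorem realizes_keyWord (N : ℕ) : Realizes N (N + 1) keyWord fun k x y =>
    if x 0 = y 0 then 2⁻¹ * k (dropWires 1 x) (dropWires 1 y) else 0 := by
  refine (((((realizes_ancilla N).trans (realizes_hadamard (i := 0) (by omega))).trans
    (realizes_ancilla (N + 1))).trans (realizes_cnot (i := 1) (j := 0) (by omega) (by omega)
    (by simp))).trans (realizes_discard (i := 0) (by omega))).congr (by simp [keyWord])
    fun k x y => ?_
  have e (b : Bool) (x : ℕ → Bool) :
      dropWires 1 (cnotBits 1 0 (insertWire 0 b x)) = x := by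
    rw [cnotBits, dropWires_update_zero, dropWires_insertWire_zero]
  have e0 (b : Bool) (x : ℕ → Bool) : cnotBits 1 0 (insertWire 0 b x) 0 = xor b (x 0) := by
    simp [cnotBits, insertWire]
  simp only [kDiscard, kMap, kAncilla.eq_def (kHadamard 0 _), e, e0, kHadamard_kAncilla]
  cases x 0 <;> cases y 0 <;> simp

theorem realizes_keys (N m : ℕ) : Realizes N (N + m) (wordLoop m fun _ => keyWord) fun k x y =>
    if wires m x = wires m y then (2 ^ m)⁻¹ * k (dropWires m x) (dropWires m y) else 0 := by
  induction m with
  | zero =>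
    refine (Realizes.nil N).congr rfl fun k x y => ?_
    have : wires 0 x = wires 0 y := Subsingleton.elim _ _
    simp only [this]
    simp
    rfl
  | succ m ih =>
    refine (ih.trans (realizes_keyWord (N + m))).congr (wordLoop_succ m _).symm fun k x y => ?_
    have e (x : ℕ → Bool) : dropWires m (dropWires 1 x) = dropWires (m + 1) x := by
      funext i; simp [dropWires, add_assoc]
    have e' : wires (m + 1) x = wires (m + 1) y ↔
        x 0 = y 0 ∧ wires m (dropWires 1 x) = wires m (dropWires 1 y) := by
      constructor
      · intro h
        refine ⟨congrFun h 0, funext fun i => ?_⟩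
        simpa [wires, dropWires] using congrFun h i.succ
      · rintro ⟨h0, h⟩
        funext i
        refine Fin.cases h0 (fun i => ?_) i
        simpa [wires, dropWires] using congrFun h i
    simp only [e, e']
    by_cases h0 : x 0 = y 0 <;>
      by_cases h : wires m (dropWires 1 x) = wires m (dropWires 1 y) <;> simp [h0, h, pow_succ]
    ring

/-! ### Circuits acting beside idle wires -/

/-- The action of a channel on the first wires. -/
def kExtend {n m : ℕ} (Φ : Op (Qubits n) →ₗ[ℂ] Op (Qubits m)) (k : Kernel) : Kernel :=
  fun x y => Φ (Matrix.of fun u v => k (cat u (dropWires m x)) (cat v (dropWires m y)))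
    (wires m x) (wires m y)

theorem cat_update {n : ℕ} (u : Qubits n) (x : ℕ → Bool) (i : Fin n) (b : Bool) :
    cat (Function.update u i b) x = Function.update (cat u x) i b := by
  funext j
  by_cases h : j < n
  · by_cases h' : j = i
    · subst h'; simp [cat]
    · have : (⟨j, h⟩ : Fin n) ≠ i := fun e => h' (congrArg Fin.val e)
      simp [cat, h, h', this]
  · have : j ≠ i := fun e => h (e ▸ i.2)
    simp [cat, h, this]

theorem cat_update_wires (n : ℕ) (x : ℕ → Bool) (i : Fin n) (b : Bool) :
    cat (Function.update (wires n x) i b) (dropWires n x) = Function.update x i b := by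
  rw [cat_update, cat_wires_dropWires]

theorem cat_insertNth {n : ℕ} (x : ℕ → Bool) (i : Fin (n + 1)) (b : Bool) :
    cat (Fin.insertNth (α := fun _ => Bool) i b (wires n x)) (dropWires n x) =
      insertWire i b x := by
  rw [← wires_insertWire]
  have : dropWires n x = dropWires (n + 1) (insertWire i b x) := by
    funext j
    have := i.2
    simp [dropWires, insertWire, show ¬ (j + (n + 1) < i) by omega,
      show j + (n + 1) ≠ i by omega, show j + (n + 1) - 1 = j + n by omega]
  rw [this, cat_wires_dropWires]

theorem cat_tail {n : ℕ} (x : ℕ → Bool) :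
    cat (Fin.tail (wires (n + 1) x)) (dropWires (n + 1) x) = dropWires 1 x := by
  have h1 : Fin.tail (wires (n + 1) x) = wires n (dropWires 1 x) := by
    funext i; simp [Fin.tail, wires, dropWires]
  have h2 : dropWires (n + 1) x = dropWires n (dropWires 1 x) := by
    funext i; simp [dropWires, add_assoc]
  rw [h1, h2, cat_wires_dropWires]

/-- The idle wires come last, so the wire numbers of a gate, and hence its description, stay the
same when they are added. -/
theorem realizes_extend_gate (r : ℕ) {n m : ℕ} (g : QGate n m) :
    Realizes (r + n) (r + m) g.symbols (kExtend g.channel) := by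
  cases g with
  | hadamard i =>
    refine (realizes_hadamard (i := i) (by omega)).congr rfl fun k x y => ?_
    simp only [kExtend, hadamard_channel_apply, Matrix.of_apply, cat_update_wires, kHadamard]
    rfl
  | tGate i =>
    refine (realizes_tGate (i := i) (by omega)).congr rfl fun k x y => ?_
    simp only [kExtend, tGate_channel_apply, Matrix.of_apply, cat_wires_dropWires, kT]
    rfl
  | cnot i j hij =>
    refine (realizes_cnot (i := i) (j := j) (by omega) (by omega) (Fin.val_ne_of_ne hij)).congr
      rfl fun k x y => ?_
    simp only [kExtend, cnot_channel_apply, Matrix.of_apply, cat_update_wires, kMap, cnotBits]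
    rfl
  | toffoli i j l hij hil hjl =>
    refine (realizes_toffoli (i := i) (j := j) (k := l) (by omega) (by omega) (by omega)
      (Fin.val_ne_of_ne hij) (Fin.val_ne_of_ne hil) (Fin.val_ne_of_ne hjl)).congr
      (by simp [QGate.symbols]) fun k x y => ?_
    simp only [kExtend, toffoli_channel_apply, Matrix.of_apply, cat_update_wires, kMap,
      toffoliBits]
    rfl
  | ancilla =>
    refine (realizes_ancilla (r + n)).congr rfl fun k x y => ?_
    simp only [kExtend, kAncilla, QGate.channel, ancillaMap, LinearMap.coe_mk, AddHom.coe_mk,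
      Matrix.of_apply, cat_tail]
    rfl
  | discard i =>
    refine (realizes_discard (N := r + m) (i := i) (by omega)).congr rfl fun k x y => ?_
    simp only [kExtend, kDiscard, QGate.channel, discardMap, LinearMap.coe_mk, AddHom.coe_mk,
      Matrix.of_apply, cat_insertNth]

theorem realizes_extend (r : ℕ) {n m : ℕ} (c : QCircuit n m) :
    Realizes (r + n) (r + m) c.symbols (kExtend c.channel) := by
  induction c with
  | nil =>
    refine (Realizes.nil _).congr rfl fun k x y => ?_
    simp [kExtend, QCircuit.channel, cat_wires_dropWires]
  | cons g c ih =>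
    refine ((realizes_extend_gate r g).trans ih).congr rfl fun k x y => ?_
    simp only [kExtend, dropWires_cat, wires_cat, QCircuit.channel, LinearMap.comp_apply]
    rfl

theorem dropWires_cat_add {m n : ℕ} (u : Qubits (m + n)) (x : ℕ → Bool) :
    dropWires m (cat u x) = cat (fun i => u (Fin.natAdd m i)) x := by
  funext j
  by_cases h : j < n
  · have : (⟨j + m, by omega⟩ : Fin (m + n)) = Fin.natAdd m ⟨j, h⟩ := by
      ext; simp [add_comm]
    simp [dropWires, cat, h, show j + m < m + n by omega, this]
  · simp [dropWires, cat, h, show ¬ j + m < m + n by omega, show j + m - (m + n) = j - n by omega]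

theorem wires_cat_add {m n : ℕ} (u : Qubits (m + n)) (x : ℕ → Bool) :
    wires m (cat u x) = fun i => u (Fin.castAdd n i) := by
  funext i
  simp [wires, cat, show (i : ℕ) < m + n by omega]
  rfl

/-- Random keys followed by the encryption circuit realize the averaged channel. -/
theorem realizes_average (E : EncryptionCircuit) (r : ℕ) :
    Realizes (r + E.n) (r + E.l) (wordLoop E.m (fun _ => keyWord) ++ E.circuit.symbols)
      (kExtend E.average) := by
  have h := realizes_keys (r + E.n) E.m
  rw [show r + E.n + E.m = r + (E.m + E.n) by ring] at h
  refine (h.trans (realizes_extend r E.circuit)).congr rfl fun k x y => ?_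
  simp only [kExtend, EncryptionCircuit.average, LinearMap.smul_apply, LinearMap.sum_apply,
    EncryptionCircuit.chan, QCircuit.keyed, LinearMap.comp_apply]
  rw [← map_sum, ← map_smul]
  refine congrFun (congrFun (congrArg E.circuit.channel ?_) _) _
  ext u v
  simp only [Matrix.of_apply, wires_cat_add, dropWires_cat_add, Matrix.smul_apply,
    Matrix.sum_apply, attachKey, LinearMap.coe_mk, AddHom.coe_mk, smul_eq_mul]
  -- The dephased key register is the uniform mixture of the states |κ⟩⟨κ|: a diagonal block meets
  -- exactly one κ, an off-diagonal block none.
  by_cases h : (fun i => u (Fin.castAdd E.n i)) = fun i => v (Fin.castAdd E.n i)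
  · simp only [h, and_self, if_true, Finset.sum_ite_eq, Finset.mem_univ]
  · rw [if_neg h, Finset.sum_eq_zero, mul_zero]
    intro κ _
    rw [if_neg]
    rintro ⟨h1, h2⟩
    exact h (h1.trans h2.symm)

/-! ### Moving registers -/

/-- The change of variables of moving wire `j - 1` to the front. -/
def moveBits (j : ℕ) (x : ℕ → Bool) : ℕ → Bool := fun i =>
  if i + 1 = j then x 0 else if i + 1 < j then x (i + 1) else x i

/-- A fresh ancilla turns wire `j - 1` into wire `j`. Exchanging that wire with the ancilla takes
only two controlled-nots because the ancilla is |0⟩, and the vacated wire is then discarded. -/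
theorem realizes_moveWord {N j : ℕ} (hj : 0 < j) (hjN : j ≤ N) :
    Realizes N N (moveWord j) (kMap (moveBits j)) := by
  refine ((((realizes_ancilla N).trans (realizes_cnot (i := j) (j := 0) (by omega) (by omega)
    (by omega))).trans (realizes_cnot (i := 0) (j := j) (by omega) (by omega)
    (by omega))).trans (realizes_discard (i := j) (by omega))).congr
    (by simp [moveWord]) fun k x y => ?_
  -- Pulled back to the ancilla, the discarded bit must be 0, so one term of the partial trace
  -- survives.
  have e0 (b : Bool) (x : ℕ → Bool) : cnotBits j 0 (cnotBits 0 j (insertWire j b x)) 0 = b := by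
    simp [cnotBits, insertWire, hj, hj.ne]
    cases b <;> cases x 0 <;> rfl
  have e (x : ℕ → Bool) :
      dropWires 1 (cnotBits j 0 (cnotBits 0 j (insertWire j false x))) = moveBits j x := by
    rw [cnotBits, dropWires_update_zero]
    funext i
    by_cases h1 : i + 1 = j
    · subst h1
      simp [dropWires, cnotBits, insertWire, moveBits]
    · by_cases h2 : i + 1 < j <;> simp [dropWires, cnotBits, insertWire, moveBits, h1, h2]
  simp [kDiscard, kMap, kAncilla, e0, e]

/-- Each move rotates the first `j` wires by one place; the formula is the rotation by `c`. -/
theorem realizes_moves {N j : ℕ} (c : ℕ) (hc : c ≤ j) (hjN : j ≤ N) :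
    Realizes N N (wordLoop c fun _ => moveWord j) (kMap fun x i =>
      if i + c < j then x (i + c) else if i < j then x (i + c - j) else x i) := by
  induction c with
  | zero =>
    refine (Realizes.nil N).congr rfl fun k x y => ?_
    have (x : ℕ → Bool) : (fun i => if i + 0 < j then x (i + 0) else if i < j then x (i + 0 - j)
        else x i) = x := by
      funext i; by_cases h : i < j <;> simp [h]
    simp only [kMap, this, id]
  | succ c ih =>
    refine ((ih (by omega)).trans (realizes_moveWord (N := N) (j := j) (by omega) hjN)).congr
      (wordLoop_succ c _).symm fun k x y => ?_
    simp only [kMap]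
    have (x : ℕ → Bool) : (fun i => if i + c < j then moveBits j x (i + c) else if i < j then
        moveBits j x (i + c - j) else moveBits j x i) = fun i => if i + (c + 1) < j then
        x (i + (c + 1)) else if i < j then x (i + (c + 1) - j) else x i := by
      funext i
      unfold moveBits
      split_ifs <;> first | rfl | omega | (congr 1; omega)
    rw [this, this]

/-- Moving a register to the front. -/
theorem realizes_moveRegister {N l n : ℕ} (hN : l + (n + n) ≤ N) :
    ∃ f : (ℕ → Bool) → ℕ → Bool,
      Realizes N N (wordLoop n fun _ => moveWord (l + (n + n))) (kMap f) ∧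
      ∀ (h r : Qubits n) (u : Qubits l) (x : ℕ → Bool),
        f (cat h (cat u (cat r x))) = cat u (cat r (cat h x)) := by
  refine ⟨_, realizes_moves n (by omega) hN, fun h r u x => ?_⟩
  funext i
  by_cases h1 : i < l
  · simp [cat, h1, show i + n < l + (n + n) by omega]
  · by_cases h2 : i - l < n
    · simp [cat, h1, h2, show i + n < l + (n + n) by omega]
    · by_cases h3 : i - l - n < n
      · simp [cat, h1, h2, h3, show ¬ i + n < l + (n + n) by omega,
          show i < l + (n + n) by omega,
          show i + n - (l + (n + n)) = i - l - n by omega]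
      · simp [cat, h1, h2, h3, show ¬ i + n < l + (n + n) by omega,
          show ¬ i < l + (n + n) by omega, show ¬ i < n by omega,
          show ¬ i - n < l by omega, show ¬ i - n - l < n by omega,
          show i - n - l - n = i - l - n - n by omega]

end

noncomputable section

/-! ### The swap test -/

/-- Add a wire at the front. -/
def consWire (b : Bool) (x : ℕ → Bool) : ℕ → Bool
  | 0 => b
  | i + 1 => x i

theorem consWire_zero (b : Bool) (x : ℕ → Bool) : consWire b x 0 = b := rfl

theorem dropWires_consWire (b : Bool) (x : ℕ → Bool) : dropWires 1 (consWire b x) = x := rfl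

/-- The change of variables of a controlled swap of the wires `a` and `b`. -/
def cswapBits (a b : ℕ) (x : ℕ → Bool) : ℕ → Bool := fun i =>
  if x 0 = true then if i = a then x b else if i = b then x a else x i else x i

/-- A swap is three alternating controlled-nots. It suffices to control the middle one, since
without it the outer two cancel. -/
theorem realizes_cswapWord {N a b : ℕ} (ha : 0 < a) (hab : a < b) (hb : b < N) :
    Realizes N N (cswapWord a b) (kMap (cswapBits a b)) := by
  refine (((realizes_cnot (i := b) (j := a) (by omega) (by omega) (by omega)).trans
    (realizes_toffoli (i := 0) (j := a) (k := b) (by omega) (by omega) (by omega) (by omega)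
    (by omega) (by omega))).trans (realizes_cnot (i := b) (j := a) (by omega) (by omega)
    (by omega))).congr (by simp [cswapWord]) fun k x y => ?_
  have (x : ℕ → Bool) : cnotBits b a (toffoliBits 0 a b (cnotBits b a x)) = cswapBits a b x := by
    funext i
    by_cases h1 : i = a
    · subst h1
      simp [cnotBits, toffoliBits, cswapBits, hab.ne, hab.ne', ha.ne]
      cases x i <;> cases x b <;> cases x 0 <;> rfl
    · by_cases h2 : i = b
      · subst h2
        simp [cnotBits, toffoliBits, cswapBits, hab.ne', ha.ne, hab.ne]
        cases x i <;> cases x a <;> cases x 0 <;> rfl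
      · simp [cnotBits, toffoliBits, cswapBits, h1, h2]
  simp only [kMap, this]

/-- The change of variables of a controlled swap of the blocks of `c` wires that start at `p` and at
`p + d`. -/
def cswapBlockBits (p d c : ℕ) (x : ℕ → Bool) : ℕ → Bool := fun i =>
  if x 0 = true then
    if p ≤ i ∧ i < p + c then x (i + d) else
      if p + d ≤ i ∧ i < p + d + c then x (i - d) else x i
  else x i

/-- The condition `c ≤ d` makes the blocks disjoint and `0 < p` keeps the control wire out of them,
so the single swaps do not interfere. -/
theorem realizes_cswapBlock {N p d : ℕ} (c : ℕ) (hp : 0 < p) (hc : c ≤ d) (hN : p + d + c ≤ N) :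
    Realizes N N (wordLoop c fun i => cswapWord (p + i) (p + d + i))
      (kMap (cswapBlockBits p d c)) := by
  induction c with
  | zero =>
    refine (Realizes.nil N).congr rfl fun k x y => ?_
    have (x : ℕ → Bool) : cswapBlockBits p d 0 x = x := by
      funext i
      unfold cswapBlockBits
      split_ifs <;> first | rfl | omega
    simp only [kMap, this, id]
  | succ c ih =>
    refine ((ih (by omega) (by omega)).trans (realizes_cswapWord (N := N) (a := p + c)
      (b := p + d + c) (by omega) (by omega) (by omega))).congr (wordLoop_succ c _).symm
      fun k x y => ?_
    have (x : ℕ → Bool) : cswapBlockBits p d c (cswapBits (p + c) (p + d + c) x) =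
        cswapBlockBits p d (c + 1) x := by
      have h0 : cswapBits (p + c) (p + d + c) x 0 = x 0 := by
        simp [cswapBits, show 0 ≠ p + c by omega, show 0 ≠ p + d + c by omega]
      funext i
      unfold cswapBlockBits
      rw [h0]
      by_cases hx : x 0 = true
      · simp only [hx, cswapBits, if_true]
        split_ifs <;> first | rfl | omega | (congr 1; omega)
      · simp only [hx, cswapBits]
        rfl
    simp only [kMap, this]

/-- A controlled swap of two neighbouring registers. -/
theorem realizes_cswapRegisters {N q n : ℕ} (hN : q + n + n + 1 ≤ N) :
    ∃ f : (ℕ → Bool) → ℕ → Bool,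
      Realizes N N (wordLoop n fun i => cswapWord (q + i + 1) (q + n + i + 1)) (kMap f) ∧
      ∀ (a : Bool) (w : Qubits q) (u v : Qubits n) (x : ℕ → Bool),
        f (consWire a (cat w (cat u (cat v x)))) =
          consWire a (cat w (if a = true then cat v (cat u x) else cat u (cat v x))) := by
  refine ⟨cswapBlockBits (q + 1) n n, ?_, fun a w u v x => ?_⟩
  · have := realizes_cswapBlock (N := N) (p := q + 1) (d := n) n (by omega) le_rfl (by omega)
    convert this using 4 <;> omega
  · cases a
    · funext i; simp [cswapBlockBits, consWire_zero]
    · funext i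
      cases i with
      | zero => simp [cswapBlockBits, consWire_zero]
      | succ i =>
        by_cases h1 : i < q
        · simp [cswapBlockBits, consWire, cat, h1, show ¬ q ≤ i by omega,
            show ¬ q + 1 + n ≤ i + 1 by omega]
        · by_cases h2 : i - q < n
          · simp [cswapBlockBits, consWire_zero, show q ≤ i by omega,
              show i + 1 < q + 1 + n by omega, show i + 1 + n = (i + n) + 1 by omega]
            simp [consWire, cat, h1, h2, show ¬ i + n < q by omega,
              show ¬ i + n - q < n by omega, show i + n - q - n = i - q by omega]
          · by_cases h3 : i - q - n < n
            · simp [cswapBlockBits, consWire_zero, show ¬ i + 1 < q + 1 + n by omega,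
                show q + 1 + n ≤ i + 1 by omega, show i + 1 < q + 1 + n + n by omega,
                show i + 1 - n = (i - n) + 1 by omega]
              simp [consWire, cat, h1, h2, h3, show ¬ i - n < q by omega,
                show i - n - q = i - q - n by omega]
            · simp [cswapBlockBits, consWire_zero, show ¬ i + 1 < q + 1 + n by omega,
                show ¬ i + 1 < q + 1 + n + n by omega]
              simp [consWire, cat, h1, h2, h3]

/-- The fourth power of the T gate is diag(1, -1), which turns (|0⟩ + |1⟩)/√2 into (|0⟩ - |1⟩)/√2.
-/
theorem realizes_minusWord (N : ℕ) : Realizes N (N + 1) minusWord fun k x y =>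
    2⁻¹ * (hadamardSign (x 0) true * hadamardSign (y 0) true *
      k (dropWires 1 x) (dropWires 1 y)) := by
  have hT := realizes_tGate (N := N + 1) (i := 0) (by omega)
  refine ((((((realizes_ancilla N).trans (realizes_hadamard (i := 0) (by omega))).trans hT).trans
    hT).trans hT).trans hT).congr (by simp [minusWord]) fun k x y => ?_
  have h4 : Complex.exp (Complex.I * (Real.pi / 4 : ℝ)) ^ 4 = -1 := by
    rw [← Complex.exp_nat_mul]
    convert Complex.exp_pi_mul_I using 2
    push_cast
    ring
  simp only [kT, kHadamard_kAncilla]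
  set z := Complex.exp (Complex.I * (Real.pi / 4 : ℝ)) with hz
  have h4' : star z ^ 4 = -1 := by rw [← star_pow, h4]; simp
  have e1 : z * (z * (z * z)) = -1 := by rw [← h4]; ring
  have e2 : star z * (star z * (star z * star z)) = -1 := by rw [← h4']; ring
  have key (b : Bool) : ((if b = true then z else 1) * ((if b = true then z else 1) *
      ((if b = true then z else 1) * (if b = true then z else 1)))) = hadamardSign b true := by
    cases b <;> simp [hadamardSign, e1]
  have key' (b : Bool) : (star (if b = true then z else 1) * (star (if b = true then z else 1) *
      (star (if b = true then z else 1) * star (if b = true then z else 1)))) =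
      hadamardSign b true := by
    cases b
    · simp [hadamardSign]
    · simp only [if_true, e2, hadamardSign, and_self]
  rw [← key, ← key']
  ring

theorem wordLoop_const_succ (c : ℕ) (w : List CircuitSym) :
    wordLoop (c + 1) (fun _ => w) = w ++ wordLoop c fun _ => w := by
  simp [wordLoop, List.range_succ_eq_map, List.flatMap_map]

theorem cat_cons {c : ℕ} (b : Bool) (u : Qubits c) (x : ℕ → Bool) :
    cat (Fin.cons (α := fun _ => Bool) b u) x = consWire b (cat u x) := by
  funext i
  cases i with
  | zero => simp [cat, consWire]
  | succ i =>
    by_cases h : i < c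
    · have : cat (Fin.cons (α := fun _ => Bool) b u) x (i + 1) =
          Fin.cons (α := fun _ => Bool) b u (Fin.succ ⟨i, h⟩) := dif_pos (by omega)
      rw [this, Fin.cons_succ]
      simp [consWire, cat, h]
    · simp [cat, consWire, h]

theorem sum_qubits_succ {c : ℕ} (f : Qubits (c + 1) → ℂ) :
    ∑ z, f z = ∑ b, ∑ u : Qubits c, f (Fin.cons (α := fun _ => Bool) b u) := by
  rw [← (Fin.consEquiv fun _ => Bool).sum_comp, Fintype.sum_prod_type]
  rfl

/-- Tracing out a register that follows wire `0`. -/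
theorem realizes_discards (N c : ℕ) :
    Realizes (N + 1 + c) (N + 1) (wordLoop c fun _ => .discard :: unary 1) fun k x y =>
      ∑ z : Qubits c, k (consWire (x 0) (cat z (dropWires 1 x)))
        (consWire (y 0) (cat z (dropWires 1 y))) := by
  induction c with
  | zero =>
    refine (Realizes.nil _).congr rfl fun k x y => ?_
    have (x : ℕ → Bool) (z : Qubits 0) : consWire (x 0) (cat z (dropWires 1 x)) = x := by
      funext i
      cases i <;> simp [consWire, cat, dropWires]
    simp [this]
  | succ c ih =>
    refine ((realizes_discard (N := N + 1 + c) (i := 1) (by omega)).trans ih).congr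
      (wordLoop_const_succ c _).symm fun k x y => ?_
    have (a b : Bool) (x : ℕ → Bool) : insertWire 1 b (consWire a x) =
        consWire a (consWire b x) := by
      funext i
      match i with
      | 0 => simp [insertWire, consWire]
      | 1 => simp [insertWire, consWire]
      | i + 2 => simp [insertWire, consWire]
    simp only [kDiscard, this, sum_qubits_succ, cat_cons]
    rw [Finset.sum_comm]

end

noncomputable section

/-! ### The verifier realizes the protocol -/

theorem linearMap_apply_eq_sum {A B : Type} [Fintype A] [DecidableEq A] (Φ : Op A →ₗ[ℂ] Op B)
    (X : Op A) (z w : B) :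
    Φ X z w = ∑ u, ∑ v, X u v * Φ (Matrix.single u v 1) z w := by
  conv_lhs => rw [Matrix.matrix_eq_sum_single X]
  simp only [map_sum, Matrix.sum_apply]
  refine Finset.sum_congr rfl fun u _ => Finset.sum_congr rfl fun v _ => ?_
  rw [show Matrix.single u v (X u v) = X u v • Matrix.single u v (1 : ℂ) by simp, map_smul]
  rfl

theorem sum_comm_pairs {A A' : Type} [Fintype A] [Fintype A'] (F : A → A → A' → A' → ℂ) :
    ∑ u, ∑ v, ∑ u', ∑ v', F u v u' v' = ∑ u', ∑ v', ∑ u, ∑ v, F u v u' v' := by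
  calc _ = ∑ u, ∑ u', ∑ v, ∑ v', F u v u' v' := Finset.sum_congr rfl fun _ _ => Finset.sum_comm
    _ = ∑ u', ∑ u, ∑ v, ∑ v', F u v u' v' := Finset.sum_comm
    _ = ∑ u', ∑ u, ∑ v', ∑ v, F u v u' v' := Finset.sum_congr rfl fun _ _ =>
      Finset.sum_congr rfl fun _ _ => Finset.sum_comm
    _ = _ := Finset.sum_congr rfl fun _ _ => Finset.sum_comm

/-- Maps acting on different tensor factors commute. -/
theorem linearMap_apply_comm {A A' B B' : Type} [Fintype A] [DecidableEq A] [Fintype A']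
    [DecidableEq A'] (Φ : Op A →ₗ[ℂ] Op B) (Ψ : Op A' →ₗ[ℂ] Op B')
    (X : A → A' → A → A' → ℂ) (z w : B) (z' w' : B') :
    Φ (Matrix.of fun u v => Ψ (Matrix.of fun u' v' => X u u' v v') z' w') z w =
      Ψ (Matrix.of fun u' v' => Φ (Matrix.of fun u v => X u u' v v') z w) z' w' := by
  rw [linearMap_apply_eq_sum Φ, linearMap_apply_eq_sum Ψ]
  simp only [Matrix.of_apply, linearMap_apply_eq_sum Ψ (Matrix.of fun u' v' => X _ u' _ v') z' w',
    linearMap_apply_eq_sum Φ (Matrix.of fun u v => X u _ v _) z w, Finset.sum_mul]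
  rw [sum_comm_pairs]
  simp only [mul_right_comm]

theorem mapTensor_tensorId_apply {A B R A' B' R' : Type} (Φ : Op A →ₗ[ℂ] Op B)
    (Ψ : Op A' →ₗ[ℂ] Op B') (ρ : Op ((A × R) × (A' × R'))) (z w : B) (r s : R) (z' w' : B')
    (r' s' : R') :
    mapTensor (tensorId Φ R) (tensorId Ψ R') ρ ((z, r), (z', r')) ((w, s), (w', s')) =
      Φ (Matrix.of fun u v => Ψ (Matrix.of fun u' v' => ρ ((u, r), (u', r')) ((v, s), (v', s')))
        z' w') z w :=
  rfl

theorem trace_swapOp_mul {A : Type} [Fintype A] [DecidableEq A] (σ : Op (A × A)) :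
    (swapOp A * σ).trace = ∑ z : A × A, σ z.swap z := by
  simp only [Matrix.trace, Matrix.diag, Matrix.mul_apply, swapOp]
  refine Finset.sum_congr rfl fun z _ => ?_
  have (y : A × A) : z = y.swap ↔ z.swap = y := by
    rw [← Prod.swap_inj, Prod.swap_swap]
  simp [this]

/-- In this form, sums of matrix entries, the swap test can be compared with what the circuit
computes. -/
theorem trace_symProj_mul {A : Type} [Fintype A] [DecidableEq A] (σ : Op (A × A)) :
    (symProj A * σ).trace = 2⁻¹ * (∑ z, σ z z + ∑ z : A × A, σ z.swap z) := by
  rw [symProj, Matrix.smul_mul, Matrix.trace_smul, Matrix.add_mul, Matrix.trace_add,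
    trace_swapOp_mul, Matrix.one_mul]
  rfl

namespace EncryptionCircuit

variable (E : EncryptionCircuit)

/-- The state on which the swap test of the protocol is performed. -/
def swapTestInput (ρ : Op ((Qubits E.n × Qubits E.n) × (Qubits E.n × Qubits E.n))) :
    Op ((Qubits E.l × Qubits E.n) × (Qubits E.l × Qubits E.n)) :=
  mapTensor (tensorId E.average (Qubits E.n)) (tensorId E.average (Qubits E.n)) ρ

/-- The keys are independent, so by bilinearity the average over pairs of keys factors into two
averaged channels. -/
theorem swapTestInput_eq (ρ : Op ((Qubits E.n × Qubits E.n) × (Qubits E.n × Qubits E.n))) :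
    E.swapTestInput ρ = ((2 : ℂ) ^ E.m * 2 ^ E.m)⁻¹ • ∑ k₁ : Qubits E.m, ∑ k₂ : Qubits E.m,
      mapTensor (tensorId (E.chan k₁) (Qubits E.n)) (tensorId (E.chan k₂) (Qubits E.n)) ρ := by
  ext ⟨⟨z, r⟩, ⟨z', r'⟩⟩ ⟨⟨w, s⟩, ⟨w', s'⟩⟩
  simp only [swapTestInput, Matrix.smul_apply, Matrix.sum_apply, mapTensor_tensorId_apply]
  have h : (Matrix.of fun u v => E.average (Matrix.of fun u' v' =>
      ρ ((u, r), (u', r')) ((v, s), (v', s'))) z' w') = ((2 : ℂ) ^ E.m)⁻¹ • ∑ k₂ : Qubits E.m,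
      Matrix.of fun u v => E.chan k₂ (Matrix.of fun u' v' =>
      ρ ((u, r), (u', r')) ((v, s), (v', s'))) z' w' := by
    ext u v
    simp only [average, LinearMap.smul_apply, LinearMap.sum_apply, Matrix.smul_apply,
      Matrix.sum_apply, Matrix.of_apply]
  rw [h]
  simp only [average, LinearMap.smul_apply, LinearMap.sum_apply, Matrix.smul_apply,
    Matrix.sum_apply, map_smul, map_sum, smul_eq_mul, Finset.mul_sum, mul_inv]
  rw [Finset.sum_comm]
  refine Finset.sum_congr rfl fun _ _ => Finset.sum_congr rfl fun _ _ => ?_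
  ring

theorem protocolAcceptProb_eq
    (ρ : Op ((Qubits E.n × Qubits E.n) × (Qubits E.n × Qubits E.n))) :
    E.protocolAcceptProb ρ = (symProj _ * E.swapTestInput ρ).trace.re := by
  rw [swapTestInput_eq, protocolAcceptProb, Matrix.mul_smul, Matrix.trace_smul]
  simp only [Matrix.mul_sum, Matrix.trace_sum]
  have : ((2 : ℂ) ^ E.m * 2 ^ E.m)⁻¹ = (((2 : ℝ) ^ E.m * 2 ^ E.m)⁻¹ : ℝ) := by push_cast; rfl
  rw [this, smul_eq_mul, Complex.re_ofReal_mul]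
  simp only [Complex.re_sum]

end EncryptionCircuit

theorem cat_append {n m : ℕ} (u : Qubits n) (v : Qubits m) (x : ℕ → Bool) :
    cat (Fin.append u v) x = cat u (cat v x) := by
  funext i
  by_cases h : i < n
  · have h1 : cat (Fin.append u v) x i = Fin.append u v (Fin.castAdd m ⟨i, h⟩) :=
      dif_pos (by omega)
    rw [h1, Fin.append_left]
    simp [cat, h]
  · by_cases h' : i - n < m
    · have h1 : cat (Fin.append u v) x i = Fin.append u v (Fin.natAdd n ⟨i - n, h'⟩) := by
        have : Fin.natAdd n ⟨i - n, h'⟩ = ⟨i, by omega⟩ := by ext; simp; omega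
        rw [this]
        exact dif_pos (by omega)
      rw [h1, Fin.append_right]
      simp [cat, h, h']
    · simp [cat, h, h', show ¬ i < n + m by omega, show i - (n + m) = i - n - m by omega]

theorem wires_cat_joinRegisters {n : ℕ} (h r h' r' : Qubits n) (t : ℕ → Bool) :
    wires ((n + n) + (n + n)) (cat h (cat r (cat h' (cat r' t)))) =
      joinRegisters ((h, r), (h', r')) := by
  rw [← cat_append h' r', ← cat_append h r, ← cat_append, wires_cat]
  rfl

theorem sum_comm_registers {A R : Type} [Fintype A] [Fintype R] (F : A → R → A → R → ℂ) :
    ∑ r₂, ∑ r₁, ∑ κ₁, ∑ κ₂, F κ₁ r₁ κ₂ r₂ = ∑ κ₁, ∑ r₁, ∑ κ₂, ∑ r₂, F κ₁ r₁ κ₂ r₂ := by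
  calc _ = ∑ r₂, ∑ κ₁, ∑ r₁, ∑ κ₂, F κ₁ r₁ κ₂ r₂ := Finset.sum_congr rfl fun _ _ => Finset.sum_comm
    _ = ∑ κ₁, ∑ r₂, ∑ r₁, ∑ κ₂, F κ₁ r₁ κ₂ r₂ := Finset.sum_comm
    _ = ∑ κ₁, ∑ r₁, ∑ r₂, ∑ κ₂, F κ₁ r₁ κ₂ r₂ := Finset.sum_congr rfl fun _ _ => Finset.sum_comm
    _ = _ := Finset.sum_congr rfl fun _ _ => Finset.sum_congr rfl fun _ _ => Finset.sum_comm

/-- The circuit of the verifier. -/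
theorem exists_verifier (E : EncryptionCircuit) :
    ∃ c : QCircuit ((E.n + E.n) + (E.n + E.n)) 1,
      c.symbols = verifierWord E.m E.n E.l E.circuit.symbols ∧
      ∀ ρ, c.acceptProb ρ = E.protocolAcceptProb (ρ.submatrix joinRegisters joinRegisters) := by
  obtain ⟨fM, hM, hM'⟩ := realizes_moveRegister
    (N := E.n + (E.n + E.n) + E.l) (l := E.l) (n := E.n) (by omega)
  obtain ⟨fK, hK, hK'⟩ := realizes_cswapRegisters
    (N := E.l + (E.n + E.n) + E.l + 1) (q := 0) (n := E.l) (by omega)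
  obtain ⟨fR, hR, hR'⟩ := realizes_cswapRegisters
    (N := E.l + (E.n + E.n) + E.l + 1) (q := E.l + E.l) (n := E.n) (by omega)
  have h1 := realizes_average E (E.n + (E.n + E.n))
  have h2 := realizes_average E (E.l + (E.n + E.n))
  have h3 := realizes_minusWord (E.l + (E.n + E.n) + E.l)
  have d1 := realizes_discards (E.n + E.n + E.l) E.l
  have d2 := realizes_discards (E.n + E.n) E.l
  have d3 := realizes_discards E.n E.n
  have d4 := realizes_discards 0 E.n
  have h4 := realizes_hadamard (N := 0 + 1) (i := 0) (by omega)
  -- The widths of consecutive pieces agree only up to arithmetic and have to match literally for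
  -- the composition.
  rw [show E.n + (E.n + E.n) + E.n = (E.n + E.n) + (E.n + E.n) by omega] at h1
  rw [show E.l + (E.n + E.n) + E.n = E.n + (E.n + E.n) + E.l by omega] at h2
  rw [show E.n + E.n + E.l + 1 + E.l = E.l + (E.n + E.n) + E.l + 1 by omega] at d1
  rw [show E.n + E.n + 1 + E.l = E.n + E.n + E.l + 1 by omega] at d2
  rw [show E.n + 1 + E.n = E.n + E.n + 1 by omega] at d3
  rw [show 0 + 1 + E.n = E.n + 1 by omega] at d4
  obtain ⟨c, hc, hG⟩ := h1.trans <| hM.trans <| h2.trans <| h3.trans <| hK.trans <| hR.trans <|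
    d1.trans <| d2.trans <| d3.trans <| d4.trans h4
  refine ⟨c, ?_, fun ρ => ?_⟩
  · rw [hc, verifierWord]
    simp only [List.append_assoc, Nat.zero_add, add_assoc]
  -- Wire 0 carries the accepting outcome; a constant assignment is also unchanged when wires are
  -- dropped.
  set t : ℕ → Bool := fun _ => true with ht
  have hacc : c.acceptProb ρ = (kernel (c.channel ρ) t t).re := rfl
  set σ := E.swapTestInput (ρ.submatrix joinRegisters joinRegisters) with hσ
  rw [hacc, hG, E.protocolAcceptProb_eq, trace_symProj_mul, ← hσ]
  congr 1
  -- The second ciphertext stands in front because the second plaintext was moved there before being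
  -- encrypted. The circuit applies the second copy's channel last, `mapTensor` applies it first;
  -- maps on different factors commute.
  have hσ' (κ₁ κ₂ κ₁' κ₂' : Qubits E.l) (r₁ r₂ r₁' r₂' : Qubits E.n) :
      kExtend E.average (kMap fM (kExtend E.average (kernel ρ)))
        (cat κ₂ (cat κ₁ (cat r₁ (cat r₂ t)))) (cat κ₂' (cat κ₁' (cat r₁' (cat r₂' t)))) =
      σ ((κ₁, r₁), (κ₂, r₂)) ((κ₁', r₁'), (κ₂', r₂')) := by
    rw [hσ, EncryptionCircuit.swapTestInput, mapTensor_tensorId_apply, linearMap_apply_comm]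
    simp only [kExtend, kMap, dropWires_cat, wires_cat, hM', kernel, wires_cat_joinRegisters,
      Matrix.submatrix_apply]
  have hK0 (a : Bool) (u v : Qubits E.l) (x : ℕ → Bool) : fK (consWire a (cat u (cat v x))) =
      consWire a (if a = true then cat v (cat u x) else cat u (cat v x)) := by
    have hcat (z : ℕ → Bool) : cat (wires 0 z) z = z := cat_wires_dropWires 0 z
    have := hK' a (wires 0 (cat u (cat v x))) u v x
    rw [hcat] at this
    rw [this]
    congr 1
  have hR0 (a : Bool) (κ κ' : Qubits E.l) (u v : Qubits E.n) (x : ℕ → Bool) :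
      fR (consWire a (cat κ (cat κ' (cat u (cat v x))))) =
      consWire a (cat κ (cat κ' (if a = true then cat v (cat u x) else cat u (cat v x)))) := by
    rw [← cat_append κ κ', hR', cat_append]
  simp only [kHadamard, consWire_zero, dropWires_consWire, dropWires_update_zero,
    Function.update_self, kMap, hR0, hK0]
  have hsum (F : (Qubits E.l × Qubits E.n) × (Qubits E.l × Qubits E.n) → ℂ) :
      ∑ r₂, ∑ r₁, ∑ κ₁, ∑ κ₂, F ((κ₁, r₁), (κ₂, r₂)) = ∑ z, F z := by
    simp only [Fintype.sum_prod_type]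
    rw [sum_comm_registers]
  -- The control bit on either side of σ gives four sums. Equal bits give tr σ and different bits
  -- give tr Wσ. All signs are +1, as those of the control state cancel those of the last Hadamard
  -- gate at outcome 1.
  have e1 : ∑ z : (Qubits E.l × Qubits E.n) × (Qubits E.l × Qubits E.n), σ z.swap z.swap =
      ∑ z, σ z z := (Equiv.prodComm _ _).sum_comp fun z => σ z z
  have e2 : ∑ z : (Qubits E.l × Qubits E.n) × (Qubits E.l × Qubits E.n), σ z z.swap =
      ∑ z : (Qubits E.l × Qubits E.n) × (Qubits E.l × Qubits E.n), σ z.swap z := by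
    rw [← (Equiv.prodComm _ _).sum_comp]
    rfl
  have s1 := hsum fun z => σ z z
  have s2 := hsum fun z => σ z.swap z.swap
  have s3 := hsum fun z => σ z.swap z
  have s4 := hsum fun z => σ z z.swap
  simp only [Prod.swap_prod_mk] at s1 s2 s3 s4
  have ht' : dropWires 1 t = t := rfl
  simp only [ht', ← Finset.mul_sum, Fintype.sum_bool, if_true, Bool.false_eq_true, if_false, hσ',
    s1, s2, s3, s4, e1, e2]
  simp [hadamardSign, ht]
  ring

end

noncomputable section

/-! ### The trace norm -/

open scoped Matrix.Norms.L2Operator Matrix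

theorem norm_mulVec_le {A B : Type} [Fintype A] [Fintype B] [DecidableEq A]
    (M : Matrix B A ℂ) (hM : ‖M‖ ≤ 1) (v : A → ℂ) :
    ‖(WithLp.toLp 2 (M *ᵥ v) : EuclideanSpace ℂ B)‖ ≤ ‖(WithLp.toLp 2 v : EuclideanSpace ℂ A)‖ :=
  (Matrix.l2_opNorm_mulVec M (WithLp.toLp 2 v)).trans
    (mul_le_of_le_one_left (norm_nonneg _) hM)

/-- The trace norm bounds the pairing with contractions. -/
theorem norm_trace_mul_le {A : Type} [Fintype A] [DecidableEq A] (M X : Op A) (hM : ‖M‖ ≤ 1) :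
    ‖(M * X).trace‖ ≤ traceNorm X := by
  set hH := Matrix.isHermitian_conjTranspose_mul_self X
  set b := hH.eigenvectorBasis
  -- In an eigenbasis of X*X, each diagonal entry of MX is at most ‖X b i‖, which is a singular
  -- value of X.
  have h1 : (M * X).trace = ∑ i, inner ℂ (b i) (Matrix.toEuclideanLin (M * X) (b i)) := by
    rw [← LinearMap.trace_eq_sum_inner, Matrix.toEuclideanLin_eq_toLin_orthonormal,
      Matrix.trace_toLin_eq]
  rw [h1, traceNorm]
  refine (norm_sum_le _ _).trans (Finset.sum_le_sum fun i _ => ?_)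
  have h2 : ‖(WithLp.toLp 2 (X *ᵥ (b i)) : EuclideanSpace ℂ A)‖ = √(hH.eigenvalues i) := by
    rw [EuclideanSpace.norm_eq, hH.eigenvalues_eq i, ← Matrix.mulVec_mulVec,
      Matrix.dotProduct_mulVec, ← Matrix.star_mulVec]
    congr 1
    simp only [dotProduct, map_sum]
    refine Finset.sum_congr rfl fun j _ => ?_
    simp [← Complex.normSq_eq_norm_sq, Complex.normSq_apply]
    rfl
  rw [← h2]
  refine (norm_inner_le_norm _ _).trans ?_
  rw [b.norm_eq_one, one_mul, Matrix.toLpLin_apply, ← Matrix.mulVec_mulVec]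
  exact norm_mulVec_le M hM _

/-- Here X*X = X, whose eigenvalues are idempotent and thus equal to their square roots; their sum
is the trace. -/
theorem traceNorm_of_isProjection {A : Type} [Fintype A] [DecidableEq A] {X : Op A}
    (hX : X.IsHermitian) (h : X * X = X) : (traceNorm X : ℂ) = X.trace := by
  have hX' : Xᴴ * X = X := by rw [hX.eq, h]
  set hH := Matrix.isHermitian_conjTranspose_mul_self X
  have hid : Xᴴ * X * (Xᴴ * X) = Xᴴ * X := by rw [hX', h]
  have h1 : ∀ i, hH.eigenvalues i * hH.eigenvalues i = hH.eigenvalues i := by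
    intro i
    have h2 := hH.mulVec_eigenvectorBasis i
    have h3 : (Xᴴ * X) *ᵥ ((Xᴴ * X) *ᵥ ⇑(hH.eigenvectorBasis i)) =
        (Xᴴ * X) *ᵥ ⇑(hH.eigenvectorBasis i) := by
      rw [Matrix.mulVec_mulVec, hid]
    rw [h2, Matrix.mulVec_smul, h2, smul_smul] at h3
    have h4 : hH.eigenvectorBasis i ≠ 0 := hH.eigenvectorBasis.toBasis.ne_zero i
    have h5 : (⇑(hH.eigenvectorBasis i) : A → ℂ) ≠ 0 := fun e => h4 (by ext j; exact congrFun e j)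
    exact smul_left_injective ℝ h5 h3
  have h2 : traceNorm X = ∑ i, hH.eigenvalues i := by
    refine Finset.sum_congr rfl fun i _ => ?_
    conv_lhs => rw [← h1 i]
    exact Real.sqrt_mul_self (by rw [← h1 i]; exact mul_self_nonneg _)
  rw [h2]
  refine Eq.trans ?_ (hH.trace_eq_sum_eigenvalues.symm.trans (congrArg Matrix.trace hX'))
  push_cast
  rfl

/-! ### Rank-one operators and contractions -/

/-- The rank-one operator `|v⟩⟨v|`. -/
def ketbra {A : Type} (v : A → ℂ) : Op A := Matrix.vecMulVec v (star v)

theorem trace_ketbra {A : Type} [Fintype A] (v : A → ℂ) :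
    (ketbra v).trace = ((∑ i, ‖v i‖ ^ 2 : ℝ) : ℂ) := by
  simp [ketbra, Matrix.trace, Matrix.vecMulVec, Complex.mul_conj, Complex.normSq_eq_norm_sq]

theorem ketbra_mul_ketbra {A : Type} [Fintype A] (v : A → ℂ) :
    ketbra v * ketbra v = ((∑ i, ‖v i‖ ^ 2 : ℝ) : ℂ) • ketbra v := by
  rw [← trace_ketbra]
  ext i j
  simp only [ketbra, Matrix.mul_apply, Matrix.vecMulVec_apply, Matrix.smul_apply, smul_eq_mul,
    Matrix.trace, Matrix.diag, Finset.sum_mul]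
  refine Finset.sum_congr rfl fun k _ => ?_
  ring

theorem posSemidef_ketbra {A : Type} [Fintype A] (v : A → ℂ) : (ketbra v).PosSemidef :=
  Matrix.posSemidef_vecMulVec_self_star v

theorem traceNorm_ketbra {A : Type} [Fintype A] [DecidableEq A] {v : A → ℂ}
    (hv : ∑ i, ‖v i‖ ^ 2 = 1) : traceNorm (ketbra v) = 1 := by
  have := traceNorm_of_isProjection (posSemidef_ketbra v).isHermitian
    (by rw [ketbra_mul_ketbra, hv]; simp)
  rw [trace_ketbra, hv] at this
  exact_mod_cast this

theorem norm_le_one_of_conjTranspose_mul_self {A B : Type} [Fintype A] [Fintype B] [DecidableEq A]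
    [DecidableEq B] {M : Matrix B A ℂ} {d : A → ℂ} (h : Mᴴ * M = Matrix.diagonal d)
    (hd : ∀ i, ‖d i‖ ≤ 1) : ‖M‖ ≤ 1 := by
  have h1 := Matrix.l2_opNorm_conjTranspose_mul_self M
  rw [h, Matrix.l2_opNorm_diagonal] at h1
  have h2 : ‖d‖ ≤ 1 := (pi_norm_le_iff_of_nonneg zero_le_one).2 hd
  nlinarith [norm_nonneg M]

theorem norm_le_one_of_isometry {A B : Type} [Fintype A] [Fintype B] [DecidableEq A]
    [DecidableEq B] {M : Matrix B A ℂ} (h : Mᴴ * M = 1) : ‖M‖ ≤ 1 :=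
  norm_le_one_of_conjTranspose_mul_self (d := fun _ => 1) (by rw [h]; simp) (by simp)

/-- The eigenvalues are nonnegative with sum 1. This lets states serve as test operators in the
overlap estimate. -/
theorem IsDensity.norm_le_one {A : Type} [Fintype A] [DecidableEq A] {ρ : Op A}
    (h : IsDensity ρ) : ‖ρ‖ ≤ 1 := by
  obtain ⟨h0, h1⟩ := h
  have hH := h0.isHermitian
  have h2 := hH.trace_eq_sum_eigenvalues
  have h3 : ∑ i, hH.eigenvalues i = 1 := by
    rw [h1] at h2
    exact Complex.ofReal_injective (by push_cast; exact h2.symm)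
  have h4 : ‖(Matrix.diagonal (RCLike.ofReal ∘ hH.eigenvalues) : Op A)‖ ≤ 1 := by
    rw [Matrix.l2_opNorm_diagonal]
    refine (pi_norm_le_iff_of_nonneg zero_le_one).2 fun i => ?_
    have h5 : hH.eigenvalues i ≤ ∑ i, hH.eigenvalues i :=
      Finset.single_le_sum (fun i _ => h0.eigenvalues_nonneg i) (Finset.mem_univ i)
    simpa [abs_of_nonneg (h0.eigenvalues_nonneg i)] using h5.trans h3.le
  have hU : ‖(hH.eigenvectorUnitary : Op A)‖ ≤ 1 :=
    norm_le_one_of_isometry (Unitary.coe_star_mul_self _)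
  have hU' : ‖(star (hH.eigenvectorUnitary : Op A))‖ ≤ 1 := by rwa [norm_star]
  rw [hH.spectral_theorem, Unitary.conjStarAlgAut_apply]
  refine (norm_mul_le _ _).trans (mul_le_one₀ ((norm_mul_le _ _).trans ?_) (norm_nonneg _) hU')
  exact mul_le_one₀ hU (norm_nonneg _) h4

end

noncomputable section

/-! ### Consequences of a bound on the diamond norm -/

open scoped Matrix.Norms.L2Operator Matrix Kronecker

theorem one_kronecker_mul_mul_apply {A R R' : Type} [Fintype A] [DecidableEq A] [Fintype R']
    (V : Matrix R R' ℂ) (X : Op (A × R')) (a a' : A) (r r' : R) :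
    (((1 : Op A) ⊗ₖ V) * X * ((1 : Op A) ⊗ₖ V)ᴴ) (a, r) (a', r') =
      ∑ c, ∑ c', V r c * star (V r' c') * X (a, c) (a', c') := by
  have h1 (y : A × R') : (((1 : Op A) ⊗ₖ V) * X) (a, r) y = ∑ c, V r c * X (a, c) y := by
    rw [Matrix.mul_apply, Fintype.sum_prod_type, Finset.sum_eq_single a]
    · simp
    · intro b _ hb
      simp [Matrix.one_apply_ne hb.symm]
    · simp
  rw [Matrix.mul_apply, Fintype.sum_prod_type, Finset.sum_eq_single a']
  · simp only [h1, Finset.sum_mul]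
    rw [Finset.sum_comm]
    refine Finset.sum_congr rfl fun _ _ => Finset.sum_congr rfl fun _ _ => ?_
    simp
    ring
  · intro b _ hb
    simp [Matrix.one_apply_ne hb.symm]
  · simp

/-- Operators on the reference commute with a map on the system. The matrix `V` may be rectangular,
which allows a change of reference space. -/
theorem tensorId_conj_right {A B R R' : Type} [Fintype A] [DecidableEq A] [Fintype B]
    [DecidableEq B] [Fintype R'] (Φ : Op A →ₗ[ℂ] Op B) (V : Matrix R R' ℂ) (X : Op (A × R')) :
    tensorId Φ R (((1 : Op A) ⊗ₖ V) * X * ((1 : Op A) ⊗ₖ V)ᴴ) =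
      ((1 : Op B) ⊗ₖ V) * tensorId Φ R' X * ((1 : Op B) ⊗ₖ V)ᴴ := by
  ext ⟨b, r⟩ ⟨b', r'⟩
  rw [one_kronecker_mul_mul_apply]
  have : (fun a a' => (((1 : Op A) ⊗ₖ V) * X * ((1 : Op A) ⊗ₖ V)ᴴ) (a, r) (a', r')) =
      ∑ c, ∑ c', (V r c * star (V r' c')) • (Matrix.of fun a a' => X (a, c) (a', c')) := by
    ext a a'
    rw [one_kronecker_mul_mul_apply]
    simp [Matrix.sum_apply]
  change Φ (fun a a' => (((1 : Op A) ⊗ₖ V) * X * ((1 : Op A) ⊗ₖ V)ᴴ) (a, r) (a', r')) b b' = _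
  rw [this]
  simp only [map_sum, map_smul, Matrix.sum_apply, Matrix.smul_apply, smul_eq_mul]
  rfl

/-- A rectangular matrix factors through the square of its smaller side as a contraction and a
matrix with the same Frobenius norm. -/
theorem exists_contraction_mul {A R : Type} [Fintype A] [DecidableEq A] [Fintype R]
    (Ψ : Matrix R A ℂ) : ∃ (V : Matrix R A ℂ) (B : Op A) (d : A → ℂ), Ψ = V * B ∧
      Vᴴ * V = Matrix.diagonal d ∧ (∀ i, ‖d i‖ ≤ 1) ∧ Bᴴ * B = Ψᴴ * Ψ := by
  have hP := Matrix.posSemidef_conjTranspose_mul_self Ψ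
  have hH := hP.isHermitian
  set U : Op A := (hH.eigenvectorUnitary : Op A)
  set lam := hH.eigenvalues with hlam
  have hU : Uᴴ * U = 1 := Unitary.coe_star_mul_self _
  have hU' : U * Uᴴ = 1 := Unitary.coe_mul_star_self _
  have hspec : Ψᴴ * Ψ = U * Matrix.diagonal (fun i => (lam i : ℂ)) * Uᴴ := by
    conv_lhs => rw [hH.spectral_theorem, Unitary.conjStarAlgAut_apply]
    rfl
  have hdiag : Uᴴ * (Ψᴴ * Ψ) * U = Matrix.diagonal (fun i => (lam i : ℂ)) := by
    rw [hspec]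
    calc _ = (Uᴴ * U) * Matrix.diagonal (fun i => (lam i : ℂ)) * (Uᴴ * U) := by
          simp only [Matrix.mul_assoc]
      _ = _ := by rw [hU, Matrix.one_mul, Matrix.mul_one]
  have hcol (q : A → ℂ) : (Ψ * U * Matrix.diagonal q)ᴴ * (Ψ * U * Matrix.diagonal q) =
      Matrix.diagonal fun i => star (q i) * lam i * q i := by
    calc _ = (Matrix.diagonal q)ᴴ * (Uᴴ * (Ψᴴ * Ψ) * U) * Matrix.diagonal q := by
          simp only [Matrix.conjTranspose_mul, Matrix.mul_assoc]
      _ = _ := by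
        rw [hdiag, Matrix.diagonal_conjTranspose, Matrix.diagonal_mul_diagonal,
          Matrix.diagonal_mul_diagonal]
        rfl
  have hl (i : A) : 0 ≤ lam i := hP.eigenvalues_nonneg i
  set s : A → ℂ := fun i => ((√(lam i) : ℝ) : ℂ) with hs
  have hss (i : A) : s i * s i = lam i := by
    rw [hs, ← Complex.ofReal_mul, Real.mul_self_sqrt (hl i)]
  have hst (i : A) : star (s i) = s i := Complex.conj_ofReal _
  -- A singular value decomposition with 0⁻¹ = 0: the columns of the first factor are left singular
  -- vectors or zero, so the diagonal entries are 1 or 0.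
  refine ⟨Ψ * U * Matrix.diagonal fun i => (s i)⁻¹, Matrix.diagonal s * Uᴴ,
    fun i => star (s i)⁻¹ * lam i * (s i)⁻¹, ?_, hcol _, fun i => ?_, ?_⟩
  -- The columns lost to 0⁻¹ = 0 belong to vanishing singular values and are zero anyway.
  · have h0 : Ψ * U * Matrix.diagonal (fun i => 1 - (s i)⁻¹ * s i) = 0 := by
      rw [← Matrix.conjTranspose_mul_self_eq_zero, hcol, ← Matrix.diagonal_zero]
      congr 1
      funext i
      by_cases hi : s i = 0
      · rw [← hss, hi]; simp
      · simp [hi]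
    have h1 : Ψ * U = Ψ * U * Matrix.diagonal fun i => (s i)⁻¹ * s i := by
      have : Matrix.diagonal (fun i => 1 - (s i)⁻¹ * s i) =
          1 - Matrix.diagonal fun i => (s i)⁻¹ * s i := by
        rw [← Matrix.diagonal_one, Matrix.diagonal_sub]
      rw [this, Matrix.mul_sub, Matrix.mul_one, sub_eq_zero] at h0
      exact h0
    calc Ψ = Ψ * U * Uᴴ := by rw [Matrix.mul_assoc, hU', Matrix.mul_one]
      _ = Ψ * U * (Matrix.diagonal fun i => (s i)⁻¹ * s i) * Uᴴ := by rw [← h1]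
      _ = _ := by rw [← Matrix.diagonal_mul_diagonal]; simp only [Matrix.mul_assoc]
  · beta_reduce
    rw [star_inv₀, hst, ← hss]
    by_cases hi : s i = 0
    · simp [hi]
    · field_simp
      simp
  · rw [hspec, Matrix.conjTranspose_mul, Matrix.conjTranspose_conjTranspose]
    calc _ = U * ((Matrix.diagonal s)ᴴ * Matrix.diagonal s) * Uᴴ := by
          simp only [Matrix.mul_assoc]
      _ = _ := by
        rw [Matrix.diagonal_conjTranspose, Matrix.diagonal_mul_diagonal]
        congr 3
        funext i
        rw [← hss, ← hst]
        simp [hst]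

section

variable {A B : Type} [Fintype A] [DecidableEq A] [Fintype B] [DecidableEq B]

theorem traceNorm_tensorId_ketbra_le {Φ : Op A →ₗ[ℂ] Op B} {ε : ℝ} (hε : 0 ≤ ε)
    (h : diamondNorm Φ ≤ ENNReal.ofReal ε) {φ : A × A → ℂ} (hφ : ∑ i, ‖φ i‖ ^ 2 = 1) :
    traceNorm (tensorId Φ A (ketbra φ)) ≤ ε := by
  have h0 : ketbra φ ≠ 0 := fun e => by
    have := trace_ketbra φ
    rw [e, hφ] at this
    simp at this
  have h1 := (le_iSup₂ (f := fun (X : Op (A × A)) (_ : X ≠ 0) =>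
    ENNReal.ofReal (traceNorm (tensorId Φ A X)) / ENNReal.ofReal (traceNorm X)) _ h0).trans h
  rw [traceNorm_ketbra hφ, ENNReal.ofReal_one, div_one] at h1
  exact (ENNReal.ofReal_le_ofReal_iff hε).1 h1

/-- Homogeneity removes the normalization, as the vectors in a decomposition of a mixed state are
not unit vectors. -/
theorem norm_trace_tensorId_ketbra_le {Φ : Op A →ₗ[ℂ] Op B} {ε : ℝ} (hε : 0 ≤ ε)
    (h : diamondNorm Φ ≤ ENNReal.ofReal ε) (φ : A × A → ℂ) {M : Op (B × A)} (hM : ‖M‖ ≤ 1) :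
    ‖(M * tensorId Φ A (ketbra φ)).trace‖ ≤ ε * ∑ i, ‖φ i‖ ^ 2 := by
  set N := ∑ i, ‖φ i‖ ^ 2 with hN
  have hN0 : 0 ≤ N := Finset.sum_nonneg fun _ _ => by positivity
  rcases hN0.eq_or_lt with h0 | h0
  · have : φ = 0 := by
      funext i
      have := (Finset.sum_eq_zero_iff_of_nonneg (fun i _ => by positivity)).1
        (hN.symm.trans h0.symm) i
        (Finset.mem_univ i)
      simpa using this
    subst this
    simp [ketbra, ← h0]
  · have h1 : ketbra φ = (N : ℂ) • ketbra (fun i => ((√N)⁻¹ : ℝ) • φ i) := by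
      ext i j
      have : ((√N : ℝ) : ℂ) * (√N : ℝ) = N := by
        rw [← Complex.ofReal_mul, Real.mul_self_sqrt hN0]
      have h2 : ((√N : ℝ) : ℂ) ≠ 0 := by
        simpa using (Real.sqrt_pos.2 h0).ne'
      simp [ketbra, Matrix.vecMulVec_apply]
      rw [← this]
      field_simp
    have h2 : ∑ i, ‖((√N)⁻¹ : ℝ) • φ i‖ ^ 2 = 1 := by
      simp only [norm_smul, mul_pow]
      rw [← Finset.mul_sum, ← hN, Real.norm_eq_abs, sq_abs, inv_pow, Real.sq_sqrt hN0,
        inv_mul_cancel₀ h0.ne']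
    rw [h1, map_smul, Matrix.mul_smul, Matrix.trace_smul, norm_smul, mul_comm]
    refine mul_le_mul ?_ (by simp [abs_of_pos h0]) (by positivity) hε
    exact (norm_trace_mul_le _ _ hM).trans (traceNorm_tensorId_ketbra_le hε h h2)

variable {R : Type} [Fintype R] [DecidableEq R]

theorem norm_one_kronecker_le_one {V : Matrix R A ℂ} {d : A → ℂ} (h : Vᴴ * V = Matrix.diagonal d)
    (hd : ∀ i, ‖d i‖ ≤ 1) : ‖(1 : Op B) ⊗ₖ V‖ ≤ 1 := by
  refine norm_le_one_of_conjTranspose_mul_self (d := fun x => d x.2) ?_ fun x => hd x.2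
  rw [Matrix.conjTranspose_kronecker, ← Matrix.mul_kronecker_mul, h, Matrix.conjTranspose_one,
    Matrix.one_mul, ← Matrix.diagonal_one, Matrix.diagonal_kronecker_diagonal]
  simp

/-- A bound on the diamond norm bounds the action on density operators, with any reference
space. -/
theorem norm_trace_tensorId_le {Φ : Op A →ₗ[ℂ] Op B} {ε : ℝ} (hε : 0 ≤ ε)
    (h : diamondNorm Φ ≤ ENNReal.ofReal ε) {τ : Op (A × R)} (hτ : IsDensity τ) {M : Op (B × R)}
    (hM : ‖M‖ ≤ 1) : ‖(M * tensorId Φ R τ).trace‖ ≤ ε := by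
  have key (ψ : A × R → ℂ) :
      ‖(M * tensorId Φ R (ketbra ψ)).trace‖ ≤ ε * ∑ i, ‖ψ i‖ ^ 2 := by
    -- Reshaped into a matrix, ψ has rank at most dim A, so a copy of A suffices as reference. The
    -- contraction `V` is moved onto `M` by cyclicity of the trace.
    obtain ⟨V, B', d, h1, h2, h3, h4⟩ := exists_contraction_mul (Matrix.of fun r a => ψ (a, r))
    set T : Matrix (B × R) (B × A) ℂ := (1 : Op B) ⊗ₖ V
    have hT : ‖T‖ ≤ 1 := norm_one_kronecker_le_one h2 h3
    set φ : A × A → ℂ := fun x => B' x.2 x.1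
    have hψ : ketbra ψ = ((1 : Op A) ⊗ₖ V) * ketbra φ * ((1 : Op A) ⊗ₖ V)ᴴ := by
      ext ⟨a, r⟩ ⟨a', r'⟩
      rw [one_kronecker_mul_mul_apply]
      have e1 (a : A) (r : R) : ψ (a, r) = ∑ c, V r c * B' c a := by
        have := congrFun (congrFun h1 r) a
        rwa [Matrix.mul_apply] at this
      simp only [ketbra, Matrix.vecMulVec_apply, Pi.star_apply, e1, star_sum, star_mul',
        Finset.sum_mul_sum]
      refine Finset.sum_congr rfl fun _ _ => Finset.sum_congr rfl fun _ _ => ?_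
      simp only [φ]
      ring
    have hnorm : ∑ i, ‖φ i‖ ^ 2 = ∑ i, ‖ψ i‖ ^ 2 := by
      have e1 := congrArg Matrix.trace h4
      have e2 (x : ℂ) : star x * x = ((‖x‖ ^ 2 : ℝ) : ℂ) := by
        rw [← Complex.normSq_eq_norm_sq]
        exact (Complex.normSq_eq_conj_mul_self).symm
      simp only [Matrix.trace, Matrix.diag, Matrix.mul_apply, Matrix.conjTranspose_apply, e2,
        Matrix.of_apply] at e1
      simp only [Fintype.sum_prod_type, φ]
      exact_mod_cast e1
    have hM' : ‖Tᴴ * M * T‖ ≤ 1 := by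
      have hT' : ‖Tᴴ‖ ≤ 1 := by rwa [Matrix.l2_opNorm_conjTranspose]
      refine (Matrix.l2_opNorm_mul _ _).trans (mul_le_one₀ ((Matrix.l2_opNorm_mul _ _).trans ?_)
        (norm_nonneg _) hT)
      exact mul_le_one₀ hT' (norm_nonneg _) hM
    have := norm_trace_tensorId_ketbra_le hε h φ hM'
    rw [hψ, tensorId_conj_right, ← hnorm]
    convert this using 2
    rw [← Matrix.mul_assoc, Matrix.trace_mul_comm]
    simp only [Matrix.mul_assoc]
    rfl
  -- The squared norms of these vectors sum to tr τ = 1, so the bounds for rank-one operators add up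
  -- to ε.
  obtain ⟨m, v, hv⟩ := Matrix.posSemidef_iff_eq_sum_vecMulVec.1 hτ.1
  have htr : ∑ j, ∑ i, ‖v j i‖ ^ 2 = 1 := by
    have := hτ.2
    rw [hv, Matrix.trace_sum] at this
    have h2 (j) := trace_ketbra (v j)
    simp only [ketbra] at h2
    simp only [h2] at this
    exact_mod_cast this
  rw [hv, map_sum, Matrix.mul_sum, Matrix.trace_sum]
  calc _ ≤ ∑ j, ‖(M * tensorId Φ R (ketbra (v j))).trace‖ := norm_sum_le _ _
    _ ≤ ∑ j, ε * ∑ i, ‖v j i‖ ^ 2 := Finset.sum_le_sum fun j _ => key (v j)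
    _ = ε := by rw [← Finset.mul_sum, htr, mul_one]

end

end

noncomputable section

/-! ### Completely positive trace-preserving maps -/

open scoped Matrix Kronecker

/-- Completely positive trace-preserving maps. -/
structure IsChannel {A B : Type} [Fintype A] [Fintype B] (Φ : Op A →ₗ[ℂ] Op B) : Prop where
  pos : ∀ (R : Type) [Fintype R] (X : Op (A × R)), X.PosSemidef → (tensorId Φ R X).PosSemidef
  trace : ∀ X, (Φ X).trace = X.trace

theorem trace_submatrix_equiv {A B : Type} [Fintype A] [Fintype B] (e : A ≃ B) (X : Op B) :
    (X.submatrix e e).trace = X.trace :=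
  e.sum_comp fun b => X b b

theorem trace_tensorId {A B R : Type} [Fintype A] [Fintype B] [Fintype R] {Φ : Op A →ₗ[ℂ] Op B}
    (h : ∀ X, (Φ X).trace = X.trace) (X : Op (A × R)) :
    (tensorId Φ R X).trace = X.trace := by
  simp only [Matrix.trace, Matrix.diag, Fintype.sum_prod_type_right]
  exact Finset.sum_congr rfl fun r _ => h (fun a a' => X (a, r) (a', r))

namespace IsChannel

variable {A B C R : Type} [Fintype A] [Fintype B] [Fintype C] [Fintype R]

theorem id : IsChannel (LinearMap.id : Op A →ₗ[ℂ] Op A) := ⟨fun _ _ _ h => h, fun _ => rfl⟩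

theorem comp {Φ : Op B →ₗ[ℂ] Op C} {Ψ : Op A →ₗ[ℂ] Op B} (hΦ : IsChannel Φ) (hΨ : IsChannel Ψ) :
    IsChannel (Φ ∘ₗ Ψ) :=
  ⟨fun R _ X h => hΦ.pos R _ (hΨ.pos R X h), fun X => (hΦ.trace _).trans (hΨ.trace X)⟩

theorem isDensity {Φ : Op A →ₗ[ℂ] Op B} (hΦ : IsChannel Φ) {ρ : Op (A × R)} (h : IsDensity ρ) :
    IsDensity (tensorId Φ R ρ) :=
  ⟨hΦ.pos R ρ h.1, (trace_tensorId hΦ.trace ρ).trans h.2⟩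

/-- Complete positivity covers every reference, in particular `R × Z`; what remains is
reassociation. -/
theorem tensorId {Φ : Op A →ₗ[ℂ] Op B} (hΦ : IsChannel Φ) (R : Type) [Fintype R] :
    IsChannel (tensorId Φ R) := by
  refine ⟨fun Z _ X h => ?_, trace_tensorId hΦ.trace⟩
  exact (hΦ.pos (R × Z) _ (h.submatrix fun x : A × R × Z => ((x.1, x.2.1), x.2.2))).submatrix
    fun x : (B × R) × Z => (x.1.1, x.1.2, x.2)

theorem isDensity_idTensor {Φ : Op A →ₗ[ℂ] Op B} (hΦ : IsChannel Φ) {ρ : Op (R × A)}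
    (h : IsDensity ρ) : IsDensity (idTensor R Φ ρ) := by
  have h1 : IsDensity (ρ.submatrix (Equiv.prodComm A R) (Equiv.prodComm A R)) :=
    ⟨h.1.submatrix _, (trace_submatrix_equiv _ ρ).trans h.2⟩
  have h2 := hΦ.isDensity h1
  exact ⟨h2.1.submatrix (Equiv.prodComm R B),
    (trace_submatrix_equiv (Equiv.prodComm R B) _).trans h2.2⟩

end IsChannel

section

variable {A B : Type} [Fintype A]

theorem kronecker_one_mul_mul_apply [DecidableEq A] {R : Type} [Fintype R] [DecidableEq R]
    (K : Matrix B A ℂ) (X : Op (A × R)) (b b' : B) (r r' : R) :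
    ((K ⊗ₖ (1 : Op R)) * X * (K ⊗ₖ (1 : Op R))ᴴ) (b, r) (b', r') =
      (K * (Matrix.of fun a a' => X (a, r) (a', r')) * Kᴴ) b b' := by
  have h1 (y : A × R) : ((K ⊗ₖ (1 : Op R)) * X) (b, r) y = ∑ c, K b c * X (c, r) y := by
    rw [Matrix.mul_apply, Fintype.sum_prod_type_right, Finset.sum_eq_single r]
    · simp
    · intro s _ hs
      simp [Matrix.one_apply_ne hs.symm]
    · simp
  rw [Matrix.mul_apply, Fintype.sum_prod_type_right, Finset.sum_eq_single r']
  · simp [h1, Matrix.mul_apply]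
  · intro s _ hs
    simp [Matrix.one_apply_ne hs.symm]
  · simp

theorem tensorId_eq_conj [DecidableEq A] {R : Type} [Fintype R] [DecidableEq R]
    {Φ : Op A →ₗ[ℂ] Op B} {K : Matrix B A ℂ} (h : ∀ X, Φ X = K * X * Kᴴ) (X : Op (A × R)) :
    tensorId Φ R X = (K ⊗ₖ (1 : Op R)) * X * (K ⊗ₖ (1 : Op R))ᴴ := by
  ext ⟨b, r⟩ ⟨b', r'⟩
  rw [kronecker_one_mul_mul_apply, ← h]
  rfl

variable [Fintype B]

/-- Conjugation by an isometry is a channel. -/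
theorem isChannel_of_conj [DecidableEq A] {Φ : Op A →ₗ[ℂ] Op B} {K : Matrix B A ℂ}
    (h : ∀ X, Φ X = K * X * Kᴴ) (hK : Kᴴ * K = 1) : IsChannel Φ := by
  classical
  refine ⟨fun R _ X hX => ?_, fun X => ?_⟩
  · rw [tensorId_eq_conj h]
    exact hX.mul_mul_conjTranspose_same _
  · rw [h, Matrix.trace_mul_comm, ← Matrix.mul_assoc, hK, Matrix.one_mul]

theorem isChannel_conjMap [DecidableEq A] {U : Op A} (hU : Uᴴ * U = 1) : IsChannel (conjMap U) :=
  isChannel_of_conj (K := U) (fun _ => (Matrix.mul_assoc _ _ _).symm) hU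

theorem conjTranspose_mul_self_of_perm [DecidableEq A] {f : A → A} (hf : Function.Injective f)
    {U : Op A} (hU : ∀ x y, U x y = if x = f y then 1 else 0) : Uᴴ * U = 1 := by
  ext x y
  simp [Matrix.mul_apply, hU, Matrix.one_apply, hf.eq_iff, eq_comm]

end

/-! ### Gates, circuits and the averaged encryption are channels -/

theorem isChannel_hadamard {n : ℕ} (i : Fin n) : IsChannel (QGate.hadamard i).channel := by
  refine isChannel_conjMap ?_
  have h2 (x y : Qubits n) : star (hadamardOp i y x) = hadamardOp i x y := by
    have : (∀ j, j ≠ i → y j = x j) ↔ ∀ j, j ≠ i → x j = y j := by simp only [eq_comm]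
    simp only [hadamardOp, this, and_comm]
    split_ifs <;> simp [Complex.conj_ofReal]
  have h3 : (((Real.sqrt 2 : ℝ) : ℂ)⁻¹) * ((Real.sqrt 2 : ℝ) : ℂ)⁻¹ = 2⁻¹ := by
    rw [← mul_inv, ← Complex.ofReal_mul, Real.mul_self_sqrt (by norm_num)]
    simp
  ext x y
  simp only [Matrix.mul_apply, Matrix.conjTranspose_apply, h2]
  have h4 := sum_ite_agree i x fun z => ((Real.sqrt 2 : ℝ) : ℂ)⁻¹ * hadamardSign (x i) (z i) *
    hadamardOp i z y
  have h5 : ∀ a, hadamardOp i (Function.update x i a) y = if ∀ j, j ≠ i → x j = y j then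
      ((Real.sqrt 2 : ℝ) : ℂ)⁻¹ * hadamardSign a (y i) else 0 := fun a => by
    have : (∀ j, j ≠ i → Function.update x i a j = y j) ↔ ∀ j, j ≠ i → x j = y j :=
      forall₂_congr fun j hj => by simp [hj]
    simp only [hadamardOp, this, Function.update_self, hadamardSign]
  have h6 : ∑ z, hadamardOp i x z * hadamardOp i z y =
      ∑ z, if ∀ j, j ≠ i → x j = z j then ((Real.sqrt 2 : ℝ) : ℂ)⁻¹ * hadamardSign (x i) (z i) *
        hadamardOp i z y else 0 := by
    refine Finset.sum_congr rfl fun z _ => ?_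
    conv_lhs => rw [hadamardOp]
    rw [ite_mul, zero_mul]
    rfl
  rw [h6, h4]
  simp only [h5, Function.update_self, Fintype.sum_bool]
  by_cases h : ∀ j, j ≠ i → x j = y j
  · simp only [if_pos h]
    by_cases hi : x i = y i
    · have hxy : x = y := funext fun j => by
        by_cases hj : j = i
        · rw [hj, hi]
        · exact h j hj
      subst hxy
      rw [Matrix.one_apply_eq]
      cases x i <;> simp [hadamardSign] <;> rw [h3] <;> norm_num
    · have hxy : x ≠ y := fun e => hi (by rw [e])
      rw [Matrix.one_apply_ne hxy]
      revert hi
      cases x i <;> cases y i <;> simp [hadamardSign]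
  · have hxy : x ≠ y := fun e => h fun j _ => by rw [e]
    rw [Matrix.one_apply_ne hxy]
    simp only [if_neg h]
    simp

theorem isChannel_tGate {n : ℕ} (i : Fin n) : IsChannel (QGate.tGate i).channel := by
  refine isChannel_conjMap ?_
  have h : star (Complex.exp (Complex.I * (Real.pi / 4 : ℝ))) *
      Complex.exp (Complex.I * (Real.pi / 4 : ℝ)) = 1 := by
    rw [Complex.star_def, ← Complex.exp_conj, ← Complex.exp_add, map_mul,
      Complex.conj_I, Complex.conj_ofReal, neg_mul, neg_add_cancel, Complex.exp_zero]
  rw [tOp, Matrix.diagonal_conjTranspose, Matrix.diagonal_mul_diagonal, ← Matrix.diagonal_one]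
  congr 1
  funext x
  by_cases hx : x i = true
  · simpa [hx] using h
  · simp [hx]

/-- Maps that embed the computational basis are channels. -/
theorem posSemidef_masked {A B : Type} [Fintype A] [Fintype B] {X : Op A} (hX : X.PosSemidef)
    (p : B → Prop) [DecidablePred p] (f : B → A) :
    (Matrix.of fun x y => if p x ∧ p y then X (f x) (f y) else 0 : Op B).PosSemidef := by
  classical
  convert (hX.submatrix f).mul_mul_conjTranspose_same
    (Matrix.diagonal fun x => if p x then (1 : ℂ) else 0) using 1
  ext x y
  rw [Matrix.diagonal_conjTranspose, Matrix.mul_diagonal, Matrix.diagonal_mul]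
  by_cases hx : p x <;> by_cases hy : p y <;> simp [hx, hy]

theorem isChannel_ancilla (n : ℕ) : IsChannel (ancillaMap n) := by
  refine ⟨fun R _ X hX => ?_, fun X => ?_⟩
  · convert posSemidef_masked hX (fun x : Qubits (n + 1) × R => x.1 0 = false)
      (fun x => (Fin.tail x.1, x.2)) using 1
    rfl
  · simp only [Matrix.trace, Matrix.diag]
    rw [sum_qubits_succ]
    simp [ancillaMap]

theorem isChannel_discard {n : ℕ} (i : Fin (n + 1)) : IsChannel (discardMap i) := by
  refine ⟨fun R _ X hX => ?_, fun X => ?_⟩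
  · have : tensorId (discardMap i) R X = ∑ b : Bool, X.submatrix
        (fun x => (Fin.insertNth (α := fun _ => Bool) i b x.1, x.2))
        (fun x => (Fin.insertNth (α := fun _ => Bool) i b x.1, x.2)) := by
      ext x y
      rw [Matrix.sum_apply]
      rfl
    rw [this]
    exact Matrix.posSemidef_sum _ fun b _ => hX.submatrix _
  · simp only [Matrix.trace, Matrix.diag]
    rw [← (Fin.insertNthEquiv (fun _ => Bool) i).sum_comp, Fintype.sum_prod_type_right]
    rfl

theorem isChannel_attachKey {m : ℕ} (n : ℕ) (k : Qubits m) : IsChannel (attachKey n k) := by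
  refine ⟨fun R _ X hX => ?_, fun X => ?_⟩
  · convert posSemidef_masked hX
      (fun x : Qubits (m + n) × R => (fun i => x.1 (Fin.castAdd n i)) = k)
      (fun x => (fun i => x.1 (Fin.natAdd m i), x.2)) using 1
    rfl
  · simp only [Matrix.trace, Matrix.diag]
    rw [← (Fin.appendEquiv m n).sum_comp, Fintype.sum_prod_type]
    simp [attachKey, Fin.appendEquiv]

theorem QGate.isChannel {n m : ℕ} (g : QGate n m) : IsChannel g.channel := by
  cases g with
  | hadamard i => exact isChannel_hadamard i
  | tGate i => exact isChannel_tGate i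
  | cnot i j hij =>
    exact isChannel_conjMap (U := cnotOp i j)
      (conjTranspose_mul_self_of_perm (involutive_cnot hij).injective fun _ _ => rfl)
  | toffoli i j k hij hik hjk =>
    exact isChannel_conjMap (U := toffoliOp i j k)
      (conjTranspose_mul_self_of_perm (involutive_toffoli hik hjk).injective fun _ _ => rfl)
  | ancilla => exact isChannel_ancilla n
  | discard i => exact isChannel_discard i

theorem QCircuit.isChannel {n m : ℕ} (c : QCircuit n m) : IsChannel c.channel := by
  induction c with
  | nil => exact IsChannel.id
  | cons g c ih => exact ih.comp g.isChannel

theorem EncryptionCircuit.isChannel_chan (E : EncryptionCircuit) (k : Qubits E.m) :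
    IsChannel (E.chan k) :=
  E.circuit.isChannel.comp (isChannel_attachKey E.n k)

theorem EncryptionCircuit.tensorId_average (E : EncryptionCircuit) (R : Type)
    (X : Op (Qubits E.n × R)) :
    tensorId E.average R X = ((2 : ℂ) ^ E.m)⁻¹ • ∑ k, tensorId (E.chan k) R X := by
  ext x y
  have h (Y : Op (Qubits E.n)) :
      E.average Y x.1 y.1 = ((2 : ℂ) ^ E.m)⁻¹ * ∑ k, E.chan k Y x.1 y.1 := by
    simp only [average, LinearMap.smul_apply, LinearMap.sum_apply, Matrix.smul_apply,
      Matrix.sum_apply, smul_eq_mul]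
  rw [Matrix.smul_apply, Matrix.sum_apply]
  exact h fun a a' => X (a, x.2) (a', y.2)

theorem EncryptionCircuit.isChannel_average (E : EncryptionCircuit) : IsChannel E.average := by
  refine ⟨fun R _ X hX => ?_, fun X => ?_⟩
  · rw [E.tensorId_average]
    refine (Matrix.posSemidef_sum _ fun k _ => (E.isChannel_chan k).pos R X hX).smul ?_
    rw [← Complex.ofReal_ofNat, ← Complex.ofReal_pow, ← Complex.ofReal_inv]
    exact_mod_cast (by positivity : (0 : ℝ) ≤ ((2 : ℝ) ^ E.m)⁻¹)
  · simp only [average, LinearMap.smul_apply, LinearMap.sum_apply, Matrix.trace_smul,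
      Matrix.trace_sum, (E.isChannel_chan _).trace]
    simp

/-- With a reference, the output is a multiple of 𝟙 ⊗ tr_A X, a Kronecker product of positive
semidefinite operators. -/
theorem isChannel_depolarizing (A B : Type) [Fintype A] [Fintype B] [DecidableEq B] [Nonempty B] :
    IsChannel (depolarizing A B) := by
  have hd : (Fintype.card B : ℂ) ≠ 0 := by simp
  refine ⟨fun R _ X hX => ?_, fun X => ?_⟩
  · have h1 : (∑ a, X.submatrix (fun r : R => (a, r)) (fun r => (a, r))).PosSemidef :=
      Matrix.posSemidef_sum _ fun a _ => hX.submatrix _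
    have h2 : tensorId (depolarizing A B) R X = (Fintype.card B : ℂ)⁻¹ •
        ((1 : Op B) ⊗ₖ ∑ a, X.submatrix (fun r : R => (a, r)) (fun r => (a, r))) := by
      ext x y
      change (∑ a, X (a, x.2) (a, y.2)) * ((Fintype.card B : ℂ)⁻¹ * (1 : Op B) x.1 y.1) =
        (Fintype.card B : ℂ)⁻¹ * ((1 : Op B) x.1 y.1 * _)
      rw [Matrix.sum_apply]
      simp only [Matrix.submatrix_apply]
      ring
    rw [h2]
    refine (Matrix.PosSemidef.one.kronecker h1).smul ?_
    rw [← Complex.ofReal_natCast, ← Complex.ofReal_inv]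
    exact_mod_cast (by positivity : (0 : ℝ) ≤ ((Fintype.card B : ℝ))⁻¹)
  · simp [depolarizing, hd]

theorem padding_conjTranspose_mul_self {n l : ℕ} (h : n ≤ l) :
    (padding h)ᴴ * padding h = 1 := by
  let f (x : Qubits n) : Qubits l := fun j => if hj : (j : ℕ) < n then x ⟨j, hj⟩ else false
  have hf (y : Qubits l) (x : Qubits n) : padding h y x = if y = f x then 1 else 0 := by
    refine if_congr ⟨fun hy => funext fun j => ?_, ?_⟩ rfl rfl
    · by_cases hj : (j : ℕ) < n
      · simpa [f, hj] using hy.1 ⟨j, hj⟩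
      · simpa [f, hj] using hy.2 j (not_lt.1 hj)
    · rintro rfl
      exact ⟨fun i => by simp [f], fun j hj => by simp [f, not_lt.2 hj]⟩
  have hinj : Function.Injective f := fun x y hxy => funext fun i => by
    simpa [f] using congrFun hxy (Fin.castLE h i)
  ext x y
  simp [Matrix.mul_apply, hf, Matrix.one_apply, hinj.eq_iff, eq_comm]

theorem isChannel_paddingMap {n l : ℕ} (h : n ≤ l) : IsChannel (paddingMap h) :=
  isChannel_of_conj (fun _ => rfl) (padding_conjTranspose_mul_self h)

end

noncomputable section

/-! ### Completeness of the swap test -/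

open scoped Matrix Kronecker Matrix.Norms.L2Operator

theorem mapTensor_kronecker {A A' B B' : Type} (Φ : Op A →ₗ[ℂ] Op B) (Ψ : Op A' →ₗ[ℂ] Op B')
    (X : Op A) (Y : Op A') : mapTensor Φ Ψ (X ⊗ₖ Y) = Φ X ⊗ₖ Ψ Y := by
  ext ⟨b, b'⟩ ⟨c, c'⟩
  have h1 (t : ℂ) : Ψ (t • Y) b' c' = Ψ Y b' c' * t := by
    rw [map_smul, Matrix.smul_apply, smul_eq_mul, mul_comm]
  have h2 : Φ (Ψ Y b' c' • X) b c = Φ X b c * Ψ Y b' c' := by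
    rw [map_smul, Matrix.smul_apply, smul_eq_mul, mul_comm]
  refine Eq.trans ?_ h2
  exact congrArg (fun Z => Φ Z b c) (funext fun a => funext fun d => h1 (X a d))

theorem ketbra_kronecker {A A' : Type} (v : A → ℂ) (w : A' → ℂ) :
    ketbra (fun x : A × A' => v x.1 * w x.2) = ketbra v ⊗ₖ ketbra w := by
  ext x y
  simp only [ketbra, Matrix.vecMulVec_apply, Matrix.kroneckerMap_apply, Pi.star_apply, star_mul']
  ring

/-- The swap trick: it makes the swap test on two equal copies a purity test. -/
theorem trace_swapOp_mul_kronecker {A : Type} [Fintype A] [DecidableEq A] (X Y : Op A) :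
    (swapOp A * (X ⊗ₖ Y)).trace = (Y * X).trace := by
  rw [trace_swapOp_mul, Fintype.sum_prod_type]
  simp only [Matrix.trace, Matrix.diag, Matrix.mul_apply, Matrix.kroneckerMap_apply,
    Prod.swap_prod_mk]
  exact Finset.sum_congr rfl fun _ _ => Finset.sum_congr rfl fun _ _ => mul_comm _ _

/-- Two states that no measurement tells apart well overlap well if one of them is pure. -/
theorem one_sub_le_trace_mul_self {A : Type} [Fintype A] [DecidableEq A] {ε : ℝ} {σ P : Op A}
    (hσ : IsDensity σ) (hP : IsDensity P) (hPP : P * P = P)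
    (h : ∀ M : Op A, ‖M‖ ≤ 1 → ‖(M * (σ - P)).trace‖ ≤ ε) : 1 - 2 * ε ≤ (σ * σ).trace.re := by
  have h1 : (σ * σ).trace = 1 + (P * (σ - P)).trace + (σ * (σ - P)).trace := by
    rw [Matrix.mul_sub, Matrix.mul_sub, Matrix.trace_sub, Matrix.trace_sub, hPP, hP.2,
      Matrix.trace_mul_comm σ P]
    ring
  have h2 := (abs_le.1 ((Complex.abs_re_le_norm _).trans (h P hP.norm_le_one))).1
  have h3 := (abs_le.1 ((Complex.abs_re_le_norm _).trans (h σ hσ.norm_le_one))).1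
  rw [h1, Complex.add_re, Complex.add_re, Complex.one_re]
  linarith

theorem exists_unit_mem {A : Type} [Fintype A] {S : Submodule ℂ (A → ℂ)}
    (h : 0 < Module.finrank ℂ S) : ∃ s ∈ S, ∑ a, ‖s a‖ ^ 2 = 1 := by
  obtain ⟨⟨v, hv⟩, hne⟩ := (Module.finrank_pos_iff_exists_ne_zero (R := ℂ)).1 h
  have hv0 : v ≠ 0 := fun e => hne (Subtype.ext e)
  obtain ⟨i, hi⟩ := Function.ne_iff.1 hv0
  have hpos : 0 < ∑ a, ‖v a‖ ^ 2 :=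
    Finset.sum_pos' (fun _ _ => by positivity) ⟨i, Finset.mem_univ i, by
      have : 0 < ‖v i‖ := norm_pos_iff.2 hi
      positivity⟩
  refine ⟨((Real.sqrt (∑ a, ‖v a‖ ^ 2) : ℝ) : ℂ)⁻¹ • v, S.smul_mem _ hv, ?_⟩
  simp only [Pi.smul_apply, smul_eq_mul, norm_mul, norm_inv, Complex.norm_real, mul_pow,
    ← Finset.mul_sum, inv_pow, Real.norm_eq_abs, sq_abs, Real.sq_sqrt hpos.le]
  exact inv_mul_cancel₀ hpos.ne'

theorem sum_norm_sq_mul {A A' : Type} [Fintype A] [Fintype A'] (v : A → ℂ) (w : A' → ℂ) :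
    ∑ x : A × A', ‖v x.1 * w x.2‖ ^ 2 = (∑ a, ‖v a‖ ^ 2) * ∑ b, ‖w b‖ ^ 2 := by
  simp only [norm_mul, mul_pow, Fintype.sum_prod_type, Finset.sum_mul_sum]

theorem isDensity_ketbra {A : Type} [Fintype A] {v : A → ℂ} (hv : ∑ i, ‖v i‖ ^ 2 = 1) :
    IsDensity (ketbra v) :=
  ⟨posSemidef_ketbra v, by rw [trace_ketbra, hv]; simp⟩

theorem isDensityOn_ketbra {A R : Type} [Fintype A] [Fintype R] {S : Submodule ℂ (A → ℂ)}
    {v : A × R → ℂ} (hv : ∑ i, ‖v i‖ ^ 2 = 1) (hS : ∀ r, (fun a => v (a, r)) ∈ S) :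
    IsDensityOn S (ketbra v) := by
  refine ⟨isDensity_ketbra hv, fun w r => ?_⟩
  convert S.smul_mem (star v ⬝ᵥ w) (hS r) using 1
  funext a
  simp [ketbra, Matrix.vecMulVec_mulVec, mul_comm]

/-- A product of a unit vector of `S` with a basis vector of `R` suffices: all its slices are
multiples of the former. -/
theorem exists_unit_isDensityOn {A : Type} (R : Type) [Fintype A] [Fintype R] [Nonempty R]
    {S : Submodule ℂ (A → ℂ)} (h : 0 < Module.finrank ℂ S) :
    ∃ ψ : A × R → ℂ, ∑ i, ‖ψ i‖ ^ 2 = 1 ∧ IsDensityOn S (ketbra ψ) := by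
  classical
  obtain ⟨s, hs, h1⟩ := exists_unit_mem h
  obtain ⟨r₀⟩ := ‹Nonempty R›
  have h2 : ∑ x : A × R, ‖s x.1 * (Pi.single r₀ (1 : ℂ) : R → ℂ) x.2‖ ^ 2 = 1 := by
    rw [sum_norm_sq_mul, h1, one_mul, Finset.sum_eq_single r₀]
    · simp
    · intro b _ hb
      simp [hb]
    · simp
  refine ⟨_, h2, isDensityOn_ketbra h2 fun r => ?_⟩
  convert S.smul_mem ((Pi.single r₀ (1 : ℂ) : R → ℂ) r) hs using 1
  funext a
  simp [mul_comm]

namespace EncryptionCircuit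

variable (E : EncryptionCircuit)

theorem protocolAcceptProb_ketbra (ψ : Qubits E.n × Qubits E.n → ℂ)
    (hψ : ∑ i, ‖ψ i‖ ^ 2 = 1) :
    E.protocolAcceptProb (ketbra fun x => ψ x.1 * ψ x.2) =
      2⁻¹ * (1 + (tensorId E.average (Qubits E.n) (ketbra ψ) *
        tensorId E.average (Qubits E.n) (ketbra ψ)).trace.re) := by
  have h1 := (E.isChannel_average.isDensity (isDensity_ketbra hψ)).2
  rw [protocolAcceptProb_eq, trace_symProj_mul, swapTestInput, ketbra_kronecker,
    mapTensor_kronecker, ← trace_swapOp_mul, trace_swapOp_mul_kronecker]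
  have h2 : ∑ z, (tensorId E.average (Qubits E.n) (ketbra ψ) ⊗ₖ
      tensorId E.average (Qubits E.n) (ketbra ψ)) z z = 1 :=
    (Matrix.trace_kronecker _ _).trans (by rw [h1, mul_one])
  rw [h2, show (2⁻¹ : ℂ) = ((2⁻¹ : ℝ) : ℂ) by simp, Complex.re_ofReal_mul, Complex.add_re,
    Complex.one_re]

/-- All keys approximate the same key-independent target, so the triangle inequality passes the
bound to the average. -/
theorem norm_trace_average_sub_le {ε : ℝ} {R : Type} [Fintype R] [DecidableEq R]
    {ρ : Op (Qubits E.n × R)} (h : ∀ k : Qubits E.m,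
      traceNorm (tensorId (E.chan k) R ρ - tensorId (paddingMap E.le) R ρ) ≤ ε)
    {M : Op (Qubits E.l × R)} (hM : ‖M‖ ≤ 1) :
    ‖(M * (tensorId E.average R ρ - tensorId (paddingMap E.le) R ρ)).trace‖ ≤ ε := by
  have h0 : ((2 : ℂ) ^ E.m) ≠ 0 := by positivity
  have h1 : tensorId E.average R ρ - tensorId (paddingMap E.le) R ρ = ((2 : ℂ) ^ E.m)⁻¹ •
      ∑ k, (tensorId (E.chan k) R ρ - tensorId (paddingMap E.le) R ρ) := by
    rw [tensorId_average, Finset.sum_sub_distrib, smul_sub, Finset.sum_const, Finset.card_univ,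
      ← Nat.cast_smul_eq_nsmul ℂ, smul_smul]
    simp [h0]
  rw [h1, Matrix.mul_smul, Matrix.trace_smul, Matrix.mul_sum, Matrix.trace_sum, norm_smul]
  have h2 : ‖∑ k, (M * (tensorId (E.chan k) R ρ - tensorId (paddingMap E.le) R ρ)).trace‖ ≤
      2 ^ E.m * ε := by
    refine (norm_sum_le _ _).trans ((Finset.sum_le_card_nsmul _ _ ε fun k _ =>
      (norm_trace_mul_le _ _ hM).trans (h k)).trans_eq ?_)
    simp
  rw [norm_inv, norm_pow, Complex.norm_ofNat]
  calc _ ≤ ((2 : ℝ) ^ E.m)⁻¹ * (2 ^ E.m * ε) := by gcongr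
    _ = ε := by field_simp

/-- The padded ψ is pure because padding is an isometry. The averaged output is ε-close to it, hence
has purity at least 1 - 2ε, and the swap test halves the loss. -/
theorem exists_accepted {ε : ℝ} {S : Submodule ℂ (Qubits E.n → ℂ)}
    (hS : 0 < Module.finrank ℂ S) (h : ∀ ρ : Op (Qubits E.n × Qubits E.n), IsDensityOn S ρ →
      ∀ k : Qubits E.m, traceNorm (tensorId (E.chan k) (Qubits E.n) ρ -
        tensorId (paddingMap E.le) (Qubits E.n) ρ) ≤ ε) :
    ∃ ψ : Qubits E.n × Qubits E.n → ℂ, ∑ i, ‖ψ i‖ ^ 2 = 1 ∧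
      1 - ε ≤ E.protocolAcceptProb (ketbra fun x => ψ x.1 * ψ x.2) := by
  obtain ⟨ψ, h1, h2⟩ := exists_unit_isDensityOn (Qubits E.n) hS
  refine ⟨ψ, h1, ?_⟩
  have hd := isDensity_ketbra h1
  have hP : tensorId (paddingMap E.le) (Qubits E.n) (ketbra ψ) *
      tensorId (paddingMap E.le) (Qubits E.n) (ketbra ψ) =
      tensorId (paddingMap E.le) (Qubits E.n) (ketbra ψ) := by
    rw [tensorId_eq_conj (K := padding E.le) fun _ => rfl]
    set K := padding E.le ⊗ₖ (1 : Op (Qubits E.n)) with hK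
    have hKK : Kᴴ * K = 1 := by
      rw [hK, Matrix.conjTranspose_kronecker, ← Matrix.mul_kronecker_mul,
        padding_conjTranspose_mul_self]
      simp
    have h3 : ketbra ψ * ketbra ψ = ketbra ψ := by
      rw [ketbra_mul_ketbra, h1]
      simp
    calc K * ketbra ψ * Kᴴ * (K * ketbra ψ * Kᴴ) = K * ketbra ψ * (Kᴴ * K) * ketbra ψ * Kᴴ := by
          simp only [Matrix.mul_assoc]
      _ = K * ketbra ψ * Kᴴ := by rw [hKK, Matrix.mul_one, Matrix.mul_assoc K, h3]
  have h4 := one_sub_le_trace_mul_self (E.isChannel_average.isDensity hd)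
    ((isChannel_paddingMap E.le).isDensity hd) hP
    fun M hM => E.norm_trace_average_sub_le (h _ h2) hM
  rw [E.protocolAcceptProb_ketbra ψ h1]
  linarith

end EncryptionCircuit

end

noncomputable section

/-! ### Soundness of the swap test -/

open scoped Matrix Kronecker Matrix.Norms.L2Operator

theorem trace_mul_submatrix_equiv {A B : Type} [Fintype A] [Fintype B] (e : A ≃ B) (M : Op A)
    (X : Op B) : (M * X.submatrix e e).trace = (M.submatrix e.symm e.symm * X).trace := by
  rw [← trace_submatrix_equiv e (M.submatrix e.symm e.symm * X),
    ← Matrix.submatrix_mul_equiv _ _ e e e]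
  simp

theorem isometry_submatrix_equiv {A B : Type} [Fintype A] [Fintype B] [DecidableEq A]
    [DecidableEq B] (e : A ≃ B) {M : Op B} (h : Mᴴ * M = 1) :
    (M.submatrix e e)ᴴ * M.submatrix e e = 1 := by
  rw [Matrix.conjTranspose_submatrix, Matrix.submatrix_mul_equiv, h, Matrix.submatrix_one_equiv]

theorem IsDensity.submatrix_equiv {A B : Type} [Fintype A] [Fintype B] (e : A ≃ B) {ρ : Op B}
    (h : IsDensity ρ) : IsDensity (ρ.submatrix e e) :=
  ⟨h.1.submatrix e, (trace_submatrix_equiv e ρ).trans h.2⟩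

theorem swapOp_conjTranspose_mul_self (A : Type) [Fintype A] [DecidableEq A] :
    (swapOp A)ᴴ * swapOp A = 1 :=
  conjTranspose_mul_self_of_perm Prod.swap_injective fun _ _ => rfl

/-- `mapTensor` applies the second factor first. Exchanging the channel in that factor requires the
opposite order, where it acts last on a density operator. -/
theorem mapTensor_eq_idTensor {A A' B B' : Type} [Fintype A] [DecidableEq A] [Fintype A']
    [DecidableEq A'] (Φ : Op A →ₗ[ℂ] Op B) (Ψ : Op A' →ₗ[ℂ] Op B') (X : Op (A × A')) :
    mapTensor Φ Ψ X = idTensor B Ψ (tensorId Φ A' X) := by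
  ext ⟨b, b'⟩ ⟨c, c'⟩
  exact linearMap_apply_comm Φ Ψ (fun u u' v v' => X (u, u') (v, v')) b c b' c'

section

variable {A B R Z : Type} [Fintype A] [DecidableEq A] [Fintype B] [DecidableEq B] [Fintype R]
  [DecidableEq R] [Fintype Z] [DecidableEq Z]

/-- The spaces `R` and `Z` together form one large reference for `Δ`. Being an isometry, unlike a
norm bound, transfers to reindexed matrices by plain algebra. -/
theorem norm_trace_tensorId_tensorId_le {Δ : Op A →ₗ[ℂ] Op B} {ε : ℝ} (hε : 0 ≤ ε)
    (h : diamondNorm Δ ≤ ENNReal.ofReal ε) {τ : Op ((A × R) × Z)} (hτ : IsDensity τ)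
    {M : Op ((B × R) × Z)} (hM : Mᴴ * M = 1) :
    ‖(M * tensorId (tensorId Δ R) Z τ).trace‖ ≤ ε := by
  have h1 : tensorId (tensorId Δ R) Z τ = (tensorId Δ (R × Z)
      (τ.submatrix (Equiv.prodAssoc A R Z).symm (Equiv.prodAssoc A R Z).symm)).submatrix
      (Equiv.prodAssoc B R Z) (Equiv.prodAssoc B R Z) := rfl
  rw [h1, trace_mul_submatrix_equiv]
  exact norm_trace_tensorId_le hε h (hτ.submatrix_equiv _)
    (norm_le_one_of_isometry (isometry_submatrix_equiv _ hM))

theorem norm_trace_idTensor_tensorId_le {Δ : Op A →ₗ[ℂ] Op B} {ε : ℝ} (hε : 0 ≤ ε)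
    (h : diamondNorm Δ ≤ ENNReal.ofReal ε) {τ : Op (Z × (A × R))} (hτ : IsDensity τ)
    {M : Op (Z × (B × R))} (hM : Mᴴ * M = 1) :
    ‖(M * idTensor Z (tensorId Δ R) τ).trace‖ ≤ ε := by
  have h1 : idTensor Z (tensorId Δ R) τ = (tensorId (tensorId Δ R) Z
      (τ.submatrix (Equiv.prodComm _ _) (Equiv.prodComm _ _))).submatrix
      (Equiv.prodComm _ _) (Equiv.prodComm _ _) := rfl
  rw [h1, trace_mul_submatrix_equiv]
  exact norm_trace_tensorId_tensorId_le hε h (hτ.submatrix_equiv _)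
    (isometry_submatrix_equiv _ hM)

/-- Channels that are close in the diamond norm are close after two parallel uses. -/
theorem norm_trace_mapTensor_sub_le {Φ Ψ : Op A →ₗ[ℂ] Op B} (hΦ : IsChannel Φ)
    (hΨ : IsChannel Ψ) {ε : ℝ} (hε : 0 ≤ ε) (h : diamondNorm (Φ - Ψ) ≤ ENNReal.ofReal ε)
    {ρ : Op ((A × R) × (A × R))} (hρ : IsDensity ρ) {M : Op ((B × R) × (B × R))}
    (hM : Mᴴ * M = 1) :
    ‖(M * mapTensor (tensorId Φ R) (tensorId Φ R) ρ).trace -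
      (M * mapTensor (tensorId Ψ R) (tensorId Ψ R) ρ).trace‖ ≤ 2 * ε := by
  -- A hybrid argument: each difference is one use of Φ - Ψ on a density operator, the other factor
  -- having already acted.
  have h1 : mapTensor (tensorId Φ R) (tensorId Φ R) ρ -
      mapTensor (tensorId Ψ R) (tensorId Φ R) ρ = tensorId (tensorId (Φ - Ψ) R) (B × R)
        (idTensor (A × R) (tensorId Φ R) ρ) := rfl
  have h2 : mapTensor (tensorId Ψ R) (tensorId Φ R) ρ -
      mapTensor (tensorId Ψ R) (tensorId Ψ R) ρ = idTensor (B × R) (tensorId (Φ - Ψ) R)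
        (tensorId (tensorId Ψ R) (A × R) ρ) := by
    rw [mapTensor_eq_idTensor, mapTensor_eq_idTensor]
    rfl
  have h3 := norm_trace_tensorId_tensorId_le hε h ((hΦ.tensorId R).isDensity_idTensor hρ) hM
  have h4 := norm_trace_idTensor_tensorId_le hε h ((hΨ.tensorId R).isDensity hρ) hM
  rw [← h1, Matrix.mul_sub, Matrix.trace_sub] at h3
  rw [← h2, Matrix.mul_sub, Matrix.trace_sub] at h4
  calc _ ≤ _ := norm_sub_le_norm_sub_add_norm_sub _
        (M * mapTensor (tensorId Ψ R) (tensorId Φ R) ρ).trace _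
    _ ≤ 2 * ε := by linarith

end

/-- Positivity is tested on the difference of two basis vectors. -/
theorem Matrix.PosSemidef.two_mul_re_le {A : Type} [Fintype A] {ρ : Op A} (h : ρ.PosSemidef)
    (x y : A) : 2 * (ρ x y).re ≤ (ρ x x).re + (ρ y y).re := by
  classical
  have h1 := h.dotProduct_mulVec_nonneg (Pi.single x 1 - Pi.single y 1)
  have h2 := congrArg Complex.re (h.isHermitian.apply x y)
  have h3 := (Complex.le_def.1 h1).1
  simp [Matrix.mulVec_sub, sub_dotProduct, dotProduct_sub] at h3 h2
  linarith

theorem re_sum_le_of_involutive {A : Type} [Fintype A] {ρ : Op A} (h : IsDensity ρ) {f : A → A}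
    (hf : Function.Involutive f) : (∑ z, ρ (f z) z).re ≤ 1 := by
  have h1 : ∑ z, (ρ z z).re = 1 := by
    rw [← Complex.re_sum]
    exact congrArg Complex.re h.2
  have h2 : ∑ z, (ρ (f z) (f z)).re = 1 :=
    (Equiv.sum_comp hf.toPerm fun z => (ρ z z).re).trans h1
  have h3 : ∑ z, 2 * (ρ (f z) z).re ≤ ∑ z, ((ρ (f z) (f z)).re + (ρ z z).re) :=
    Finset.sum_le_sum fun z _ => h.1.two_mul_re_le _ _
  rw [← Finset.mul_sum, Finset.sum_add_distrib, h1, h2] at h3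
  rw [Complex.re_sum]
  linarith

/-- Two maximally mixed registers of dimension d have swap expectation d · d⁻² = d⁻¹. The other
factor is the expectation in ρ of the swap of the two references alone, which is the involution `f`.
-/
theorem re_trace_swapOp_mul_depolarizing_le {A B R : Type} [Fintype A] [Fintype B]
    [DecidableEq B] [Nonempty B] [Fintype R] [DecidableEq R] {ρ : Op ((A × R) × (A × R))}
    (h : IsDensity ρ) :
    (swapOp (B × R) * mapTensor (tensorId (depolarizing A B) R) (tensorId (depolarizing A B) R)
      ρ).trace.re ≤ (Fintype.card B : ℝ)⁻¹ := by
  have hd : (Fintype.card B : ℂ) ≠ 0 := by simp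
  let f : (A × R) × (A × R) → (A × R) × (A × R) := fun z => ((z.1.1, z.2.2), (z.2.1, z.1.2))
  have h1 := re_sum_le_of_involutive h (f := f) fun _ => rfl
  let F : R → R → ℂ := fun s s' => ∑ u, ∑ u', ρ ((u, s'), (u', s)) ((u, s), (u', s'))
  have h2 (z : (B × R) × (B × R)) :
      mapTensor (tensorId (depolarizing A B) R) (tensorId (depolarizing A B) R) ρ z.swap z =
        if z.1.1 = z.2.1 then F z.1.2 z.2.2 * ((Fintype.card B : ℂ)⁻¹ * (Fintype.card B : ℂ)⁻¹)
          else 0 := by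
    obtain ⟨⟨c, s⟩, ⟨c', s'⟩⟩ := z
    change (∑ u, (∑ u', ρ ((u, s'), (u', s)) ((u, s), (u', s'))) *
      ((Fintype.card B : ℂ)⁻¹ * (1 : Op B) c c')) * ((Fintype.card B : ℂ)⁻¹ * (1 : Op B) c' c) = _
    rw [← Finset.sum_mul]
    by_cases hc : c = c'
    · subst hc
      simp [F, mul_assoc]
    · simp [Matrix.one_apply_ne hc, hc]
  have h3 : (swapOp (B × R) * mapTensor (tensorId (depolarizing A B) R)
      (tensorId (depolarizing A B) R) ρ).trace = (Fintype.card B : ℂ)⁻¹ * ∑ z, ρ (f z) z := by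
    have h4 (G : R → R → ℂ) : ∑ b : B, ∑ r, ∑ b' : B, ∑ r', (if b = b' then G r r' else 0) =
        Fintype.card B * ∑ r, ∑ r', G r r' := by
      simp
    have h5 : ∑ r, ∑ r', F r r' = ∑ z, ρ (f z) z := by
      simp only [Fintype.sum_prod_type, F, f]
      calc _ = ∑ r, ∑ u, ∑ r', ∑ u', ρ ((u, r'), (u', r)) ((u, r), (u', r')) :=
            Finset.sum_congr rfl fun _ _ => Finset.sum_comm
        _ = ∑ u, ∑ r, ∑ r', ∑ u', ρ ((u, r'), (u', r)) ((u, r), (u', r')) := Finset.sum_comm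
        _ = _ := Finset.sum_congr rfl fun _ _ => Finset.sum_congr rfl fun _ _ => Finset.sum_comm
    rw [← h5, trace_swapOp_mul]
    simp only [h2, Fintype.sum_prod_type]
    rw [h4]
    simp only [← Finset.sum_mul]
    field_simp
  rw [h3, ← Complex.ofReal_natCast, ← Complex.ofReal_inv, Complex.re_ofReal_mul]
  exact mul_le_of_le_one_right (by positivity) h1

/-- Only the swap half of the symmetric projection is perturbed, the identity half giving exactly 1.
The error 2ε of the two replacements therefore enters as ε. -/
theorem EncryptionCircuit.protocolAcceptProb_le (E : EncryptionCircuit) {ε : ℝ} (hε : 0 ≤ ε)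
    (h : diamondNorm (depolarizing (Qubits E.n) (Qubits E.l) - E.average) ≤ ENNReal.ofReal ε)
    {ρ : Op ((Qubits E.n × Qubits E.n) × (Qubits E.n × Qubits E.n))} (hρ : IsDensity ρ) :
    E.protocolAcceptProb ρ ≤ 1 / 2 + 1 / (2 * 2 ^ E.l) + ε := by
  have h1 := norm_trace_mapTensor_sub_le (isChannel_depolarizing _ _) E.isChannel_average hε h hρ
    (swapOp_conjTranspose_mul_self _)
  have h2 := re_trace_swapOp_mul_depolarizing_le (B := Qubits E.l) hρ
  have h3 : ∑ z, E.swapTestInput ρ z z = 1 :=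
    ((E.isChannel_average.tensorId _).isDensity
      ((E.isChannel_average.tensorId _).isDensity_idTensor hρ)).2
  have h4 := (abs_le.1 ((Complex.abs_re_le_norm _).trans h1)).1
  rw [Complex.sub_re] at h4
  rw [protocolAcceptProb_eq, trace_symProj_mul, h3, ← trace_swapOp_mul,
    show (2⁻¹ : ℂ) = ((2⁻¹ : ℝ) : ℂ) by simp, Complex.re_ofReal_mul, Complex.add_re,
    Complex.one_re, swapTestInput]
  have h5 : (Fintype.card (Qubits E.l) : ℝ)⁻¹ = (2 ^ E.l)⁻¹ := by simp
  have h6 : 1 / (2 * 2 ^ E.l : ℝ) = 2⁻¹ * (2 ^ E.l)⁻¹ := by rw [one_div, mul_inv]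
  rw [h5] at h2
  rw [h6]
  linarith

end

noncomputable section

/-! ### The protocol -/

/-- Concatenation of registers, as a bijection. -/
def joinRegistersEquiv (n : ℕ) :
    (Qubits n × Qubits n) × (Qubits n × Qubits n) ≃ Qubits ((n + n) + (n + n)) :=
  ((Fin.appendEquiv n n).prodCongr (Fin.appendEquiv n n)).trans (Fin.appendEquiv (n + n) (n + n))

theorem coe_joinRegistersEquiv (n : ℕ) : ⇑(joinRegistersEquiv n) = joinRegisters := rfl

theorem detectInsecure_complete {ε δ : ℝ} {p : Polynomial ℕ} {E : EncryptionCircuit}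
    (hE : E ∈ (detectInsecure ε δ p).yes) :
    ∃ ψ : Qubits E.n × Qubits E.n → ℂ, ∑ i, ‖ψ i‖ ^ 2 = 1 ∧
      1 - ε ≤ E.protocolAcceptProb (ketbra fun x => ψ x.1 * ψ x.2) := by
  obtain ⟨S, h1, h2⟩ := hE
  refine E.exists_accepted (S := S) ?_ (h2 (Qubits E.n))
  -- The dimension bound enters only through `S` being nonzero.
  have h3 : (0 : ℝ) < ((2 : ℝ) ^ E.n) ^ (1 - δ) := by positivity
  exact_mod_cast h3.trans_le h1

theorem detectInsecure_sound {ε δ : ℝ} {p : Polynomial ℕ} (hε : 0 ≤ ε) {E : EncryptionCircuit}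
    (hE : E ∈ (detectInsecure ε δ p).no)
    {ρ : Op ((Qubits E.n × Qubits E.n) × (Qubits E.n × Qubits E.n))} (hρ : IsDensity ρ) :
    E.protocolAcceptProb ρ ≤ 1 / 2 + 1 / (2 * 2 ^ E.l) + ε :=
  E.protocolAcceptProb_le hε hE.1 hρ

end

theorem mainTheorem4 :
    ∃ V : (E : EncryptionCircuit) → QCircuit ((E.n + E.n) + (E.n + E.n)) 1,
      (∀ (E : EncryptionCircuit) (ρ : Op (Qubits ((E.n + E.n) + (E.n + E.n)))), IsDensity ρ →
        (V E).acceptProb ρ = E.protocolAcceptProb (ρ.submatrix joinRegisters joinRegisters)) ∧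
      ∀ (ε δ : ℝ) (p : Polynomial ℕ), 0 < ε → ε < 1 / 8 → 0 < δ → δ ≤ 1 →
        IsQMAProtocol EncryptionCircuit.encode (detectInsecure ε δ p) (1 - ε) (3 / 4 + ε)
          (fun E => ⟨_, V E⟩) ∧
        (∀ E ∈ (detectInsecure ε δ p).yes,
          ∃ ψ : Qubits E.n × Qubits E.n → ℂ, ∑ i, ‖ψ i‖ ^ 2 = 1 ∧
            1 - ε ≤ E.protocolAcceptProb (Matrix.vecMulVec
              (fun x => ψ x.1 * ψ x.2) (star fun x => ψ x.1 * ψ x.2))) ∧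
        (∀ E ∈ (detectInsecure ε δ p).no, ∀ ρ, IsDensity ρ →
          E.protocolAcceptProb ρ ≤ 1 / 2 + 1 / (2 * 2 ^ E.l) + ε) := by
  choose V hV hacc using exists_verifier
  refine ⟨V, fun E ρ _ => hacc E ρ, fun ε δ p hε hε' _ _ => ⟨⟨polyTime_of_symbols V hV, ?_, ?_, ?_⟩,
    fun E hE => detectInsecure_complete hE, fun E hE ρ hρ => detectInsecure_sound hε.le hE hρ⟩⟩
  -- The gap 3/4 + ε < 1 - ε is exactly ε < 1/8.
  · refine ⟨?_, ?_, ?_⟩ <;> linarith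
  · intro E hE
    obtain ⟨ψ, h1, h2⟩ := detectInsecure_complete hE
    have hd : IsDensity (ketbra fun x : (Qubits E.n × Qubits E.n) × (Qubits E.n × Qubits E.n) =>
        ψ x.1 * ψ x.2) := isDensity_ketbra (by rw [sum_norm_sq_mul, h1, one_mul])
    refine ⟨_, hd.submatrix_equiv (joinRegistersEquiv E.n).symm, ?_⟩
    rw [hacc, ← coe_joinRegistersEquiv]
    simpa using h2
  · intro E hE ρ hρ
    rw [hacc, ← coe_joinRegistersEquiv]
    refine (detectInsecure_sound hε.le hE (hρ.submatrix_equiv _)).trans ?_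
    -- There is at least one output qubit, so the term 1/(2 dim K) is at most 1/4.
    have h1 : (2 : ℝ) ≤ 2 ^ E.l := le_self_pow₀ one_le_two E.pos.ne'
    have h2 : 1 / (2 * 2 ^ E.l : ℝ) ≤ 1 / 4 := one_div_le_one_div_of_le (by norm_num) (by linarith)
    linarith
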